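/- Let $k\in\mathbb N$, $T>0$, $\mathbb T^k=\mathbb R^k/\mathbb Z^k$. Functions on $\mathbb T^k$ are identified with $\mathbb Z^k$-periodic functions on $\mathbb R^k$, and subsets of $T^*\mathbb T^k=\mathbb T^k\times\mathbb R^k$ with their preimages in $\mathbb R^{2k}$. Let $H\in C^2([0,T]\times T^*\mathbb T^k)$ be of the form $$H(t,x,p)=\tfrac12\langle Ap,p\rangle+V(t,x,p),\qquad A^{t}=A,\ \det A\neq0,$$ where $V$ is compactly supported in $p$: there is $R$ with $V(t,x,p)=0$ for all $(t,x)\in[0,T]\times\mathbb T^k$ and $|p|>R$. Assume $(\star)$ for all $t\in[0,T]$ and $x$, the map $p\mapsto D_pH(t,x,p)$ is a $C^1$ diffeomorphism of $\mathbb R^k$ onto itself which is Lipschitz together with its inverse, with a constant independent of $(t,x)$. Then Hamilton's equations of $H$ have, for every initial time $s\in[0,T]$ and every initial point of $\mathbb R^{2k}$, exactly one solution on $[0,T]$; let $\phi_H^{t,s}$, $s,t\in[0,T]$, denote the flow. Moreover there is $N_0\in\mathbb N$ such that for all $N\ge N_0$ and all $t\in(0,T]$ the following holds, with $\varepsilon=t/(N+1)$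 and $t_j=j\varepsilon$, $0\le j\le N+1$. 1. For $0\le j\le N$ the map $(X,P)\mapsto(X,x)$, where $(x,p)=\phi_H^{t_{j+1},t_j}(X,P)$, is a $C^1$ diffeomorphism of $\mathbb R^{2k}$. Hence for all $X,Y\in\mathbb R^k$ there is exactly one trajectory $(x(\tau),p(\tau))$ with $x(t_j)=X$, $x(t_{j+1})=Y$; put $$S_{t_j}^{t_{j+1}}(X,Y)=\int_{t_j}^{t_{j+1}}\Big(\langle p(\tau),\dot x(\tau)\rangle-H(\tau,x(\tau),p(\tau))\Big)\,d\tau .$$ 2. For $U=(X_1,\dots,X_N)\in\mathbb R^{Nk}$, $X_0=X$, $X_{N+1}=x$, the function $S^t_0(X,x;U)=\sum_{j=0}^N S_{t_j}^{t_{j+1}}(X_j,X_{j+1})$ generates $\phi_H^{t,0}$: one has $\phi^{t,0}_H(X,P)=(x,p)$ if and only if there is $U$ with $\partial_US^t_0=0$, $P=-\partial_XS^t_0$, $p=\partial_xS^t_0$ at $(X,x;U)$. 3. For every $\sigma\in C^1(\mathbb T^k)$ the broken-geodesic function $S^t(x;\xi,U)=\sigma(\xi)+S^t_0(\xi,x;U)$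 is of class $C^1$ and generates the wavefront $\phi_H^{t,0}(\operatorname{Im}d\sigma)$: $$\phi_H^{t,0}(\operatorname{Im}d\sigma)=\{(x,\partial_xS^t(x;\xi,U)):\ \partial_{(\xi,U)}S^t(x;\xi,U)=0\}.$$ If $\sigma$ is of class $C^2$, then so is $S^t$, and $0$ is a regular value of $(x;\xi,U)\mapsto\partial_{(\xi,U)}S^t$. 4. $S^t$ is quadratic at infinity, with the nondegenerate quadratic form of the $(N+1)k\times(N+1)k$ block-diagonal matrix $\mathbf A=\operatorname{diag}(A,\dots,A)$, in the following sense. Use, in place of $(\xi,U)=(X_0,\dots,X_N)$, the variables $\eta=(\eta_0,\dots,\eta_N)\in\mathbb R^{(N+1)k}$ with $\eta_j=A^{-1}(X_{j+1}-X_j)$, $X_{N+1}=x$, and write $\tilde S(x;\eta)=S^t(x;\xi,U)$. Then $\tilde S$ is $\mathbb Z^k$-periodic in $x$, and there is a fibered $C^1$ diffeomorphism $(x,\eta)\mapsto(x,\Psi(x,\eta))$ of $\mathbb T^k\times\mathbb R^{(N+1)k}$ ($\Psi$ is of class $C^1$, and each $\Psi(x,\cdot)$ is a $C^1$ diffeomorphism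 of $\mathbb R^{(N+1)k}$), with $\Psi(x,\eta)-\eta$ bounded, such that the function $(x,\eta)\mapsto\tilde S(x;\Psi(x,\eta))$ is of class $C^1$, $\mathbb Z^k$-periodic in $x$, still generates $\phi_H^{t,0}(\operatorname{Im}d\sigma)$, and for some $C>0$ satisfies $$\tilde S(x;\Psi(x,\eta))=\frac1{2\varepsilon}\langle\mathbf A\eta,\eta\rangle\qquad\text{for all }x\text{ and all }|\eta|>C .$$ -/

import Mathlib

open Set

/-- The Euclidean space `ℝ^k`. The torus is `𝕋^k = ℝ^k / ℤ^k`; functions on `𝕋^k` are treated as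
`ℤ^k`-periodic functions on `ℝ^k`, and subsets of `T^*𝕋^k = 𝕋^k × ℝ^k` through their full
preimages in `ℝ^k × ℝ^k`. -/
abbrev EucSp (k : ℕ) : Type := EuclideanSpace ℝ (Fin k)

/-- The vector of `ℝ^k` with integer coordinates `m`. -/
noncomputable def intVec {k : ℕ} (m : Fin k → ℤ) : EucSp k :=
  WithLp.toLp 2 (fun i => (m i : ℝ))

/-- `ℤ^k`-periodicity, for functions with values in an arbitrary type. -/
def ZPeriodic {k : ℕ} {α : Type*} (f : EucSp k → α) : Prop :=
  ∀ (m : Fin k → ℤ) (x : EucSp k), f (x + intVec m) = f x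

/-- `f` is a global `C^1` diffeomorphism from `F` onto `G`. -/
def IsC1Diffeo {F G : Type*} [NormedAddCommGroup F] [NormedSpace ℝ F]
    [NormedAddCommGroup G] [NormedSpace ℝ G] (f : F → G) : Prop :=
  ∃ e : F ≃ G, (∀ z, e z = f z) ∧ ContDiff ℝ 1 e ∧ ContDiff ℝ 1 e.symm

/-- Condition `(⋆)`: each map `p ↦ D_p H(t,x,p)`, `t ∈ [0,T]`, is a global diffeomorphism of `ℝ^k`
which is Lipschitz together with its inverse, with a constant independent of `(t,x)`. -/
def StarCondition {k : ℕ} (H : ℝ → EucSp k → EucSp k → ℝ) (T : ℝ) : Prop :=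
  ∃ K : NNReal, ∀ t ∈ Icc 0 T, ∀ x : EucSp k, ∃ e : EucSp k ≃ EucSp k,
    (∀ p, e p = gradient (H t x) p) ∧ ContDiff ℝ 1 e ∧ ContDiff ℝ 1 e.symm ∧
      LipschitzWith K e ∧ LipschitzWith K e.symm

/-- `γ = (x,p)` solves Hamilton's equations `x' = D_p H`, `p' = - D_x H` on `[0,T]`
(one-sided derivatives at the end points). -/
def IsHamTrajectory {k : ℕ} (H : ℝ → EucSp k → EucSp k → ℝ) (T : ℝ)
    (γ : ℝ → EucSp k × EucSp k) : Prop :=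
  ∀ τ ∈ Icc 0 T, HasDerivWithinAt γ
    (gradient (fun p => H τ (γ τ).1 p) (γ τ).2, - gradient (fun x => H τ x (γ τ).2) (γ τ).1)
    (Icc 0 T) τ

/-- The Hamiltonian vector field of `H` is complete on `[0,T]`: through each point at each time
there is exactly one trajectory on `[0,T]`. -/
def HamComplete {k : ℕ} (H : ℝ → EucSp k → EucSp k → ℝ) (T : ℝ) : Prop :=
  ∀ s ∈ Icc 0 T, ∀ z : EucSp k × EucSp k,
    (∃ γ, IsHamTrajectory H T γ ∧ γ s = z) ∧
      ∀ γ₁ γ₂, IsHamTrajectory H T γ₁ → IsHamTrajectory H T γ₂ → γ₁ s = z → γ₂ s = z →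
        EqOn γ₁ γ₂ (Icc 0 T)

open Classical in
/-- The Hamiltonian flow `φ_H^{t,s}`, for `s, t ∈ [0,T]`: the value at time `t` of the trajectory
which passes through `z` at time `s`. -/
noncomputable def hamFlow {k : ℕ} (H : ℝ → EucSp k → EucSp k → ℝ) (T t s : ℝ)
    (z : EucSp k × EucSp k) : EucSp k × EucSp k :=
  if h : ∃ γ, IsHamTrajectory H T γ ∧ γ s = z then h.choose t else z

/-- The map `(X,P) ↦ (X, x_s^t)`, where `x_s^t` is the position component of `φ_H^{t,s}(X,P)`. -/
noncomputable def twistMap {k : ℕ} (H : ℝ → EucSp k → EucSp k → ℝ) (T t s : ℝ)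
    (z : EucSp k × EucSp k) : EucSp k × EucSp k :=
  (z.1, (hamFlow H T t s z).1)

/-- The initial momentum `P` at time `s` such that the trajectory from `(X,P)` is over `Y` at
time `t` (meaningful when `twistMap` is bijective). -/
noncomputable def startMomentum {k : ℕ} (H : ℝ → EucSp k → EucSp k → ℝ) (T t s : ℝ)
    (X Y : EucSp k) : EucSp k :=
  Function.invFun (fun P => (hamFlow H T t s (X, P)).1) Y

/-- The elementary generating function `S_s^t(X,Y)`: the action `∫ (p · dx/dτ - H) dτ` along the
trajectory which goes from position `X` at time `s` to position `Y` at time `t`. -/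
noncomputable def segmentAction {k : ℕ} (H : ℝ → EucSp k → EucSp k → ℝ) (T t s : ℝ)
    (X Y : EucSp k) : ℝ :=
  ∫ τ in s..t,
    (inner ℝ (hamFlow H T τ s (X, startMomentum H T t s X Y)).2
        (deriv (fun r => (hamFlow H T r s (X, startMomentum H T t s X Y)).1) τ)
      - H τ (hamFlow H T τ s (X, startMomentum H T t s X Y)).1
          (hamFlow H T τ s (X, startMomentum H T t s X Y)).2)

/-- The nodes `t_j = j t / (N+1)` of the subdivision of `[0,t]` into `N+1` equal intervals. -/
noncomputable def node (t : ℝ) (N j : ℕ) : ℝ := (j : ℝ) * (t / ((N : ℝ) + 1))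

/-- The vertices `X_0 = X, X_1 = U_0, …, X_N = U_{N-1}, X_{N+1} = x` of a broken geodesic. -/
def brokenPath {k N : ℕ} (X : EucSp k) (U : Fin N → EucSp k) (x : EucSp k) :
    Fin (N + 2) → EucSp k :=
  Fin.cons (α := fun _ => EucSp k) X (Fin.snoc (α := fun _ => EucSp k) U x)

/-- `S^t_0(X,x;U) = ∑_j S_{t_j}^{t_{j+1}}(X_j, X_{j+1})`. -/
noncomputable def brokenAction {k : ℕ} (H : ℝ → EucSp k → EucSp k → ℝ) (T t : ℝ) {N : ℕ}
    (X x : EucSp k) (U : Fin N → EucSp k) : ℝ :=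
  ∑ j : Fin (N + 1), segmentAction H T (node t N (j + 1)) (node t N j)
    (brokenPath X U x j.castSucc) (brokenPath X U x j.succ)

/-- The broken-geodesic function `S^t(x; ξ, U) = σ(ξ) + S^t_0(ξ, x; U)`. -/
noncomputable def brokenGF {k : ℕ} (H : ℝ → EucSp k → EucSp k → ℝ) (T t : ℝ) (N : ℕ)
    (σ : EucSp k → ℝ) (x : EucSp k) (q : EucSp k × (Fin N → EucSp k)) : ℝ :=
  σ q.1 + brokenAction H T t q.1 x q.2

/-- `S(X,x;U)` generates the canonical transformation `φ`: the graph of `φ` is the set of points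
`((X, -∂S/∂X), (x, ∂S/∂x))` with `∂S/∂U = 0`. -/
def GeneratesMap {k : ℕ} {F : Type*} [NormedAddCommGroup F] [NormedSpace ℝ F]
    (S : EucSp k → EucSp k → F → ℝ) (φ : EucSp k × EucSp k → EucSp k × EucSp k) : Prop :=
  ∀ X P x p : EucSp k, φ (X, P) = (x, p) ↔
    ∃ U : F, fderiv ℝ (S X x) U = 0 ∧ P = - gradient (fun X' => S X' x U) X ∧
      p = gradient (fun x' => S X x' U) x

/-- `S(x;ξ)` generates `L`: `L = {(x, ∂S/∂x) : ∂S/∂ξ = 0}`. -/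
def GeneratesSet {k : ℕ} {F : Type*} [NormedAddCommGroup F] [NormedSpace ℝ F]
    (S : EucSp k → F → ℝ) (L : Set (EucSp k × EucSp k)) : Prop :=
  L = {z | ∃ ξ : F, fderiv ℝ (S z.1) ξ = 0 ∧ z.2 = gradient (fun x => S x ξ) z.1}

/-- `0` is a regular value of `(x,ξ) ↦ ∂S/∂ξ (x,ξ)` (for `S` of class `C^2`). -/
def ZeroIsRegularValue {k : ℕ} {F : Type*} [NormedAddCommGroup F] [NormedSpace ℝ F]
    (S : EucSp k → F → ℝ) : Prop :=
  ∀ z : EucSp k × F, fderiv ℝ (S z.1) z.2 = 0 →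
    Function.Surjective (fderiv ℝ (fun w : EucSp k × F => fderiv ℝ (S w.1) w.2) z)

/-- `Q` is a nondegenerate quadratic form and `S(x;ξ) = Q(ξ)` for all `x` and all `|ξ| > C`. -/
def IsQuadraticAtInfinity {k : ℕ} {F : Type*} [NormedAddCommGroup F] [NormedSpace ℝ F]
    (S : EucSp k → F → ℝ) (Q : QuadraticForm ℝ F) : Prop :=
  (QuadraticMap.polarBilin Q).Nondegenerate ∧
    ∃ C : ℝ, 0 < C ∧ ∀ (x : EucSp k) (ξ : F), C < ‖ξ‖ → S x ξ = Q ξ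

/-- `S` is (the lift of) a `C^1` function on `𝕋^k × F` which generates `L` and is quadratic at
infinity with quadratic form `Q`. -/
def IsGFQI {k : ℕ} {F : Type*} [NormedAddCommGroup F] [NormedSpace ℝ F]
    (S : EucSp k → F → ℝ) (Q : QuadraticForm ℝ F) (L : Set (EucSp k × EucSp k)) : Prop :=
  ZPeriodic S ∧ ContDiff ℝ 1 (fun w : EucSp k × F => S w.1 w.2) ∧ GeneratesSet S L ∧
    IsQuadraticAtInfinity S Q

/-- `(x,η) ↦ (x, Ψ(x,η))` is (the lift of) a fibered `C^1` diffeomorphism of `𝕋^k × F`. -/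
def IsFiberedDiffeo {k : ℕ} {F : Type*} [NormedAddCommGroup F] [NormedSpace ℝ F]
    (Ψ : EucSp k → F → F) : Prop :=
  ZPeriodic Ψ ∧ ContDiff ℝ 1 (fun w : EucSp k × F => Ψ w.1 w.2) ∧ ∀ x, IsC1Diffeo (Ψ x)

/-- The Lagrangian wavefront `φ_H^{t,0}(Im dσ)` (lifted to `ℝ^k × ℝ^k`). -/
noncomputable def wavefront {k : ℕ} (H : ℝ → EucSp k → EucSp k → ℝ) (T t : ℝ)
    (σ : EucSp k → ℝ) : Set (EucSp k × EucSp k) :=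
  hamFlow H T t 0 '' range (fun ξ : EucSp k => (ξ, gradient σ ξ))

/-- The space `ℝ^{(N+1)k}` of the variables `(η_0, …, η_N)`, `η_j = (η (i,j))_i ∈ ℝ^k`. -/
abbrev IncrSp (k N : ℕ) : Type := Fin k × Fin (N + 1) → ℝ

/-- The vertex `X_j = x - ∑_{i ≥ j} A η_i`, `0 ≤ j ≤ N`. -/
noncomputable def vertexOf {k N : ℕ} (A : Matrix (Fin k) (Fin k) ℝ) (x : EucSp k)
    (η : IncrSp k N) (j : Fin (N + 1)) : EucSp k :=
  x - ∑ i ∈ Finset.Ici j, WithLp.toLp 2 (A.mulVec (fun l => η (l, i)))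

/-- The parameters `(ξ,U) = (X_0, (X_1, …, X_N))` as a function of `x = X_{N+1}` and of the
variables `η_j = A⁻¹ (X_{j+1} - X_j)`. -/
noncomputable def incrToParam {k N : ℕ} (A : Matrix (Fin k) (Fin k) ℝ) (x : EucSp k)
    (η : IncrSp k N) : EucSp k × (Fin N → EucSp k) :=
  (vertexOf A x η 0, fun l => vertexOf A x η l.succ)

/-- The quadratic form `η ↦ (1 / 2ε) ⟨diag(A,…,A) η, η⟩` on `ℝ^{(N+1)k}`. -/
noncomputable def blockForm {k : ℕ} (A : Matrix (Fin k) (Fin k) ℝ) (N : ℕ) (ε : ℝ) :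
    QuadraticForm ℝ (IncrSp k N) :=
  (1 / (2 * ε)) • (Matrix.blockDiagonal (fun _ : Fin (N + 1) => A)).toQuadraticForm'

/-!
The Hamiltonian vector field of `H` is the linear field of the kinetic part plus a bounded `C^1`
perturbation, so the flow is global and of class `C^1`, its differential solving the linearized
equation. For small `t - s` the map `P ↦ x` given by `φ_H^{t,s}(X,P) = (x,p)` is, after division
by `t - s`, a small Lipschitz perturbation of the diffeomorphism `D_pH(s,X,·)` of `(⋆)`; hence the
segments are twist maps, and the actions along them satisfy `dS = p dY - P dX`.

The differential of a sum of such actions along a broken geodesic records the jumps of the momentum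
at the vertices: its critical points are the genuine trajectories. Applying independent impulses at
the vertices moves this differential in every direction, which gives the regular value.

Where the momentum is large a segment is free, so each action differs from the action
`⟨A⁻¹(Y - X), Y - X⟩ / 2ε` of a free segment by a bounded function with bounded differential. A
function `Q + f`, with `Q` a nondegenerate quadratic form and `f` of this kind, becomes equal to `Q`
near infinity after a change of variables at bounded distance from the identity.
-/

section IntegralCurves

variable {E : Type*} [NormedAddCommGroup E] [NormedSpace ℝ E]

theorem gronwallBound_le_mul_exp {δ K ε x : ℝ} (hK : 0 ≤ K) (hε : 0 ≤ ε) :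
    gronwallBound δ K ε x ≤ (δ + ε * x) * Real.exp (K * x) := by
  rcases hK.eq_or_lt with rfl | hK
  · simp [gronwallBound_K0]
  have exp_sub_one_le : Real.exp (K * x) - 1 ≤ K * x * Real.exp (K * x) := by
    have hinv : Real.exp (K * x) * Real.exp (-(K * x)) = 1 := by rw [← Real.exp_add]; simp
    nlinarith [Real.exp_pos (K * x), Real.add_one_le_exp (-(K * x))]
  rw [gronwallBound_of_K_ne_0 hK.ne']
  calc δ * Real.exp (K * x) + ε / K * (Real.exp (K * x) - 1)
      ≤ δ * Real.exp (K * x) + ε / K * (K * x * Real.exp (K * x)) := by gcongr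
    _ = (δ + ε * x) * Real.exp (K * x) := by field_simp

theorem norm_le_mul_exp_of_norm_deriv_le {u u' : ℝ → E} {a b K ε δ : ℝ} (hK : 0 ≤ K) (hε : 0 ≤ ε)
    (hu : ∀ τ ∈ Icc a b, HasDerivWithinAt u (u' τ) (Icc a b) τ) (hua : ‖u a‖ ≤ δ)
    (hu' : ∀ τ ∈ Icc a b, ‖u' τ‖ ≤ K * ‖u τ‖ + ε) {τ : ℝ} (hτ : τ ∈ Icc a b) :
    ‖u τ‖ ≤ (δ + ε * (τ - a)) * Real.exp (K * (τ - a)) :=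
  (norm_le_gronwallBound_of_norm_deriv_right_le (fun x hx => (hu x hx).continuousWithinAt)
    (fun x hx => (hu x (Ico_subset_Icc_self hx)).mono_of_mem_nhdsWithin
      (Icc_mem_nhdsGE_of_mem hx)) hua (fun x hx => hu' x (Ico_subset_Icc_self hx)) τ hτ).trans
    (gronwallBound_le_mul_exp hK hε)

theorem eqOn_of_isIntegralCurveOn_Icc {f : ℝ → E → E} {K : NNReal} {a b s : ℝ}
    (hf : ∀ t ∈ Icc a b, LipschitzWith K (f t)) (hs : s ∈ Icc a b) {γ₁ γ₂ : ℝ → E}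
    (h₁ : IsIntegralCurveOn γ₁ f (Icc a b)) (h₂ : IsIntegralCurveOn γ₂ f (Icc a b))
    (h : γ₁ s = γ₂ s) : EqOn γ₁ γ₂ (Icc a b) := by
  rw [← Icc_union_Icc_eq_Icc hs.1 hs.2]
  have hleft : Icc a s ⊆ Icc a b := Icc_subset_Icc_right hs.2
  have hright : Icc s b ⊆ Icc a b := Icc_subset_Icc_left hs.1
  refine EqOn.union ?_ ?_
  · have deriv_left {γ : ℝ → E} (hγ : IsIntegralCurveOn γ f (Icc a b)) :
        ∀ t ∈ Ioc a s, HasDerivWithinAt γ (f t (γ t)) (Iic t) t := fun t ht =>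
      ((hγ.mono hleft) t (Ioc_subset_Icc_self ht)).mono_of_mem_nhdsWithin
        (Icc_mem_nhdsLE_of_mem ht)
    exact ODE_solution_unique_of_mem_Icc_left (s := fun _ => univ)
      (fun t ht => (hf t (hleft (Ioc_subset_Icc_self ht))).lipschitzOnWith)
      (h₁.mono hleft).continuousOn (deriv_left h₁) (fun _ _ => mem_univ _)
      (h₂.mono hleft).continuousOn (deriv_left h₂) (fun _ _ => mem_univ _) h
  · have deriv_right {γ : ℝ → E} (hγ : IsIntegralCurveOn γ f (Icc a b)) :
        ∀ t ∈ Ico s b, HasDerivWithinAt γ (f t (γ t)) (Ici t) t := fun t ht =>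
      ((hγ.mono hright) t (Ico_subset_Icc_self ht)).mono_of_mem_nhdsWithin
        (Icc_mem_nhdsGE_of_mem ht)
    exact ODE_solution_unique_of_mem_Icc_right (s := fun _ => univ)
      (fun t ht => (hf t (hright (Ico_subset_Icc_self ht))).lipschitzOnWith)
      (h₁.mono hright).continuousOn (deriv_right h₁) (fun _ _ => mem_univ _)
      (h₂.mono hright).continuousOn (deriv_right h₂) (fun _ _ => mem_univ _) h

theorem isIntegralCurveOn_ite_le {f : ℝ → E → E} {a b c : ℝ} (hac : a ≤ c) (hcb : c ≤ b)
    {γ₁ γ₂ : ℝ → E} (h₁ : IsIntegralCurveOn γ₁ f (Icc a c)) (h₂ : IsIntegralCurveOn γ₂ f (Icc c b))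
    (h : γ₁ c = γ₂ c) :
    IsIntegralCurveOn (fun τ => if τ ≤ c then γ₁ τ else γ₂ τ) f (Icc a b) := by
  set γ : ℝ → E := fun τ => if τ ≤ c then γ₁ τ else γ₂ τ with hγ
  have eqOn_left : EqOn γ γ₁ (Icc a c) := fun τ hτ => by simp [hγ, hτ.2]
  have eqOn_right : EqOn γ γ₂ (Icc c b) := fun τ hτ => by
    rcases hτ.1.eq_or_lt with rfl | hlt
    · simp [hγ, h]
    · simp [hγ, not_le.2 hlt]
  intro τ _
  rw [← Icc_union_Icc_eq_Icc hac hcb]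
  refine HasDerivWithinAt.union ?_ ?_
  · by_cases hc : τ ∈ Icc a c
    · rw [eqOn_left hc]
      exact (h₁ τ hc).congr eqOn_left (eqOn_left hc)
    · exact HasFDerivWithinAt.of_notMem_closure (by rwa [closure_Icc])
  · by_cases hc : τ ∈ Icc c b
    · rw [eqOn_right hc]
      exact (h₂ τ hc).congr eqOn_right (eqOn_right hc)
    · exact HasFDerivWithinAt.of_notMem_closure (by rwa [closure_Icc])

variable [CompleteSpace E]

theorem exists_isIntegralCurveOn_Icc_of_mul_sub_le {f : ℝ → E → E} {K : NNReal} {a b : ℝ}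
    (hf : ∀ t ∈ Icc a b, LipschitzWith K (f t))
    (hc : ∀ x, ContinuousOn (fun t => f t x) (Icc a b)) (hlen : K * (b - a) ≤ 1 / 2)
    {s : ℝ} (hs : s ∈ Icc a b) (z : E) :
    ∃ γ, IsIntegralCurveOn γ f (Icc a b) ∧ γ s = z := by
  obtain ⟨C, hC⟩ := isCompact_Icc.exists_bound_of_continuousOn (hc z)
  have hC0 : 0 ≤ C := (norm_nonneg _).trans (hC s hs)
  have hab : 0 ≤ b - a := sub_nonneg.2 (hs.1.trans hs.2)
  let r : NNReal := ⟨2 * C * (b - a), by positivity⟩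
  let M : NNReal := ⟨C, hC0⟩ + K * r
  have hr : (r : ℝ) = 2 * C * (b - a) := rfl
  have hM : (M : ℝ) = C + K * r := rfl
  have hPicard : IsPicardLindelof f (⟨s, hs⟩ : Icc a b) z r 0 M K :=
    { lipschitzOnWith := fun t ht => (hf t ht).lipschitzOnWith
      continuousOn := fun x _ => hc x
      norm_le := fun t ht x hx => by
        rw [Metric.mem_closedBall, dist_eq_norm] at hx
        calc ‖f t x‖ ≤ ‖f t z‖ + ‖f t x - f t z‖ := by
              simpa using norm_add_le (f t z) (f t x - f t z)
          _ ≤ C + K * r :=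
              add_le_add (hC t ht) (((hf t ht).norm_sub_le x z).trans (by gcongr))
      mul_max_le := by
        have hmax : max (b - s) (s - a) ≤ b - a :=
          max_le (by linarith [hs.1]) (by linarith [hs.2])
        calc (M : ℝ) * max (b - s) (s - a) ≤ M * (b - a) := by gcongr
          _ ≤ r := by
            rw [hM, hr]
            nlinarith [mul_nonneg hC0 hab, mul_le_mul_of_nonneg_left hlen (mul_nonneg hC0 hab)]
          _ = r - 0 := (sub_zero _).symm }
  obtain ⟨γ, hγs, hγ⟩ := hPicard.exists_eq_forall_mem_Icc_hasDerivWithinAt₀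
  exact ⟨γ, hγ, hγs⟩

theorem exists_isIntegralCurveOn_Icc {f : ℝ → E → E} {K : NNReal} {a b : ℝ}
    (hf : ∀ t ∈ Icc a b, LipschitzWith K (f t))
    (hc : ∀ x, ContinuousOn (fun t => f t x) (Icc a b))
    {s : ℝ} (hs : s ∈ Icc a b) (z : E) :
    ∃ γ, IsIntegralCurveOn γ f (Icc a b) ∧ γ s = z := by
  obtain ⟨n, hn⟩ : ∃ n : ℕ, 2 * K * (b - a) ≤ 2 ^ n :=
    pow_unbounded_of_one_lt _ (by norm_num : (1 : ℝ) < 2) |>.imp fun n h => h.le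
  induction n generalizing a b s z with
  | zero =>
    rw [pow_zero] at hn
    exact exists_isIntegralCurveOn_Icc_of_mul_sub_le hf hc (by linarith) hs z
  | succ n ih =>
    set c := (a + b) / 2 with hcdef
    have hac : a ≤ c := by linarith [hs.1.trans hs.2]
    have hcb : c ≤ b := by linarith [hs.1.trans hs.2]
    have hleft : Icc a c ⊆ Icc a b := Icc_subset_Icc_right hcb
    have hright : Icc c b ⊆ Icc a b := Icc_subset_Icc_left hac
    rw [pow_succ] at hn
    have exists_left {s} (hs : s ∈ Icc a c) z := ih (s := s) (fun t ht => hf t (hleft ht))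
      (fun x => (hc x).mono hleft) hs z (by rw [hcdef]; linarith)
    have exists_right {s} (hs : s ∈ Icc c b) z := ih (s := s) (fun t ht => hf t (hright ht))
      (fun x => (hc x).mono hright) hs z (by rw [hcdef]; linarith)
    rcases le_total s c with hsc | hsc
    · obtain ⟨γ₁, h₁, e₁⟩ := exists_left ⟨hs.1, hsc⟩ z
      obtain ⟨γ₂, h₂, e₂⟩ := exists_right ⟨le_rfl, hcb⟩ (γ₁ c)
      exact ⟨_, isIntegralCurveOn_ite_le hac hcb h₁ h₂ e₂.symm, by simp [hsc, e₁]⟩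
    · obtain ⟨γ₂, h₂, e₂⟩ := exists_right ⟨hsc, hs.2⟩ z
      obtain ⟨γ₁, h₁, e₁⟩ := exists_left ⟨hac, le_rfl⟩ (γ₂ c)
      refine ⟨_, isIntegralCurveOn_ite_le hac hcb h₁ h₂ e₁, ?_⟩
      rcases hsc.eq_or_lt with rfl | hlt
      · simp [e₁, e₂]
      · simp [not_le.2 hlt, e₂]

end IntegralCurves

section Flow

variable {E : Type*} [NormedAddCommGroup E] [NormedSpace ℝ E]
  {f : ℝ → E → E} {f' : ℝ → E → E →L[ℝ] E} {a b M : ℝ} {φ : ℝ → ℝ → E → E}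

/-- A time-dependent vector field on `[a,b] × E` of class `C^1` in the space variable, whose
derivative `f'` is bounded by `M` and uniformly continuous in time and space together. -/
structure IsC1Field (f : ℝ → E → E) (f' : ℝ → E → E →L[ℝ] E) (a b M : ℝ) : Prop where
  nonneg : 0 ≤ M
  hasFDerivAt : ∀ t ∈ Icc a b, ∀ z, HasFDerivAt (f t) (f' t z) z
  bound : ∀ t ∈ Icc a b, ∀ z, ‖f' t z‖ ≤ M
  cont : ContinuousOn (fun q : ℝ × E => f q.1 q.2) (Icc a b ×ˢ univ)
  cont' : ContinuousOn (fun q : ℝ × E => f' q.1 q.2) (Icc a b ×ˢ univ)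
  unif : ∀ ε > 0, ∃ δ > 0, ∀ t ∈ Icc a b, ∀ t' ∈ Icc a b, |t - t'| < δ → ∀ z w, ‖z - w‖ < δ →
    ‖f' t z - f' t' w‖ ≤ ε

/-- `φ t s z` is the value at time `t` of an integral curve of `f` on `[a,b]` which is at `z` at
time `s`. -/
structure IsFlowOn (φ : ℝ → ℝ → E → E) (f : ℝ → E → E) (a b : ℝ) : Prop where
  curve : ∀ s ∈ Icc a b, ∀ z, IsIntegralCurveOn (fun t => φ t s z) f (Icc a b)
  self : ∀ s ∈ Icc a b, ∀ z, φ s s z = z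

/-- `D t s z` solves the linearization of `f` along the trajectory of `φ` which is at `z` at time
`s`, with `D s s z` the identity. -/
structure IsLinearizedFlow (D : ℝ → ℝ → E → E →L[ℝ] E) (φ : ℝ → ℝ → E → E)
    (f' : ℝ → E → E →L[ℝ] E) (a b : ℝ) : Prop where
  deriv : ∀ s ∈ Icc a b, ∀ z, ∀ t ∈ Icc a b,
    HasDerivWithinAt (fun t => D t s z) ((f' t (φ t s z)).comp (D t s z)) (Icc a b) t
  self : ∀ s ∈ Icc a b, ∀ z, D s s z = ContinuousLinearMap.id ℝ E

namespace IsC1Field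

theorem norm_sub_le (h : IsC1Field f f' a b M) {t : ℝ} (ht : t ∈ Icc a b) (z w : E) :
    ‖f t w - f t z‖ ≤ M * ‖w - z‖ :=
  convex_univ.norm_image_sub_le_of_norm_hasFDerivWithin_le
    (fun x _ => (h.hasFDerivAt t ht x).hasFDerivWithinAt) (fun x _ => h.bound t ht x)
    (mem_univ z) (mem_univ w)

theorem lipschitzWith (h : IsC1Field f f' a b M) {t : ℝ} (ht : t ∈ Icc a b) :
    LipschitzWith ⟨M, h.nonneg⟩ (f t) :=
  LipschitzWith.of_dist_le_mul fun x y => by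
    rw [dist_eq_norm, dist_eq_norm]
    exact h.norm_sub_le ht y x

theorem continuousOn_time (h : IsC1Field f f' a b M) (z : E) :
    ContinuousOn (fun t => f t z) (Icc a b) :=
  h.cont.comp (f := fun t : ℝ => (t, z)) (by fun_prop) fun _ ht => ⟨ht, mem_univ _⟩

theorem eqOn (h : IsC1Field f f' a b M) {γ₁ γ₂ : ℝ → E} {s : ℝ} (hs : s ∈ Icc a b)
    (h₁ : IsIntegralCurveOn γ₁ f (Icc a b)) (h₂ : IsIntegralCurveOn γ₂ f (Icc a b))
    (hγ : γ₁ s = γ₂ s) : EqOn γ₁ γ₂ (Icc a b) :=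
  eqOn_of_isIntegralCurveOn_Icc (fun _ ht => h.lipschitzWith ht) hs h₁ h₂ hγ

theorem exists_curve [CompleteSpace E] (h : IsC1Field f f' a b M) {s : ℝ} (hs : s ∈ Icc a b)
    (z : E) : ∃ γ, IsIntegralCurveOn γ f (Icc a b) ∧ γ s = z :=
  exists_isIntegralCurveOn_Icc (fun _ ht => h.lipschitzWith ht) h.continuousOn_time hs z

theorem exists_norm_sub_sub_le (h : IsC1Field f f' a b M) {ε : ℝ} (hε : 0 < ε) :
    ∃ δ > 0, ∀ t ∈ Icc a b, ∀ z w, ‖w - z‖ < δ →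
      ‖f t w - f t z - f' t z (w - z)‖ ≤ ε * ‖w - z‖ := by
  obtain ⟨δ, hδ, hmod⟩ := h.unif ε hε
  refine ⟨δ, hδ, fun t ht z w hw => ?_⟩
  refine (convex_ball z δ).norm_image_sub_le_of_norm_hasFDerivWithin_le'
    (fun x _ => (h.hasFDerivAt t ht x).hasFDerivWithinAt) (fun x hx => ?_)
    (Metric.mem_ball_self hδ) (mem_ball_iff_norm.2 hw)
  exact hmod t ht t ht (by simpa using hδ) x z (mem_ball_iff_norm.1 hx)

end IsC1Field

namespace IsFlowOn

theorem comp_apply (hφ : IsFlowOn φ f a b) (h : IsC1Field f f' a b M) {s r t : ℝ}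
    (hs : s ∈ Icc a b) (hr : r ∈ Icc a b) (ht : t ∈ Icc a b) (z : E) :
    φ t r (φ r s z) = φ t s z :=
  h.eqOn hr (hφ.curve r hr _) (hφ.curve s hs z) (hφ.self r hr _) ht

theorem hasDerivWithinAt_Icc (hφ : IsFlowOn φ f a b) {s : ℝ} (hs : s ∈ Icc a b) (z : E) {t : ℝ}
    (ht : t ∈ Icc s b) : HasDerivWithinAt (fun t => φ t s z) (f t (φ t s z)) (Icc s b) t :=
  ((hφ.curve s hs z).mono (Icc_subset_Icc_left hs.1)) t ht

theorem norm_sub_le (hφ : IsFlowOn φ f a b) (h : IsC1Field f f' a b M) {s t : ℝ}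
    (hs : s ∈ Icc a b) (ht : t ∈ Icc s b) (z w : E) :
    ‖φ t s w - φ t s z‖ ≤ Real.exp (M * (t - s)) * ‖w - z‖ := by
  have hGronwall := norm_le_mul_exp_of_norm_deriv_le (u := fun τ => φ τ s w - φ τ s z)
    (δ := ‖w - z‖) h.nonneg le_rfl
    (fun τ hτ => (hφ.hasDerivWithinAt_Icc hs w hτ).sub (hφ.hasDerivWithinAt_Icc hs z hτ))
    (by simp [hφ.self s hs])
    (fun τ hτ => by simpa using h.norm_sub_le (Icc_subset_Icc_left hs.1 hτ) (φ τ s z) (φ τ s w)) ht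
  simpa [mul_comm] using hGronwall

theorem continuousOn_deriv (hφ : IsFlowOn φ f a b) (h : IsC1Field f f' a b M) {s : ℝ}
    (hs : s ∈ Icc a b) (z : E) : ContinuousOn (fun t => f' t (φ t s z)) (Icc a b) :=
  h.cont'.comp (f := fun t : ℝ => (t, φ t s z))
    (continuousOn_id.prodMk (hφ.curve s hs z).continuousOn) fun _ ht => ⟨ht, mem_univ _⟩

theorem exists_linearized_curve [CompleteSpace E] (hφ : IsFlowOn φ f a b)
    (h : IsC1Field f f' a b M) {s : ℝ} (hs : s ∈ Icc a b) (z : E) :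
    ∃ γ : ℝ → E →L[ℝ] E, IsIntegralCurveOn γ (fun t L => (f' t (φ t s z)).comp L) (Icc a b) ∧
      γ s = ContinuousLinearMap.id ℝ E := by
  refine exists_isIntegralCurveOn_Icc (K := ⟨M, h.nonneg⟩)
    (fun t ht => LipschitzWith.of_dist_le_mul fun L L' => ?_)
    (fun L => (hφ.continuousOn_deriv h hs z).clm_comp continuousOn_const) hs _
  rw [dist_eq_norm, dist_eq_norm, ← ContinuousLinearMap.comp_sub]
  refine (ContinuousLinearMap.opNorm_comp_le _ _).trans ?_
  gcongr
  exact h.bound t ht _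

theorem exists_isLinearizedFlow [CompleteSpace E] (hφ : IsFlowOn φ f a b)
    (h : IsC1Field f f' a b M) : ∃ D, IsLinearizedFlow D φ f' a b := by
  choose! D hD hDs using fun (s : ℝ) (hs : s ∈ Icc a b) => hφ.exists_linearized_curve h hs
  exact ⟨fun t s z => D s z t, ⟨fun s hs z => hD s hs z, fun s hs z => hDs s hs z⟩⟩

end IsFlowOn

namespace IsLinearizedFlow

variable {D : ℝ → ℝ → E → E →L[ℝ] E}

theorem hasDerivWithinAt_Icc (hD : IsLinearizedFlow D φ f' a b) {s : ℝ} (hs : s ∈ Icc a b) (z : E)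
    {t : ℝ} (ht : t ∈ Icc s b) :
    HasDerivWithinAt (fun t => D t s z) ((f' t (φ t s z)).comp (D t s z)) (Icc s b) t :=
  (hD.deriv s hs z t (Icc_subset_Icc_left hs.1 ht)).mono (Icc_subset_Icc_left hs.1)

theorem norm_le (hD : IsLinearizedFlow D φ f' a b) (h : IsC1Field f f' a b M) {s t : ℝ}
    (hs : s ∈ Icc a b) (ht : t ∈ Icc s b) (z : E) : ‖D t s z‖ ≤ Real.exp (M * (t - s)) := by
  have hGronwall := norm_le_mul_exp_of_norm_deriv_le (δ := 1) h.nonneg le_rfl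
    (fun τ hτ => hD.hasDerivWithinAt_Icc hs z hτ)
    (by rw [hD.self s hs]; exact ContinuousLinearMap.norm_id_le)
    (fun τ hτ => by
      rw [add_zero]
      refine (ContinuousLinearMap.opNorm_comp_le _ _).trans ?_
      gcongr
      exact h.bound τ (Icc_subset_Icc_left hs.1 hτ) _) ht
  simpa using hGronwall

theorem norm_sub_id_le (hD : IsLinearizedFlow D φ f' a b) (h : IsC1Field f f' a b M) {s t : ℝ}
    (hs : s ∈ Icc a b) (ht : t ∈ Icc s b) (z : E) :
    ‖D t s z - ContinuousLinearMap.id ℝ E‖ ≤ M * Real.exp (M * (t - s)) * (t - s) := by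
  have hM := h.nonneg
  have hst : Icc s t ⊆ Icc s b := Icc_subset_Icc_right ht.2
  have hmv := norm_image_sub_le_of_norm_deriv_le_segment' (f := fun τ => D τ s z)
    (C := M * Real.exp (M * (t - s)))
    (fun τ hτ => (hD.hasDerivWithinAt_Icc hs z (hst hτ)).mono hst)
    (fun τ hτ => (ContinuousLinearMap.opNorm_comp_le _ _).trans <| by
      have hτ' := hst (Ico_subset_Icc_self hτ)
      gcongr
      · exact h.bound τ (Icc_subset_Icc_left hs.1 hτ') _
      · exact (hD.norm_le h hs hτ' z).trans (by have := hτ.2.le; gcongr))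
    t (right_mem_Icc.2 ht.1)
  rwa [hD.self s hs] at hmv

theorem norm_sub_id_sub_smul_le (hD : IsLinearizedFlow D φ f' a b) (h : IsC1Field f f' a b M)
    {s t η : ℝ} (hs : s ∈ Icc a b) (ht : t ∈ Icc s b) {z : E}
    (hη : ∀ τ ∈ Icc s t, ‖f' τ (φ τ s z) - f' s z‖ ≤ η) :
    ‖D t s z - ContinuousLinearMap.id ℝ E - (t - s) • f' s z‖ ≤
      (η + M * M * (t - s)) * Real.exp (M * (t - s)) * (t - s) := by
  have hM := h.nonneg
  have hη0 : 0 ≤ η := (norm_nonneg _).trans (hη s (left_mem_Icc.2 ht.1))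
  have hst : Icc s t ⊆ Icc s b := Icc_subset_Icc_right ht.2
  have hmv := norm_image_sub_le_of_norm_deriv_le_segment'
    (f := fun τ => D τ s z - (τ - s) • f' s z)
    (f' := fun τ => (f' τ (φ τ s z)).comp (D τ s z) - f' s z)
    (C := (η + M * M * (t - s)) * Real.exp (M * (t - s)))
    (fun τ hτ => by
      refine ((hD.hasDerivWithinAt_Icc hs z (hst hτ)).mono hst).sub ?_
      simpa using (((hasDerivAt_id τ).sub_const s).smul_const (f' s z)).hasDerivWithinAt)
    (fun τ hτ => ?_) t (right_mem_Icc.2 ht.1)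
  · simpa only [hD.self s hs, sub_self, zero_smul, sub_zero, sub_right_comm] using hmv
  have hτ := Ico_subset_Icc_self hτ
  have hle : τ - s ≤ t - s := sub_le_sub_right hτ.2 s
  have hsplit : (f' τ (φ τ s z)).comp (D τ s z) - f' s z =
      (f' τ (φ τ s z) - f' s z).comp (D τ s z) +
        (f' s z).comp (D τ s z - ContinuousLinearMap.id ℝ E) := by
    rw [ContinuousLinearMap.comp_sub, ContinuousLinearMap.sub_comp, ContinuousLinearMap.comp_id]
    abel
  have hvar : ‖(f' τ (φ τ s z) - f' s z).comp (D τ s z)‖ ≤ η * Real.exp (M * (t - s)) :=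
    (ContinuousLinearMap.opNorm_comp_le _ _).trans <| by
      gcongr
      · exact hη τ hτ
      · exact (hD.norm_le h hs (hst hτ) z).trans (by gcongr)
  have hid : ‖(f' s z).comp (D τ s z - ContinuousLinearMap.id ℝ E)‖ ≤
      M * (M * Real.exp (M * (t - s)) * (t - s)) :=
    (ContinuousLinearMap.opNorm_comp_le _ _).trans <| by
      gcongr
      · exact h.bound s hs z
      · have h0 : 0 ≤ τ - s := sub_nonneg.2 hτ.1
        exact (hD.norm_sub_id_le h hs (hst hτ) z).trans (by gcongr)
  rw [hsplit]
  calc _ ≤ _ := norm_add_le_of_le hvar hid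
    _ = _ := by ring

theorem norm_remainder_le (hD : IsLinearizedFlow D φ f' a b) (hφ : IsFlowOn φ f a b)
    (h : IsC1Field f f' a b M) {s t e : ℝ} (hs : s ∈ Icc a b) (ht : t ∈ Icc s b) (he : 0 ≤ e)
    {z w : E} (hf : ∀ τ ∈ Icc s b,
      ‖f τ (φ τ s w) - f τ (φ τ s z) - f' τ (φ τ s z) (φ τ s w - φ τ s z)‖ ≤ e) :
    ‖φ t s w - φ t s z - D t s z (w - z)‖ ≤ e * (t - s) * Real.exp (M * (t - s)) := by
  have hGronwall := norm_le_mul_exp_of_norm_deriv_le (δ := 0) h.nonneg he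
    (fun τ hτ => ((hφ.hasDerivWithinAt_Icc hs w hτ).sub (hφ.hasDerivWithinAt_Icc hs z hτ)).sub
      ((hD.hasDerivWithinAt_Icc hs z hτ).clm_apply (hasDerivWithinAt_const τ _ (w - z))))
    (by simp [hφ.self s hs, hD.self s hs]) (fun τ hτ => ?_) ht
  · simpa using hGronwall
  · have hsplit : f τ (φ τ s w) - f τ (φ τ s z)
          - (((f' τ (φ τ s z)).comp (D τ s z)) (w - z) + D τ s z 0) =
        f' τ (φ τ s z) (φ τ s w - φ τ s z - D τ s z (w - z)) +
          (f τ (φ τ s w) - f τ (φ τ s z) - f' τ (φ τ s z) (φ τ s w - φ τ s z)) := by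
      simp only [map_sub, map_zero, ContinuousLinearMap.comp_apply]
      abel
    rw [hsplit]
    refine (norm_add_le _ _).trans (add_le_add ?_ (hf τ hτ))
    exact (f' τ (φ τ s z)).le_of_opNorm_le (h.bound τ (Icc_subset_Icc_left hs.1 hτ) _) _

theorem norm_sub_le (hD : IsLinearizedFlow D φ f' a b) (h : IsC1Field f f' a b M) {s t e : ℝ}
    (hs : s ∈ Icc a b) (ht : t ∈ Icc s b) (he : 0 ≤ e) {z w : E}
    (hf : ∀ τ ∈ Icc s b, ‖(f' τ (φ τ s w) - f' τ (φ τ s z)).comp (D τ s w)‖ ≤ e) :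
    ‖D t s w - D t s z‖ ≤ e * (t - s) * Real.exp (M * (t - s)) := by
  have hGronwall := norm_le_mul_exp_of_norm_deriv_le (δ := 0) h.nonneg he
    (fun τ hτ => (hD.hasDerivWithinAt_Icc hs w hτ).sub (hD.hasDerivWithinAt_Icc hs z hτ))
    (by simp [hD.self s hs]) (fun τ hτ => ?_) ht
  · simpa using hGronwall
  · have hsplit : (f' τ (φ τ s w)).comp (D τ s w) - (f' τ (φ τ s z)).comp (D τ s z) =
        (f' τ (φ τ s z)).comp (D τ s w - D τ s z) +
          (f' τ (φ τ s w) - f' τ (φ τ s z)).comp (D τ s w) := by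
      simp only [ContinuousLinearMap.comp_sub, ContinuousLinearMap.sub_comp]
      abel
    rw [hsplit]
    refine (norm_add_le _ _).trans (add_le_add ?_ (hf τ hτ))
    exact (ContinuousLinearMap.opNorm_comp_le _ _).trans
      (mul_le_mul_of_nonneg_right (h.bound τ (Icc_subset_Icc_left hs.1 hτ) _) (norm_nonneg _))

end IsLinearizedFlow

theorem IsFlowOn.eventually_norm_sub_lt (hφ : IsFlowOn φ f a b) (h : IsC1Field f f' a b M) {s : ℝ}
    (hs : s ∈ Icc a b) {δ : ℝ} (hδ : 0 < δ) (z : E) :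
    ∀ᶠ w in nhds z, ∀ τ ∈ Icc s b, ‖φ τ s w - φ τ s z‖ < δ := by
  have hM := h.nonneg
  filter_upwards [Metric.ball_mem_nhds z (div_pos hδ (Real.exp_pos (M * (b - s))))] with w hw τ hτ
  rw [mem_ball_iff_norm, lt_div_iff₀' (Real.exp_pos _)] at hw
  refine lt_of_le_of_lt ?_ hw
  refine (hφ.norm_sub_le h hs hτ z w).trans ?_
  gcongr
  exact hτ.2

namespace IsLinearizedFlow

variable {D : ℝ → ℝ → E → E →L[ℝ] E}

theorem hasFDerivAt (hD : IsLinearizedFlow D φ f' a b) (hφ : IsFlowOn φ f a b)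
    (h : IsC1Field f f' a b M) {s t : ℝ} (hs : s ∈ Icc a b) (ht : t ∈ Icc s b) (z : E) :
    HasFDerivAt (φ t s) (D t s z) z := by
  have hM := h.nonneg
  rw [hasFDerivAt_iff_isLittleO, Asymptotics.isLittleO_iff]
  intro c hc
  set C := Real.exp (M * (b - s))
  have hC : ∀ τ ∈ Icc s b, Real.exp (M * (τ - s)) ≤ C := fun τ hτ =>
    Real.exp_le_exp.2 (mul_le_mul_of_nonneg_left (sub_le_sub_right hτ.2 s) hM)
  obtain ⟨ε, hε, hεc⟩ := exists_pos_mul_lt hc (C * (t - s) * Real.exp (M * (t - s)))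
  obtain ⟨δ, hδ, hlin⟩ := h.exists_norm_sub_sub_le hε
  filter_upwards [hφ.eventually_norm_sub_lt h hs hδ z] with w hw
  calc ‖φ t s w - φ t s z - D t s z (w - z)‖
      ≤ ε * (C * ‖w - z‖) * (t - s) * Real.exp (M * (t - s)) :=
        hD.norm_remainder_le hφ h hs ht (by positivity) fun τ hτ => by
          refine (hlin τ (Icc_subset_Icc_left hs.1 hτ) _ _ (hw τ hτ)).trans ?_
          gcongr
          refine (hφ.norm_sub_le h hs hτ z w).trans ?_
          gcongr
          exact hC τ hτ
    _ = C * (t - s) * Real.exp (M * (t - s)) * ε * ‖w - z‖ := by ring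
    _ ≤ c * ‖w - z‖ := by gcongr

theorem continuous (hD : IsLinearizedFlow D φ f' a b) (hφ : IsFlowOn φ f a b)
    (h : IsC1Field f f' a b M) {s t : ℝ} (hs : s ∈ Icc a b) (ht : t ∈ Icc s b) :
    Continuous (D t s) := by
  have hM := h.nonneg
  rw [Metric.continuous_iff']
  intro z c hc
  set C := Real.exp (M * (b - s))
  have hC : ∀ τ ∈ Icc s b, Real.exp (M * (τ - s)) ≤ C := fun τ hτ =>
    Real.exp_le_exp.2 (mul_le_mul_of_nonneg_left (sub_le_sub_right hτ.2 s) hM)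
  obtain ⟨ε, hε, hεc⟩ := exists_pos_mul_lt hc (C * (t - s) * Real.exp (M * (t - s)))
  obtain ⟨δ, hδ, hmod⟩ := h.unif ε hε
  filter_upwards [hφ.eventually_norm_sub_lt h hs hδ z] with w hw
  rw [dist_eq_norm]
  calc ‖D t s w - D t s z‖ ≤ ε * C * (t - s) * Real.exp (M * (t - s)) :=
        hD.norm_sub_le h hs ht (by positivity) fun τ hτ => by
          have hτ' := Icc_subset_Icc_left hs.1 hτ
          refine (ContinuousLinearMap.opNorm_comp_le _ _).trans ?_
          gcongr
          · exact hmod τ hτ' τ hτ' (by simpa using hδ) _ _ (hw τ hτ)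
          · exact (hD.norm_le h hs hτ w).trans (hC τ hτ)
    _ = C * (t - s) * Real.exp (M * (t - s)) * ε := by ring
    _ < c := hεc

theorem contDiff (hD : IsLinearizedFlow D φ f' a b) (hφ : IsFlowOn φ f a b)
    (h : IsC1Field f f' a b M) {s t : ℝ} (hs : s ∈ Icc a b) (ht : t ∈ Icc s b) :
    ContDiff ℝ 1 (φ t s) :=
  contDiff_one_iff_hasFDerivAt.2 ⟨D t s, hD.continuous hφ h hs ht, hD.hasFDerivAt hφ h hs ht⟩

end IsLinearizedFlow

end Flow

section Regularity

theorem exists_norm_add_intVec_le (k : ℕ) :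
    ∃ ρ : ℝ, ∀ x : EucSp k, ∃ m : Fin k → ℤ, ‖x + intVec m‖ ≤ ρ := by
  refine ⟨Real.sqrt k, fun x => ⟨fun i => -⌊x i⌋, ?_⟩⟩
  rw [EuclideanSpace.norm_eq]
  have hcoord : ∀ i ∈ Finset.univ, ‖(x + intVec fun i => -⌊x i⌋ : EucSp k) i‖ ^ 2 ≤ (1 : ℝ) := by
    intro i _
    have hfract : (x + intVec fun i => -⌊x i⌋ : EucSp k) i = Int.fract (x i) := by
      simp [intVec, Int.fract, sub_eq_add_neg]
    rw [hfract, Real.norm_eq_abs, sq_abs]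
    exact pow_le_one₀ (Int.fract_nonneg _) (Int.fract_lt_one _).le
  exact Real.sqrt_le_sqrt (by simpa using Finset.sum_le_sum hcoord)

theorem exists_norm_add_intVec_prod_le (k : ℕ) (R : ℝ) :
    ∃ ρ : ℝ, ∀ z : EucSp k × EucSp k, ‖z.2‖ ≤ R →
      ∃ m : Fin k → ℤ, ‖z + (intVec m, (0 : EucSp k))‖ ≤ ρ := by
  obtain ⟨ρ, hρ⟩ := exists_norm_add_intVec_le k
  refine ⟨max ρ R, fun z hz => ?_⟩
  obtain ⟨m, hm⟩ := hρ z.1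
  exact ⟨m, by rw [Prod.norm_def]; exact max_le_max hm (by simpa using hz)⟩

section Periodic

variable {k : ℕ} {G : Type*} [NormedAddCommGroup G] {g : ℝ → EucSp k × EucSp k → G} {a b R : ℝ}

theorem exists_norm_le_of_periodic
    (hg : ContinuousOn (fun q : ℝ × EucSp k × EucSp k => g q.1 q.2) (Icc a b ×ˢ univ))
    (hper : ∀ t ∈ Icc a b, ∀ m z, g t (z + (intVec m, 0)) = g t z)
    (hR : ∀ t ∈ Icc a b, ∀ z : EucSp k × EucSp k, R < ‖z.2‖ → g t z = 0) :
    ∃ M, 0 ≤ M ∧ ∀ t ∈ Icc a b, ∀ z, ‖g t z‖ ≤ M := by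
  obtain ⟨ρ, hρ⟩ := exists_norm_add_intVec_prod_le k R
  obtain ⟨C, hC⟩ := (isCompact_Icc.prod (isCompact_closedBall (0 : EucSp k × EucSp k)
    ρ)).exists_bound_of_continuousOn (hg.mono (prod_mono_right (subset_univ _)))
  refine ⟨max C 0, le_max_right _ _, fun t ht z => ?_⟩
  rcases lt_or_ge R ‖z.2‖ with hz | hz
  · simp [hR t ht z hz]
  · obtain ⟨m, hm⟩ := hρ z hz
    rw [← hper t ht m z]
    exact (hC (t, z + (intVec m, 0)) ⟨ht, mem_closedBall_zero_iff.2 hm⟩).trans (le_max_left _ _)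

theorem exists_norm_sub_le_of_periodic
    (hg : ContinuousOn (fun q : ℝ × EucSp k × EucSp k => g q.1 q.2) (Icc a b ×ˢ univ))
    (hper : ∀ t ∈ Icc a b, ∀ m z, g t (z + (intVec m, 0)) = g t z)
    (hR : ∀ t ∈ Icc a b, ∀ z : EucSp k × EucSp k, R < ‖z.2‖ → g t z = 0) {ε : ℝ} (hε : 0 < ε) :
    ∃ δ > 0, ∀ t ∈ Icc a b, ∀ t' ∈ Icc a b, |t - t'| < δ → ∀ z w, ‖z - w‖ < δ →
      ‖g t z - g t' w‖ ≤ ε := by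
  obtain ⟨ρ, hρ⟩ := exists_norm_add_intVec_prod_le k (R + 1)
  have hunif := (isCompact_Icc.prod (isCompact_closedBall (0 : EucSp k × EucSp k)
    (ρ + 1))).uniformContinuousOn_of_continuous (hg.mono (prod_mono_right (subset_univ _)))
  obtain ⟨δ, hδ, hgδ⟩ := Metric.uniformContinuousOn_iff.1 hunif ε hε
  refine ⟨min δ 1, by positivity, fun t ht t' ht' htt z w hzw => ?_⟩
  have hzw1 : ‖z - w‖ < 1 := hzw.trans_le (min_le_right _ _)
  rcases lt_or_ge (R + 1) ‖z.2‖ with hz | hz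
  · have hw : R < ‖w.2‖ := by
      have hsnd : ‖z.2 - w.2‖ ≤ ‖z - w‖ := norm_snd_le (z - w)
      linarith [norm_sub_norm_le z.2 w.2]
    simpa [hR t ht z (by linarith), hR t' ht' w hw] using hε.le
  · obtain ⟨m, hm⟩ := hρ z hz
    have hdist : dist (z + (intVec m, (0 : EucSp k))) (w + (intVec m, 0)) = ‖z - w‖ := by
      rw [dist_add_right, dist_eq_norm]
    have hw : ‖w + (intVec m, (0 : EucSp k))‖ ≤ ρ + 1 := by
      have := norm_le_norm_add_norm_sub (z + (intVec m, (0 : EucSp k))) (w + (intVec m, 0))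
      rw [← dist_eq_norm, hdist] at this
      linarith
    rw [← hper t ht m z, ← hper t' ht' m w, ← dist_eq_norm]
    refine (hgδ (t, z + (intVec m, 0)) ⟨ht, mem_closedBall_zero_iff.2 (hm.trans (by linarith))⟩
      (t', w + (intVec m, 0)) ⟨ht', mem_closedBall_zero_iff.2 hw⟩ ?_).le
    rw [Prod.dist_eq, max_lt_iff, hdist]
    exact ⟨(Real.dist_eq t t').trans_lt (htt.trans_le (min_le_left _ _)),
      hzw.trans_le (min_le_left _ _)⟩

end Periodic

section Slices

variable {E F G : Type*} [NormedAddCommGroup E] [NormedSpace ℝ E] [NormedAddCommGroup F]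
  [NormedSpace ℝ F] [NormedAddCommGroup G] [NormedSpace ℝ G]

theorem hasFDerivAt_slice {g : ℝ → E → G} {s : Set ℝ}
    (hg : DifferentiableOn ℝ (fun q : ℝ × E => g q.1 q.2) (s ×ˢ univ)) {t : ℝ} (ht : t ∈ s)
    (z : E) :
    HasFDerivAt (g t) ((fderivWithin ℝ (fun q : ℝ × E => g q.1 q.2) (s ×ˢ univ) (t, z)).comp
      (ContinuousLinearMap.inr ℝ ℝ E)) z :=
  ((hg (t, z) ⟨ht, mem_univ _⟩).hasFDerivWithinAt.comp z
    (hasFDerivAt_prodMk_right t z).hasFDerivWithinAt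
    (fun _ _ => ⟨ht, mem_univ _⟩)).hasFDerivAt_of_univ

theorem contDiffOn_fderiv_slice {g : ℝ → E → G} {s : Set ℝ} (hs : UniqueDiffOn ℝ s)
    {n : WithTop ℕ∞}
    (hg : ContDiffOn ℝ (n + 1) (fun q : ℝ × E => g q.1 q.2) (s ×ˢ univ)) :
    ContDiffOn ℝ n (fun q : ℝ × E => fderiv ℝ (g q.1) q.2) (s ×ˢ univ) :=
  ((hg.fderivWithin (hs.prod uniqueDiffOn_univ) le_rfl).clm_comp contDiffOn_const).congr
    fun q hq => (hasFDerivAt_slice (hg.differentiableOn (by simp)) hq.1 q.2).fderiv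

theorem fderiv_add_of_periodic {g : E → G} {v : E} (hg : ∀ z, g (z + v) = g z) (z : E) :
    fderiv ℝ g (z + v) = fderiv ℝ g z := by
  rw [← fderiv_comp_add_right]
  exact congrArg (fderiv ℝ · z) (funext hg)

theorem fderiv_eq_zero_of_lt_norm_snd {g : E × F → G} {R : ℝ} (hg : ∀ z, R < ‖z.2‖ → g z = 0)
    {z : E × F} (hz : R < ‖z.2‖) : fderiv ℝ g z = 0 := by
  have hopen : IsOpen {z : E × F | R < ‖z.2‖} := isOpen_lt continuous_const (by fun_prop)
  have hzero : g =ᶠ[nhds z] fun _ => 0 := Filter.eventually_of_mem (hopen.mem_nhds hz) hg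
  rw [hzero.fderiv_eq, fderiv_fun_const, Pi.zero_apply]

end Slices

theorem exists_isC1Field_of_periodic {k : ℕ} {b : ℝ → EucSp k × EucSp k → EucSp k × EucSp k}
    {T R : ℝ} (hT : 0 < T)
    (hb : ContDiffOn ℝ 1 (fun q : ℝ × EucSp k × EucSp k => b q.1 q.2) (Icc 0 T ×ˢ univ))
    (hper : ∀ t ∈ Icc 0 T, ∀ m z, b t (z + (intVec m, 0)) = b t z)
    (hR : ∀ t ∈ Icc 0 T, ∀ z : EucSp k × EucSp k, R < ‖z.2‖ → b t z = 0) :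
    ∃ M, IsC1Field b (fun t => fderiv ℝ (b t)) 0 T M ∧ ∀ t ∈ Icc 0 T, ∀ z, ‖b t z‖ ≤ M := by
  have hcont' : ContinuousOn (fun q : ℝ × EucSp k × EucSp k => fderiv ℝ (b q.1) q.2)
      (Icc 0 T ×ˢ univ) :=
    (contDiffOn_fderiv_slice (n := 0) (uniqueDiffOn_Icc hT) (by simpa using hb)).continuousOn
  have hper' : ∀ t ∈ Icc 0 T, ∀ m z, fderiv ℝ (b t) (z + (intVec m, 0)) = fderiv ℝ (b t) z :=
    fun t ht m => fderiv_add_of_periodic (hper t ht m)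
  have hR' : ∀ t ∈ Icc 0 T, ∀ z : EucSp k × EucSp k, R < ‖z.2‖ → fderiv ℝ (b t) z = 0 :=
    fun t ht _ => fderiv_eq_zero_of_lt_norm_snd (hR t ht)
  obtain ⟨M, hM, hbM⟩ := exists_norm_le_of_periodic hb.continuousOn hper hR
  obtain ⟨M', -, hbM'⟩ := exists_norm_le_of_periodic hcont' hper' hR'
  refine ⟨max M M', ?_, fun t ht z => (hbM t ht z).trans (le_max_left _ _)⟩
  exact
    { nonneg := hM.trans (le_max_left _ _)
      hasFDerivAt := fun t ht z =>
        (hasFDerivAt_slice (hb.differentiableOn (by simp)) ht z).differentiableAt.hasFDerivAt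
      bound := fun t ht z => (hbM' t ht z).trans (le_max_right _ _)
      cont := hb.continuousOn
      cont' := hcont'
      unif := fun _ hε => exists_norm_sub_le_of_periodic hcont' hper' hR' hε }

end Regularity

section KineticHamiltonian

variable {k : ℕ}

/-- The Hamiltonian vector field of `H`. -/
noncomputable def hamField (H : ℝ → EucSp k → EucSp k → ℝ) (t : ℝ) (z : EucSp k × EucSp k) :
    EucSp k × EucSp k :=
  (gradient (fun p => H t z.1 p) z.2, - gradient (fun x => H t x z.2) z.1)

/-- The symplectic gradient: the vector `(X₁, X₂)` with `D = ⟨X₁, dp⟩ - ⟨X₂, dx⟩`. -/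
noncomputable def sympGrad : (EucSp k × EucSp k →L[ℝ] ℝ) →L[ℝ] EucSp k × EucSp k :=
  LinearMap.toContinuousLinearMap
    { toFun := fun D =>
        ((InnerProductSpace.toDual ℝ _).symm (D.comp (ContinuousLinearMap.inr ℝ _ _)),
          - (InnerProductSpace.toDual ℝ _).symm (D.comp (ContinuousLinearMap.inl ℝ _ _)))
      map_add' := fun D D' => by
        simp [ContinuousLinearMap.add_comp, add_comm]
      map_smul' := fun c D => by
        simp [ContinuousLinearMap.smul_comp] }

theorem sympGrad_apply (D : EucSp k × EucSp k →L[ℝ] ℝ) :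
    sympGrad D = ((InnerProductSpace.toDual ℝ _).symm (D.comp (ContinuousLinearMap.inr ℝ _ _)),
          - (InnerProductSpace.toDual ℝ _).symm (D.comp (ContinuousLinearMap.inl ℝ _ _))) := rfl

/-- The contraction of the symplectic form with a vector `X`: the linear form
`h ↦ ⟨X₁, h₂⟩ - ⟨X₂, h₁⟩`. It is the inverse of `sympGrad`. -/
noncomputable def sympForm (X : EucSp k × EucSp k) : EucSp k × EucSp k →L[ℝ] ℝ :=
  (innerSL ℝ X.1).comp (ContinuousLinearMap.snd ℝ _ _) -
    (innerSL ℝ X.2).comp (ContinuousLinearMap.fst ℝ _ _)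

theorem sympForm_apply (X h : EucSp k × EucSp k) :
    sympForm X h = inner ℝ X.1 h.2 - inner ℝ X.2 h.1 := rfl

theorem sympForm_add (X Y : EucSp k × EucSp k) : sympForm (X + Y) = sympForm X + sympForm Y := by
  ext h
  · simp [sympForm_apply, inner_add_left, add_comm]
  · simp [sympForm_apply, inner_add_left]

theorem sympForm_sympGrad (D : EucSp k × EucSp k →L[ℝ] ℝ) : sympForm (sympGrad D) = D := by
  refine ContinuousLinearMap.ext fun h => ?_
  simp only [sympForm_apply, sympGrad_apply, InnerProductSpace.toDual_symm_apply, inner_neg_left,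
    sub_neg_eq_add, ContinuousLinearMap.comp_apply, ContinuousLinearMap.inl_apply,
    ContinuousLinearMap.inr_apply, ← map_add, Prod.mk_add_mk, zero_add, add_zero, Prod.mk.eta]

theorem sympGrad_sympForm (X : EucSp k × EucSp k) : sympGrad (sympForm X) = X := by
  rw [sympGrad_apply]
  refine Prod.ext (ext_inner_right ℝ fun v => ?_) (ext_inner_right ℝ fun v => ?_)
  · simp [sympForm_apply]
  · simp [sympForm_apply]

theorem hamField_eq_sympGrad {H : ℝ → EucSp k → EucSp k → ℝ} {t : ℝ} {z : EucSp k × EucSp k}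
    {D : EucSp k × EucSp k →L[ℝ] ℝ}
    (h : HasFDerivAt (fun z : EucSp k × EucSp k => H t z.1 z.2) D z) :
    hamField H t z = sympGrad D := by
  have hp : HasFDerivAt (fun p => H t z.1 p) (D.comp (ContinuousLinearMap.inr ℝ _ _)) z.2 :=
    HasFDerivAt.comp (f := fun p => (z.1, p)) z.2 h (hasFDerivAt_prodMk_right z.1 z.2)
  have hx : HasFDerivAt (fun x => H t x z.2) (D.comp (ContinuousLinearMap.inl ℝ _ _)) z.1 :=
    HasFDerivAt.comp (f := fun x => (x, z.2)) z.1 h (hasFDerivAt_prodMk_left z.1 z.2)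
  rw [hamField, sympGrad_apply, gradient, gradient, hp.fderiv, hx.fderiv]

/-- The field `(x,p) ↦ (L p, 0)` of the kinetic energy `½⟨L p, p⟩`. -/
noncomputable def kinField (L : EucSp k →L[ℝ] EucSp k) :
    EucSp k × EucSp k →L[ℝ] EucSp k × EucSp k :=
  (ContinuousLinearMap.inl ℝ _ _).comp (L.comp (ContinuousLinearMap.snd ℝ _ _))

theorem kinField_apply (L : EucSp k →L[ℝ] EucSp k) (z : EucSp k × EucSp k) :
    kinField L z = (L z.2, 0) := rfl

theorem hasFDerivAt_kineticEnergy {L : EucSp k →L[ℝ] EucSp k}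
    (hL : ∀ x y, inner ℝ (L x) y = inner ℝ x (L y)) (z : EucSp k × EucSp k) :
    HasFDerivAt (fun z : EucSp k × EucSp k => 1 / 2 * inner ℝ (L z.2) z.2)
      (sympForm (kinField L z)) z := by
  have hLsnd : HasFDerivAt (fun z : EucSp k × EucSp k => L z.2)
      (L.comp (ContinuousLinearMap.snd ℝ _ _)) z :=
    HasFDerivAt.comp (g := L) z L.hasFDerivAt hasFDerivAt_snd
  refine ((hLsnd.inner ℝ hasFDerivAt_snd).const_mul (1 / 2)).congr_fderiv ?_
  refine ContinuousLinearMap.ext fun v => ?_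
  have hsymm : inner ℝ (L v.2) z.2 = inner ℝ (L z.2) v.2 := by rw [hL, real_inner_comm]
  simp only [smul_apply, ContinuousLinearMap.comp_apply, ContinuousLinearMap.prod_apply,
    ContinuousLinearMap.coe_snd', fderivInnerCLM_apply, hsymm, smul_eq_mul, sympForm_apply,
    kinField_apply, inner_zero_left, sub_zero]
  ring

/-- `H = ½⟨L p, p⟩ + V` with `V` periodic in `x` and vanishing for `R < |p|`; `b` is the
Hamiltonian vector field of `V`, `b'` its derivative in the space variables, and `M` bounds
both. -/
structure IsKineticHam (L : EucSp k →L[ℝ] EucSp k) (H : ℝ → EucSp k → EucSp k → ℝ)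
    (b : ℝ → EucSp k × EucSp k → EucSp k × EucSp k)
    (b' : ℝ → EucSp k × EucSp k → EucSp k × EucSp k →L[ℝ] EucSp k × EucSp k)
    (T R M : ℝ) : Prop where
  pos : 0 < T
  hasFDerivAt : ∀ t ∈ Icc 0 T, ∀ z, HasFDerivAt (fun z : EucSp k × EucSp k => H t z.1 z.2)
    (sympForm (kinField L z + b t z)) z
  cont : ContinuousOn (fun q : ℝ × EucSp k × EucSp k => H q.1 q.2.1 q.2.2) (Icc 0 T ×ˢ univ)
  field : IsC1Field b b' 0 T M
  field_norm_le : ∀ t ∈ Icc 0 T, ∀ z, ‖b t z‖ ≤ M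
  field_eq_zero : ∀ t ∈ Icc 0 T, ∀ z : EucSp k × EucSp k, R < ‖z.2‖ → b t z = 0
  field_deriv_eq_zero : ∀ t ∈ Icc 0 T, ∀ z : EucSp k × EucSp k, R < ‖z.2‖ → b' t z = 0
  ham_eq : ∀ t ∈ Icc 0 T, ∀ x p : EucSp k, R < ‖p‖ → H t x p = 1 / 2 * inner ℝ (L p) p
  ham_periodic : ∀ t ∈ Icc 0 T, ∀ m x p, H t (x + intVec m) p = H t x p
  field_periodic : ∀ t ∈ Icc 0 T, ∀ m z, b t (z + (intVec m, 0)) = b t z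

theorem contDiffOn_potential {L : EucSp k →L[ℝ] EucSp k} {s : Set ℝ}
    {H V : ℝ → EucSp k → EucSp k → ℝ} {n : WithTop ℕ∞}
    (hreg : ContDiffOn ℝ n (fun q : ℝ × EucSp k × EucSp k => H q.1 q.2.1 q.2.2) (s ×ˢ univ))
    (hform : ∀ t ∈ s, ∀ x p : EucSp k, H t x p = 1 / 2 * inner ℝ (L p) p + V t x p) :
    ContDiffOn ℝ n (fun q : ℝ × EucSp k × EucSp k => V q.1 q.2.1 q.2.2) (s ×ˢ univ) := by
  have hkin : ContDiff ℝ n (fun q : ℝ × EucSp k × EucSp k => 1 / 2 * inner ℝ (L q.2.2) q.2.2) :=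
    contDiff_const.mul ((L.contDiff.comp (contDiff_snd.comp contDiff_snd)).inner ℝ
      (contDiff_snd.comp contDiff_snd))
  exact (hreg.sub hkin.contDiffOn).congr fun q hq => by rw [hform q.1 hq.1, add_sub_cancel_left]

theorem exists_isKineticHam {L : EucSp k →L[ℝ] EucSp k}
    (hL : ∀ x y, inner ℝ (L x) y = inner ℝ x (L y))
    {T : ℝ} (hT : 0 < T) {H V : ℝ → EucSp k → EucSp k → ℝ}
    (hreg : ContDiffOn ℝ 2 (fun q : ℝ × EucSp k × EucSp k => H q.1 q.2.1 q.2.2)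
      (Icc 0 T ×ˢ univ))
    (hform : ∀ t ∈ Icc 0 T, ∀ x p : EucSp k, H t x p = 1 / 2 * inner ℝ (L p) p + V t x p)
    (hper : ∀ t ∈ Icc 0 T, ZPeriodic (V t)) {R : ℝ}
    (hsupp : ∀ t ∈ Icc 0 T, ∀ x p : EucSp k, R < ‖p‖ → V t x p = 0) :
    ∃ b b' M, IsKineticHam L H b b' T R M := by
  let g : ℝ → EucSp k × EucSp k → ℝ := fun t z => V t z.1 z.2
  have hg : ContDiffOn ℝ (1 + 1) (fun q : ℝ × EucSp k × EucSp k => g q.1 q.2)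
      (Icc 0 T ×ˢ univ) := contDiffOn_potential hreg hform
  have hgper : ∀ t ∈ Icc 0 T, ∀ m z, g t (z + (intVec m, 0)) = g t z := fun t ht m z => by
    simp [g, hper t ht m z.1]
  let b : ℝ → EucSp k × EucSp k → EucSp k × EucSp k := fun t z => sympGrad (fderiv ℝ (g t) z)
  have hb : ContDiffOn ℝ 1 (fun q : ℝ × EucSp k × EucSp k => b q.1 q.2) (Icc 0 T ×ˢ univ) :=
    sympGrad.contDiff.comp_contDiffOn (contDiffOn_fderiv_slice (uniqueDiffOn_Icc hT) hg)
  have hbper : ∀ t ∈ Icc 0 T, ∀ m z, b t (z + (intVec m, 0)) = b t z := fun t ht m z =>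
    congrArg sympGrad (fderiv_add_of_periodic (hgper t ht m) z)
  have hbsupp : ∀ t ∈ Icc 0 T, ∀ z : EucSp k × EucSp k, R < ‖z.2‖ → b t z = 0 :=
    fun t ht z hz => by
      have hzero : fderiv ℝ (g t) z = 0 :=
        fderiv_eq_zero_of_lt_norm_snd (fun w hw => hsupp t ht w.1 w.2 hw) hz
      simp only [b, hzero, map_zero]
  obtain ⟨M, hfield, hbM⟩ := exists_isC1Field_of_periodic hT hb hbper hbsupp
  refine ⟨b, fun t => fderiv ℝ (b t), M, hT, fun t ht z => ?_, hreg.continuousOn, hfield, hbM,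
    hbsupp, fun t ht z hz => fderiv_eq_zero_of_lt_norm_snd (hbsupp t ht) hz,
    fun t ht x p hp => by rw [hform t ht, hsupp t ht x p hp, add_zero],
    fun t ht m x p => by rw [hform t ht, hform t ht, hper t ht m x], hbper⟩
  have hgz : HasFDerivAt (g t) (sympForm (b t z)) z := by
    rw [sympForm_sympGrad]
    exact (hasFDerivAt_slice (hg.differentiableOn (by simp)) ht z).differentiableAt.hasFDerivAt
  rw [sympForm_add]
  exact ((hasFDerivAt_kineticEnergy hL z).add hgz).congr_of_eventuallyEq
    (.of_forall fun w => hform t ht w.1 w.2)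

end KineticHamiltonian

section InverseFunction

theorem bijective_id_add_of_lipschitz {F : Type*} [NormedAddCommGroup F] [CompleteSpace F]
    {d : F → F} {K : NNReal} (hK : K < 1) (hd : LipschitzWith K d) :
    Function.Bijective fun x => x + d x := by
  refine ⟨fun x y (hxy : x + d x = y + d y) => ?_, fun y => ?_⟩
  · have hsub : y - x = d x - d y := by rw [sub_eq_sub_iff_add_eq_add, add_comm (d x), hxy]
    have hle := hd.norm_sub_le x y
    rw [← hsub, norm_sub_rev] at hle
    exact sub_eq_zero.1 (norm_eq_zero.1 (by
      have : (K : ℝ) < 1 := hK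
      nlinarith [norm_nonneg (x - y)]))
  · have hc : ContractingWith K fun x => y - d x :=
      ⟨hK, by simpa using (LipschitzWith.const y).sub hd⟩
    exact ⟨hc.fixedPoint, (sub_eq_iff_eq_add.1 hc.fixedPoint_isFixedPt).symm⟩

theorem bijective_of_lipschitzWith_sub {F : Type*} [NormedAddCommGroup F] [CompleteSpace F]
    {e : F ≃ F} {g : F → F} {K c : NNReal} (he : LipschitzWith K e.symm)
    (hg : LipschitzWith c fun y => g y - e y) (hc : c < K⁻¹) : Function.Bijective g := by
  have hcK : c * K < 1 := (NNReal.lt_inv_iff_mul_lt (fun hK => by simp [hK] at hc)).1 hc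
  have hcomp : g = (fun y => y + (g (e.symm y) - e (e.symm y))) ∘ e := by ext1 y; simp
  rw [hcomp]
  exact (bijective_id_add_of_lipschitz hcK (hg.comp he)).comp e.bijective

theorem antilipschitzWith_of_lipschitzWith_sub {F : Type*} [NormedAddCommGroup F]
    {e : F ≃ F} {g : F → F} {K c : NNReal} (he : LipschitzWith K e.symm)
    (hg : LipschitzWith c fun y => g y - e y) (hc : c < K⁻¹) :
    AntilipschitzWith (K⁻¹ - c)⁻¹ g := by
  simpa only [add_sub_cancel] using (he.to_rightInverse e.symm_apply_apply).add_lipschitzWith hg hc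

theorem norm_le_mul_norm_of_antilipschitzWith {F G : Type*} [NormedAddCommGroup F]
    [NormedSpace ℝ F] [NormedAddCommGroup G] [NormedSpace ℝ G] {g : F → G} {A : F →L[ℝ] G} {y : F}
    (h : HasFDerivAt g A y) {K : NNReal} (hK : AntilipschitzWith K g) (w : F) :
    ‖w‖ ≤ K * ‖A w‖ := by
  have hline : HasDerivAt (fun t : ℝ => g (y + t • w)) (A w) 0 := h.hasLineDerivAt w
  refine ge_of_tendsto (hline.tendsto_slope_zero.norm.const_mul (K : ℝ)) ?_
  filter_upwards [self_mem_nhdsWithin] with t ht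
  have hle := hK.le_mul_dist (y + (0 + t) • w) (y + (0 : ℝ) • w)
  rw [dist_eq_norm, dist_eq_norm, add_sub_add_left_eq_sub, zero_add, zero_smul, sub_zero, norm_smul,
    Real.norm_eq_abs] at hle
  rw [norm_smul, norm_inv, Real.norm_eq_abs, inv_mul_eq_div, ← mul_div_assoc,
    le_div_iff₀ (abs_pos.2 ht)]
  simpa only [zero_add, zero_smul, mul_comm ‖w‖] using hle

theorem injective_fst_prod_of_antilipschitzWith {E F : Type*} [NormedAddCommGroup E]
    [NormedSpace ℝ E] [NormedAddCommGroup F] [NormedSpace ℝ F] {g : E × F → F} {g' : E × F →L[ℝ] F}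
    {z : E × F} (hg : HasFDerivAt g g' z) {K : NNReal}
    (hK : AntilipschitzWith K fun y => g (z.1, y)) :
    Function.Injective ((ContinuousLinearMap.fst ℝ E F).prod g') := by
  rw [injective_iff_map_eq_zero]
  rintro ⟨v, w⟩ hvw
  obtain ⟨hv, hw⟩ := Prod.ext_iff.1 hvw
  obtain rfl : v = 0 := hv
  have hslice : HasFDerivAt (fun y => g (z.1, y)) (g'.comp (ContinuousLinearMap.inr ℝ E F)) z.2 :=
    HasFDerivAt.comp (f := fun y => (z.1, y)) z.2 hg (hasFDerivAt_prodMk_right z.1 z.2)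
  have hle : ‖w‖ ≤ K * ‖g' (0, w)‖ := norm_le_mul_norm_of_antilipschitzWith hslice hK w
  rw [show g' (0, w) = 0 from hw, norm_zero, mul_zero, norm_le_zero_iff] at hle
  rw [hle]
  rfl

variable {E F : Type*} [NormedAddCommGroup E] [NormedSpace ℝ E] [FiniteDimensional ℝ E]
  [NormedAddCommGroup F] [NormedSpace ℝ F] [FiniteDimensional ℝ F]

theorem contDiff_symm_of_injective_fderiv (e : E ≃ E) (he : ContDiff ℝ 1 e)
    (hinj : ∀ z, Function.Injective (fderiv ℝ e z)) : ContDiff ℝ 1 e.symm := by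
  have : CompleteSpace E := FiniteDimensional.complete ℝ E
  let D : E → E ≃L[ℝ] E := fun z =>
    (LinearEquiv.ofInjectiveEndo (fderiv ℝ e z : E →ₗ[ℝ] E) (hinj z)).toContinuousLinearEquiv
  have hD : ∀ z, (D z : E →L[ℝ] E) = fderiv ℝ e z := fun z => by ext; rfl
  have hstrict : ∀ z, HasStrictFDerivAt e (D z : E →L[ℝ] E) z := fun z => by
    rw [hD]; exact he.contDiffAt.hasStrictFDerivAt (by simp)
  have hopen : IsOpenMap e := isOpenMap_of_hasStrictFDerivAt_equiv hstrict
  exact (e.toHomeomorphOfIsInducing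
    (Topology.IsOpenEmbedding.of_continuous_injective_isOpenMap he.continuous e.injective
      hopen).isInducing).contDiff_symm (fun z => (hstrict z).hasFDerivAt) he

theorem exists_fibered_equiv {g : E × F → F} (hg : ContDiff ℝ 1 g)
    (hbij : ∀ x, Function.Bijective fun y => g (x, y))
    (hanti : ∀ x, ∃ K, AntilipschitzWith K fun y => g (x, y)) :
    ∃ e : E × F ≃ E × F, (∀ z, e z = (z.1, g z)) ∧ ContDiff ℝ 1 e ∧ ContDiff ℝ 1 e.symm := by
  have hb : Function.Bijective fun z : E × F => (z.1, g z) := by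
    refine ⟨fun ⟨x, y⟩ ⟨x', y'⟩ h => ?_, fun ⟨x, y⟩ => ?_⟩
    · obtain ⟨hx, hy⟩ := Prod.ext_iff.1 h
      obtain rfl : x = x' := hx
      exact congrArg (Prod.mk x) ((hbij x).1 hy)
    · obtain ⟨y', hy'⟩ := (hbij x).2 y
      exact ⟨(x, y'), Prod.ext rfl hy'⟩
  have hc : ContDiff ℝ 1 (Equiv.ofBijective _ hb) := contDiff_fst.prodMk hg
  refine ⟨Equiv.ofBijective _ hb, fun _ => rfl, hc,
    contDiff_symm_of_injective_fderiv _ hc fun z => ?_⟩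
  have hgz : HasFDerivAt g (fderiv ℝ g z) z := (hg.differentiable (by simp) z).hasFDerivAt
  have hd : HasFDerivAt (Equiv.ofBijective _ hb)
      ((ContinuousLinearMap.fst ℝ E F).prod (fderiv ℝ g z)) z := hasFDerivAt_fst.prodMk hgz
  obtain ⟨K, hK⟩ := hanti z.1
  rw [hd.fderiv]
  exact injective_fst_prod_of_antilipschitzWith hgz hK

theorem exists_fibered_equiv_of_lipschitzWith_sub {g : E × F → F} (hg : ContDiff ℝ 1 g)
    (hsub : ∀ x, ∃ (e : F ≃ F) (K c : NNReal), LipschitzWith K e.symm ∧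
      LipschitzWith c (fun y => g (x, y) - e y) ∧ c < K⁻¹) :
    ∃ e : E × F ≃ E × F, (∀ z, e z = (z.1, g z)) ∧ ContDiff ℝ 1 e ∧ ContDiff ℝ 1 e.symm := by
  have : CompleteSpace F := FiniteDimensional.complete ℝ F
  refine exists_fibered_equiv hg (fun x => ?_) fun x => ?_ <;>
    obtain ⟨e, K, c, he, hge, hc⟩ := hsub x
  · exact bijective_of_lipschitzWith_sub he hge hc
  · exact ⟨_, antilipschitzWith_of_lipschitzWith_sub he hge hc⟩

end InverseFunction

section HamFlow

variable {k : ℕ} {L : EucSp k →L[ℝ] EucSp k} {H : ℝ → EucSp k → EucSp k → ℝ}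
  {b : ℝ → EucSp k × EucSp k → EucSp k × EucSp k}
  {b' : ℝ → EucSp k × EucSp k → EucSp k × EucSp k →L[ℝ] EucSp k × EucSp k}
  {T R M : ℝ}

namespace IsKineticHam

theorem nonneg (h : IsKineticHam L H b b' T R M) : 0 ≤ M := h.field.nonneg

theorem hamField_eq (h : IsKineticHam L H b b' T R M) {t : ℝ} (ht : t ∈ Icc 0 T)
    (z : EucSp k × EucSp k) : hamField H t z = kinField L z + b t z :=
  (hamField_eq_sympGrad (h.hasFDerivAt t ht z)).trans (sympGrad_sympForm _)

theorem isC1Field (h : IsKineticHam L H b b' T R M) :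
    IsC1Field (hamField H) (fun t z => kinField L + b' t z) 0 T (‖kinField L‖ + M) where
  nonneg := add_nonneg (norm_nonneg _) h.nonneg
  hasFDerivAt t ht z := by
    have hsplit : hamField H t = fun z => kinField L z + b t z := funext (h.hamField_eq ht)
    rw [hsplit]
    exact (kinField L).hasFDerivAt.add (h.field.hasFDerivAt t ht z)
  bound t ht z := norm_add_le_of_le le_rfl (h.field.bound t ht z)
  cont := ((((kinField L).continuous.comp continuous_snd).continuousOn).add h.field.cont).congr
    fun q hq => h.hamField_eq hq.1 q.2
  cont' := continuousOn_const.add h.field.cont'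
  unif ε hε := by simpa only [add_sub_add_left_eq_sub] using h.field.unif ε hε

theorem hamComplete (h : IsKineticHam L H b b' T R M) : HamComplete H T := fun _ hs z =>
  ⟨h.isC1Field.exists_curve hs z, fun _ _ h₁ h₂ e₁ e₂ =>
    h.isC1Field.eqOn hs h₁ h₂ (e₁.trans e₂.symm)⟩

theorem isFlowOn (h : IsKineticHam L H b b' T R M) : IsFlowOn (hamFlow H T) (hamField H) 0 T := by
  have hchoice : ∀ s ∈ Icc 0 T, ∀ z, ∃ γ, (fun t => hamFlow H T t s z) = γ ∧
      IsIntegralCurveOn γ (hamField H) (Icc 0 T) ∧ γ s = z := by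
    intro s hs z
    have hex : ∃ γ, IsHamTrajectory H T γ ∧ γ s = z := h.isC1Field.exists_curve hs z
    exact ⟨hex.choose, by funext t; simp only [hamFlow, dif_pos hex], hex.choose_spec⟩
  constructor
  · intro s hs z
    obtain ⟨γ, hflow, hγ, -⟩ := hchoice s hs z
    rwa [hflow]
  · intro s hs z
    obtain ⟨γ, hflow, -, hγs⟩ := hchoice s hs z
    exact (congrFun hflow s).trans hγs

theorem hamFlow_eq (h : IsKineticHam L H b b' T R M) {γ : ℝ → EucSp k × EucSp k} {s t : ℝ}
    (hs : s ∈ Icc 0 T) (ht : t ∈ Icc 0 T) (hγ : IsIntegralCurveOn γ (hamField H) (Icc 0 T)) :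
    hamFlow H T t s (γ s) = γ t :=
  h.isC1Field.eqOn hs (h.isFlowOn.curve s hs _) hγ (h.isFlowOn.self s hs _) ht

theorem hamFlow_add_intVec (h : IsKineticHam L H b b' T R M) {s t : ℝ} (hs : s ∈ Icc 0 T)
    (ht : t ∈ Icc 0 T) (m : Fin k → ℤ) (z : EucSp k × EucSp k) :
    hamFlow H T t s (z + (intVec m, 0)) = hamFlow H T t s z + (intVec m, 0) := by
  have hcurve : IsIntegralCurveOn (fun τ => hamFlow H T τ s z + (intVec m, 0)) (hamField H)
      (Icc 0 T) := by
    intro τ hτ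
    have hperiodic : hamField H τ (hamFlow H T τ s z + (intVec m, 0)) =
        hamField H τ (hamFlow H T τ s z) := by
      simp only [h.hamField_eq hτ, h.field_periodic τ hτ, kinField_apply, Prod.snd_add, add_zero]
    rw [hperiodic]
    exact (h.isFlowOn.curve s hs z τ hτ).add_const _
  have hshift := h.hamFlow_eq hs ht hcurve
  simpa only [h.isFlowOn.self s hs] using hshift

theorem hamFlow_of_lt (h : IsKineticHam L H b b' T R M) {s t : ℝ} (hs : s ∈ Icc 0 T)
    (ht : t ∈ Icc 0 T) {z : EucSp k × EucSp k} (hz : R < ‖z.2‖) :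
    hamFlow H T t s z = (z.1 + (t - s) • L z.2, z.2) := by
  have hcurve : IsIntegralCurveOn (fun τ => (z.1 + (τ - s) • L z.2, z.2)) (hamField H)
      (Icc 0 T) := by
    intro τ hτ
    have hfree : b τ (z.1 + (τ - s) • L z.2, z.2) = 0 := h.field_eq_zero τ hτ _ hz
    rw [h.hamField_eq hτ, hfree, add_zero, kinField_apply]
    refine HasDerivAt.hasDerivWithinAt (HasDerivAt.prodMk ?_ (hasDerivAt_const _ _))
    simpa using (((hasDerivAt_id τ).sub_const s).smul_const (L z.2)).const_add z.1
  simpa using h.hamFlow_eq hs ht hcurve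

theorem norm_momentum_sub_le (h : IsKineticHam L H b b' T R M) {s t : ℝ} (hs : s ∈ Icc 0 T)
    (ht : t ∈ Icc s T) (z : EucSp k × EucSp k) : ‖(hamFlow H T t s z).2 - z.2‖ ≤ M * (t - s) := by
  have hmv := norm_image_sub_le_of_norm_deriv_le_segment' (f := fun τ => (hamFlow H T τ s z).2)
    (f' := fun τ => (hamField H τ (hamFlow H T τ s z)).2) (C := M)
    (fun τ hτ => (h.isFlowOn.hasDerivWithinAt_Icc hs z hτ).snd)
    (fun τ hτ => by
      have hτ' : τ ∈ Icc 0 T := Icc_subset_Icc_left hs.1 (Ico_subset_Icc_self hτ)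
      rw [h.hamField_eq hτ', Prod.snd_add, kinField_apply, zero_add]
      exact (norm_snd_le _).trans (h.field_norm_le τ hτ' _))
    t ht
  rwa [h.isFlowOn.self s hs] at hmv

theorem norm_hamFlow_sub_le (h : IsKineticHam L H b b' T R M) {s t : ℝ} (hs : s ∈ Icc 0 T)
    (ht : t ∈ Icc s T) (z : EucSp k × EucSp k) :
    ‖hamFlow H T t s z - z‖ ≤ (‖L‖ * (‖z.2‖ + M * T) + M) * (t - s) := by
  have hM := h.nonneg
  have hmv := norm_image_sub_le_of_norm_deriv_le_segment' (f := fun τ => hamFlow H T τ s z)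
    (f' := fun τ => hamField H τ (hamFlow H T τ s z)) (C := ‖L‖ * (‖z.2‖ + M * T) + M)
    (fun τ hτ => h.isFlowOn.hasDerivWithinAt_Icc hs z hτ)
    (fun τ hτ => by
      have hτs := Ico_subset_Icc_self hτ
      have hτ' : τ ∈ Icc 0 T := Icc_subset_Icc_left hs.1 hτs
      have hmomentum : ‖(hamFlow H T τ s z).2‖ ≤ ‖z.2‖ + M * T :=
        (norm_le_norm_add_norm_sub' _ z.2).trans <| by
          have hτT : τ - s ≤ T := by linarith [hτs.2, hs.1]
          gcongr
          exact (h.norm_momentum_sub_le hs hτs z).trans (by gcongr)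
      have hkin : ‖kinField L (hamFlow H T τ s z)‖ = ‖L (hamFlow H T τ s z).2‖ := by
        simp [kinField_apply, Prod.norm_def]
      rw [h.hamField_eq hτ']
      refine norm_add_le_of_le ?_ (h.field_norm_le τ hτ' _)
      rw [hkin]
      exact (L.le_opNorm _).trans (by gcongr))
    t ht
  rwa [h.isFlowOn.self s hs] at hmv

theorem exists_norm_deriv_along_sub_le (h : IsKineticHam L H b b' T R M) {η : ℝ} (hη : 0 < η) :
    ∃ ε₀ > 0, ∀ s ∈ Icc 0 T, ∀ t ∈ Icc s T, t - s ≤ ε₀ → ∀ z,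
      ‖b' t (hamFlow H T t s z) - b' s z‖ ≤ η := by
  obtain ⟨δ, hδ, hunif⟩ := h.field.unif η hη
  have hM := h.nonneg
  have hT := h.pos
  set C := ‖L‖ * (max R 0 + M * T) + M
  have hC0 : 0 ≤ C := by positivity
  refine ⟨δ / (2 * (C + 1)), by positivity, fun s hs t ht hts z => ?_⟩
  have ht' : t ∈ Icc 0 T := ⟨hs.1.trans ht.1, ht.2⟩
  have hts0 : 0 ≤ t - s := sub_nonneg.2 ht.1
  rw [le_div_iff₀ (by positivity)] at hts
  rcases lt_or_ge R ‖z.2‖ with hz | hz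
  · have hfree : b' t (z.1 + (t - s) • L z.2, z.2) = 0 := h.field_deriv_eq_zero t ht' _ hz
    rw [h.field_deriv_eq_zero s hs z hz, h.hamFlow_of_lt hs ht' hz, hfree, sub_zero, norm_zero]
    exact hη.le
  · have hspeed : ‖L‖ * (‖z.2‖ + M * T) + M ≤ ‖L‖ * (max R 0 + M * T) + M := by
      gcongr
      exact hz.trans (le_max_left _ _)
    refine hunif t ht' s hs ?_ _ _ ((h.norm_hamFlow_sub_le hs ht z).trans_lt ?_)
    · rw [abs_of_nonneg hts0]
      nlinarith
    · nlinarith [mul_le_mul_of_nonneg_right hspeed hts0]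

theorem exists_norm_linearized_sub_le (h : IsKineticHam L H b b' T R M)
    {D : ℝ → ℝ → EucSp k × EucSp k → EucSp k × EucSp k →L[ℝ] EucSp k × EucSp k}
    (hD : IsLinearizedFlow D (hamFlow H T) (fun t z => kinField L + b' t z) 0 T)
    {η : ℝ} (hη : 0 < η) :
    ∃ ε₀ > 0, ∀ s ∈ Icc 0 T, ∀ t ∈ Icc s T, t - s ≤ ε₀ → ∀ z,
      ‖D t s z - ContinuousLinearMap.id ℝ _ - (t - s) • (kinField L + b' s z)‖ ≤ η * (t - s) := by
  set N := ‖kinField L‖ + M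
  have hN : 0 ≤ N := h.isC1Field.nonneg
  set C := Real.exp (N * T)
  have hC : 0 < C := Real.exp_pos _
  obtain ⟨ε₁, hε₁, halong⟩ := h.exists_norm_deriv_along_sub_le (η := η / (2 * C)) (by positivity)
  refine ⟨min ε₁ (η / (2 * C * (N * N + 1))), by positivity, fun s hs t ht hts z => ?_⟩
  have hts0 : 0 ≤ t - s := sub_nonneg.2 ht.1
  have hlin := hD.norm_sub_id_sub_smul_le h.isC1Field hs ht (z := z) fun τ hτ => by
    rw [add_sub_add_left_eq_sub]
    exact halong s hs τ ⟨hτ.1, hτ.2.trans ht.2⟩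
      ((sub_le_sub_right hτ.2 s).trans (hts.trans (min_le_left _ _))) z
  have hexp : Real.exp (N * (t - s)) ≤ C :=
    Real.exp_le_exp.2 (mul_le_mul_of_nonneg_left (by linarith [ht.2, hs.1]) hN)
  have hquad : N * N * (t - s) ≤ η / (2 * C) := by
    have hle := hts.trans (min_le_right _ _)
    rw [le_div_iff₀ (by positivity)] at hle ⊢
    nlinarith [mul_nonneg hts0 hC.le]
  calc _ ≤ (η / (2 * C) + N * N * (t - s)) * Real.exp (N * (t - s)) * (t - s) := hlin
    _ ≤ (η / (2 * C) + η / (2 * C)) * C * (t - s) := by gcongr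
    _ = η * (t - s) := by field_simp; ring

theorem lipschitzWith_position_sub (h : IsKineticHam L H b b' T R M)
    {D : ℝ → ℝ → EucSp k × EucSp k → EucSp k × EucSp k →L[ℝ] EucSp k × EucSp k}
    (hD : IsLinearizedFlow D (hamFlow H T) (fun t z => kinField L + b' t z) 0 T)
    {s t : ℝ} (hs : s ∈ Icc 0 T) (ht : t ∈ Icc s T) {c : NNReal}
    (hc : ∀ z, ‖D t s z - ContinuousLinearMap.id ℝ _ - (t - s) • (kinField L + b' s z)‖ ≤ c)
    (X : EucSp k) :
    LipschitzWith c fun P =>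
      (hamFlow H T t s (X, P)).1 - (X + (t - s) • (hamField H s (X, P)).1) := by
  let B : EucSp k → EucSp k × EucSp k →L[ℝ] EucSp k × EucSp k := fun P =>
    D t s (X, P) - ContinuousLinearMap.id ℝ _ - (t - s) • (kinField L + b' s (X, P))
  refine lipschitzOnWith_univ.1 (convex_univ.lipschitzOnWith_of_nnnorm_hasFDerivWithin_le (𝕜 := ℝ)
    (f' := fun P => (ContinuousLinearMap.fst ℝ _ _).comp ((B P).comp
      (ContinuousLinearMap.inr ℝ _ _))) (fun P _ => HasFDerivAt.hasFDerivWithinAt ?_) fun P _ => ?_)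
  · have hX := hasFDerivAt_prodMk_right (𝕜 := ℝ) X P
    have hflow := ((hD.hasFDerivAt h.isFlowOn h.isC1Field hs ht (X, P)).comp P hX).fst
    have hfield := ((h.isC1Field.hasFDerivAt s hs (X, P)).comp P hX).fst
    refine (hflow.sub ((hfield.const_smul (t - s)).const_add X)).congr_fderiv ?_
    ext1 v
    simp [B]
  · refine ContinuousLinearMap.opNorm_le_bound _ c.2 fun v => ?_
    have hv : ‖((0 : EucSp k), v)‖ = ‖v‖ := by simp [Prod.norm_def]
    exact (norm_fst_le _).trans (((B P).le_of_opNorm_le (hc _) _).trans_eq (by rw [← hv]; rfl))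

/-- For `t` close to `s`, the map `P ↦ x` at fixed `X` is a Lipschitz-small perturbation of
`P ↦ X + (t - s) D_pH(s, X, P)`, whose inverse is controlled by `(⋆)`. -/
theorem exists_twist_equiv (h : IsKineticHam L H b b' T R M) (hstar : StarCondition H T) :
    ∃ ε₀ > 0, ∀ s ∈ Icc 0 T, ∀ t ∈ Icc s T, s < t → t - s ≤ ε₀ →
      ∃ e : EucSp k × EucSp k ≃ EucSp k × EucSp k,
        (∀ z, e z = twistMap H T t s z) ∧ ContDiff ℝ 1 e ∧ ContDiff ℝ 1 e.symm := by
  obtain ⟨K, hK⟩ := hstar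
  obtain ⟨D, hD⟩ := h.isFlowOn.exists_isLinearizedFlow h.isC1Field
  set κ : NNReal := K + 1
  obtain ⟨ε₀, hε₀, hε⟩ := h.exists_norm_linearized_sub_le hD (η := κ⁻¹ / 2) (by positivity)
  refine ⟨ε₀, hε₀, fun s hs t ht hst hts => ?_⟩
  obtain ⟨δ, hδ⟩ : ∃ δ : NNReal, (δ : ℝ) = t - s := ⟨⟨t - s, sub_nonneg.2 ht.1⟩, rfl⟩
  have hδ0 : δ ≠ 0 := fun h0 => (sub_pos.2 hst).ne' (by rw [← hδ, h0, NNReal.coe_zero])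
  have hgC1 := contDiff_fst.comp (hD.contDiff h.isFlowOn h.isC1Field hs ht)
  refine exists_fibered_equiv_of_lipschitzWith_sub hgC1 fun X => ?_
  obtain ⟨e, he, -, -, -, hesymm⟩ := hK s hs X
  let e' : EucSp k ≃ EucSp k := (e.trans (MulAction.toPerm (Units.mk0 δ hδ0))).trans
    (Equiv.addLeft X)
  refine ⟨e', κ * δ⁻¹, κ⁻¹ / 2 * δ, ?_, ?_, ?_⟩
  · have hscale : LipschitzWith δ⁻¹ fun y : EucSp k => δ⁻¹ • (-X + y) :=
      LipschitzWith.of_dist_le_mul fun y y' => by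
        simp only [NNReal.smul_def, dist_smul₀, dist_add_left, Real.norm_eq_abs, NNReal.abs_eq,
          le_refl]
    exact (hesymm.weaken le_self_add).comp hscale
  · have hlip := h.lipschitzWith_position_sub hD hs ht (c := κ⁻¹ / 2 * δ) (fun z => by
      push_cast
      rw [hδ]
      exact hε s hs t ht hts z) X
    rw [← hδ] at hlip
    have he' : ∀ P, e' P = X + (δ : ℝ) • (hamField H s (X, P)).1 := fun P =>
      congrArg (fun v => X + (δ : ℝ) • v) (he P)
    simpa only [he']
  · rw [mul_inv, inv_inv]
    have hκ : κ⁻¹ / 2 < κ⁻¹ := NNReal.half_lt_self (by positivity)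
    gcongr

end IsKineticHam

end HamFlow

section Action

variable {k : ℕ} {L : EucSp k →L[ℝ] EucSp k} {H : ℝ → EucSp k → EucSp k → ℝ}
  {b : ℝ → EucSp k × EucSp k → EucSp k × EucSp k}
  {b' : ℝ → EucSp k × EucSp k → EucSp k × EucSp k →L[ℝ] EucSp k × EucSp k}
  {T R M : ℝ}

theorem contDiff_sympForm {n : WithTop ℕ∞} : ContDiff ℝ n (sympForm (k := k)) := by
  let f : EucSp k × EucSp k →ₗ[ℝ] (EucSp k × EucSp k →L[ℝ] ℝ) :=
    { toFun := sympForm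
      map_add' := sympForm_add
      map_smul' := fun c X => ContinuousLinearMap.ext fun v => by
        simp [sympForm_apply, inner_smul_left, mul_sub] }
  exact (LinearMap.toContinuousLinearMap f).contDiff

theorem norm_sympForm_le (X : EucSp k × EucSp k) : ‖sympForm X‖ ≤ 2 * ‖X‖ := by
  refine ContinuousLinearMap.opNorm_le_bound _ (by positivity) fun v => ?_
  calc ‖sympForm X v‖ = |inner ℝ X.1 v.2 - inner ℝ X.2 v.1| := rfl
    _ ≤ ‖X.1‖ * ‖v.2‖ + ‖X.2‖ * ‖v.1‖ :=
        (abs_sub _ _).trans (add_le_add (abs_real_inner_le_norm _ _) (abs_real_inner_le_norm _ _))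
    _ ≤ ‖X‖ * ‖v‖ + ‖X‖ * ‖v‖ := by
        gcongr
        exacts [norm_fst_le X, norm_snd_le v, norm_snd_le X, norm_fst_le v]
    _ = 2 * ‖X‖ * ‖v‖ := by ring

/-- The Lagrangian `⟨p, D_pH⟩ - H`, as a function of `z = (x, p)`: the integrand of the action. -/
noncomputable def lagr (H : ℝ → EucSp k → EucSp k → ℝ) (t : ℝ) (z : EucSp k × EucSp k) : ℝ :=
  inner ℝ z.2 (hamField H t z).1 - H t z.1 z.2

/-- The action on `[s,t]` of the trajectory which passes through `z` at time `s`. -/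
noncomputable def flowAction (H : ℝ → EucSp k → EucSp k → ℝ) (T t s : ℝ)
    (z : EucSp k × EucSp k) : ℝ :=
  ∫ τ in s..t, lagr H τ (hamFlow H T τ s z)

/-- The differential `v ↦ ⟨p, (X' v)_1⟩ + ⟨X_2, v_1⟩` of the Lagrangian at a point with momentum
`p`, where `X` is the value and `X'` the differential of the Hamiltonian vector field. -/
noncomputable def lagrForm (p : EucSp k) (X : EucSp k × EucSp k)
    (X' : EucSp k × EucSp k →L[ℝ] EucSp k × EucSp k) : EucSp k × EucSp k →L[ℝ] ℝ :=
  (innerSL ℝ p).comp ((ContinuousLinearMap.fst ℝ _ _).comp X') +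
    (innerSL ℝ X.2).comp (ContinuousLinearMap.fst ℝ _ _)

theorem lagrForm_apply (p : EucSp k) (X : EucSp k × EucSp k)
    (X' : EucSp k × EucSp k →L[ℝ] EucSp k × EucSp k) (v : EucSp k × EucSp k) :
    lagrForm p X X' v = inner ℝ p (X' v).1 + inner ℝ X.2 v.1 := rfl

theorem norm_lagrForm_le (p : EucSp k) (X : EucSp k × EucSp k)
    (X' : EucSp k × EucSp k →L[ℝ] EucSp k × EucSp k) :
    ‖lagrForm p X X'‖ ≤ ‖p‖ * ‖X'‖ + ‖X.2‖ := by
  refine ContinuousLinearMap.opNorm_le_bound _ (by positivity) fun v => ?_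
  have hX' : ‖(X' v).1‖ ≤ ‖X'‖ * ‖v‖ := (norm_fst_le _).trans (X'.le_opNorm v)
  calc ‖lagrForm p X X' v‖ = |inner ℝ p (X' v).1 + inner ℝ X.2 v.1| := rfl
    _ ≤ ‖p‖ * ‖(X' v).1‖ + ‖X.2‖ * ‖v.1‖ := (abs_add_le _ _).trans
        (add_le_add (abs_real_inner_le_norm _ _) (abs_real_inner_le_norm _ _))
    _ ≤ ‖p‖ * (‖X'‖ * ‖v‖) + ‖X.2‖ * ‖v‖ := by
        gcongr
        exact norm_fst_le v
    _ = (‖p‖ * ‖X'‖ + ‖X.2‖) * ‖v‖ := by ring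

/-- The differential at `z` of the Lagrangian at time `τ` along the flow started at time `s`, when
`b'` is the differential of the compactly supported part of the Hamiltonian vector field and `D`
linearizes the flow. -/
noncomputable def lagrFlowForm (L : EucSp k →L[ℝ] EucSp k) (H : ℝ → EucSp k → EucSp k → ℝ)
    (b' : ℝ → EucSp k × EucSp k → EucSp k × EucSp k →L[ℝ] EucSp k × EucSp k) (T : ℝ)
    (D : ℝ → ℝ → EucSp k × EucSp k → EucSp k × EucSp k →L[ℝ] EucSp k × EucSp k) (s : ℝ)
    (z : EucSp k × EucSp k) (τ : ℝ) : EucSp k × EucSp k →L[ℝ] ℝ :=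
  (lagrForm (hamFlow H T τ s z).2 (hamField H τ (hamFlow H T τ s z))
    (kinField L + b' τ (hamFlow H T τ s z))).comp (D τ s z)

namespace IsKineticHam

theorem continuousOn_hamField_hamFlow (h : IsKineticHam L H b b' T R M) {s : ℝ}
    (hs : s ∈ Icc 0 T) (z : EucSp k × EucSp k) :
    ContinuousOn (fun τ => hamField H τ (hamFlow H T τ s z)) (Icc 0 T) :=
  h.isC1Field.cont.comp (f := fun τ : ℝ => (τ, hamFlow H T τ s z))
    (continuousOn_id.prodMk (h.isFlowOn.curve s hs z).continuousOn) fun _ hτ => ⟨hτ, mem_univ _⟩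

theorem continuousOn_lagr (h : IsKineticHam L H b b' T R M) {s : ℝ} (hs : s ∈ Icc 0 T)
    (z : EucSp k × EucSp k) :
    ContinuousOn (fun τ => lagr H τ (hamFlow H T τ s z)) (Icc 0 T) := by
  have hflow := (h.isFlowOn.curve s hs z).continuousOn
  have hham : ContinuousOn (fun τ => H τ (hamFlow H T τ s z).1 (hamFlow H T τ s z).2) (Icc 0 T) :=
    h.cont.comp (f := fun τ : ℝ => (τ, hamFlow H T τ s z)) (continuousOn_id.prodMk hflow)
      fun _ hτ => ⟨hτ, mem_univ _⟩
  exact (hflow.snd.inner (h.continuousOn_hamField_hamFlow hs z).fst).sub hham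

theorem hasFDerivAt_lagr (h : IsKineticHam L H b b' T R M) {t : ℝ} (ht : t ∈ Icc 0 T)
    (z : EucSp k × EucSp k) :
    HasFDerivAt (lagr H t) (lagrForm z.2 (hamField H t z) (kinField L + b' t z)) z := by
  have hsnd : HasFDerivAt (fun z : EucSp k × EucSp k => z.2) (ContinuousLinearMap.snd ℝ _ _) z :=
    hasFDerivAt_snd
  have hfield := (h.isC1Field.hasFDerivAt t ht z).fst
  refine ((hsnd.inner ℝ hfield).sub (h.hasFDerivAt t ht z)).congr_fderiv <|
    ContinuousLinearMap.ext fun v => ?_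
  rw [← h.hamField_eq ht]
  simp only [sub_apply, sympForm_apply, lagrForm_apply, ContinuousLinearMap.comp_apply,
    fderivInnerCLM_apply, ContinuousLinearMap.prod_apply, ContinuousLinearMap.coe_fst',
    ContinuousLinearMap.coe_snd']
  rw [real_inner_comm v.2]
  ring

section Linearized

variable {D : ℝ → ℝ → EucSp k × EucSp k → EucSp k × EucSp k →L[ℝ] EucSp k × EucSp k}

theorem continuousOn_lagrFlowForm (h : IsKineticHam L H b b' T R M)
    (hD : IsLinearizedFlow D (hamFlow H T) (fun t z => kinField L + b' t z) 0 T) {s : ℝ}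
    (hs : s ∈ Icc 0 T) (z : EucSp k × EucSp k) :
    ContinuousOn (lagrFlowForm L H b' T D s z) (Icc 0 T) := by
  have hmomentum : ContinuousOn (fun τ => innerSL ℝ (hamFlow H T τ s z).2) (Icc 0 T) :=
    (innerSL ℝ).continuous.comp_continuousOn (h.isFlowOn.curve s hs z).continuousOn.snd
  have hforce : ContinuousOn (fun τ => innerSL ℝ (hamField H τ (hamFlow H T τ s z)).2)
      (Icc 0 T) :=
    (innerSL ℝ).continuous.comp_continuousOn (h.continuousOn_hamField_hamFlow hs z).snd
  have hderiv := h.isFlowOn.continuousOn_deriv h.isC1Field hs z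
  have hD' : ContinuousOn (fun τ => D τ s z) (Icc 0 T) :=
    fun τ hτ => (hD.deriv s hs z τ hτ).continuousWithinAt
  exact ((hmomentum.clm_comp (continuousOn_const.clm_comp hderiv)).add
    (hforce.clm_comp continuousOn_const)).clm_comp hD'

theorem hasFDerivAt_lagr_hamFlow (h : IsKineticHam L H b b' T R M)
    (hD : IsLinearizedFlow D (hamFlow H T) (fun t z => kinField L + b' t z) 0 T) {s τ : ℝ}
    (hs : s ∈ Icc 0 T) (hτ : τ ∈ Icc s T) (z : EucSp k × EucSp k) :
    HasFDerivAt (fun w => lagr H τ (hamFlow H T τ s w)) (lagrFlowForm L H b' T D s z τ) z :=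
  (h.hasFDerivAt_lagr (Icc_subset_Icc_left hs.1 hτ) _).comp z
    (hD.hasFDerivAt h.isFlowOn h.isC1Field hs hτ z)

theorem norm_lagrFlowForm_le (h : IsKineticHam L H b b' T R M)
    (hD : IsLinearizedFlow D (hamFlow H T) (fun t z => kinField L + b' t z) 0 T) {s τ : ℝ}
    (hs : s ∈ Icc 0 T) (hτ : τ ∈ Icc s T) (z : EucSp k × EucSp k) :
    ‖lagrFlowForm L H b' T D s z τ‖ ≤
      ((‖z.2‖ + M * T) * (‖kinField L‖ + M) + M) * Real.exp ((‖kinField L‖ + M) * T) := by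
  have hM := h.nonneg
  have hT := h.pos
  have hτ' : τ ∈ Icc 0 T := Icc_subset_Icc_left hs.1 hτ
  have hτs : τ - s ≤ T := by linarith [hτ.2, hs.1]
  have hmomentum : ‖(hamFlow H T τ s z).2‖ ≤ ‖z.2‖ + M * T :=
    (norm_le_norm_add_norm_sub' _ z.2).trans <| by
      gcongr
      exact (h.norm_momentum_sub_le hs hτ z).trans (by gcongr)
  have hforce : ‖(hamField H τ (hamFlow H T τ s z)).2‖ ≤ M := by
    rw [h.hamField_eq hτ', Prod.snd_add, kinField_apply, zero_add]
    exact (norm_snd_le _).trans (h.field_norm_le τ hτ' _)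
  have hlin : ‖D τ s z‖ ≤ Real.exp ((‖kinField L‖ + M) * T) :=
    (hD.norm_le h.isC1Field hs hτ z).trans (by gcongr)
  refine (ContinuousLinearMap.opNorm_comp_le _ _).trans ?_
  gcongr
  refine (norm_lagrForm_le _ _ _).trans ?_
  gcongr
  exact h.isC1Field.bound τ hτ' _

/-- Along the flow, `dL = d/dτ ⟨p, dx⟩`. -/
theorem integral_lagrFlowForm (h : IsKineticHam L H b b' T R M)
    (hD : IsLinearizedFlow D (hamFlow H T) (fun t z => kinField L + b' t z) 0 T) {s t : ℝ}
    (hs : s ∈ Icc 0 T) (ht : t ∈ Icc s T) (z v : EucSp k × EucSp k) :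
    ∫ τ in s..t, lagrFlowForm L H b' T D s z τ v =
      inner ℝ (hamFlow H T t s z).2 (D t s z v).1 - inner ℝ z.2 v.1 := by
  have hsub : Icc s t ⊆ Icc 0 T := Icc_subset_Icc hs.1 ht.2
  have hDv : ∀ τ ∈ Icc s t, HasDerivWithinAt (fun τ => D τ s z v)
      ((kinField L + b' τ (hamFlow H T τ s z)) (D τ s z v)) (Icc 0 T) τ := fun τ hτ => by
    simpa using (hD.deriv s hs z τ (hsub hτ)).clm_apply (hasDerivWithinAt_const τ _ v)
  have hpairing : ∀ τ ∈ Icc s t,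
      HasDerivWithinAt (fun τ => inner ℝ (hamFlow H T τ s z).2 (D τ s z v).1)
        (lagrFlowForm L H b' T D s z τ v) (Icc 0 T) τ := fun τ hτ =>
    HasDerivWithinAt.inner ℝ (h.isFlowOn.curve s hs z τ (hsub hτ)).snd (hDv τ hτ).fst
  have hftc := intervalIntegral.integral_eq_sub_of_hasDerivAt_of_le ht.1
    (fun τ hτ => ((hpairing τ hτ).mono hsub).continuousWithinAt)
    (fun τ hτ => (hpairing τ (Ioo_subset_Icc_self hτ)).hasDerivAt
      (Icc_mem_nhds (hs.1.trans_lt hτ.1) (hτ.2.trans_le ht.2)))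
    (ContinuousOn.intervalIntegrable <| by
      rw [uIcc_of_le ht.1]
      exact ((h.continuousOn_lagrFlowForm hD hs z).mono hsub).clm_apply continuousOn_const)
  simpa only [h.isFlowOn.self s hs, hD.self s hs, ContinuousLinearMap.id_apply] using hftc

theorem hasFDerivAt_flowAction (h : IsKineticHam L H b b' T R M)
    (hD : IsLinearizedFlow D (hamFlow H T) (fun t z => kinField L + b' t z) 0 T) {s t : ℝ}
    (hs : s ∈ Icc 0 T) (ht : t ∈ Icc s T) (z : EucSp k × EucSp k) :
    HasFDerivAt (flowAction H T t s)
      ((innerSL ℝ (hamFlow H T t s z).2).comp ((ContinuousLinearMap.fst ℝ _ _).comp (D t s z)) -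
        (innerSL ℝ z.2).comp (ContinuousLinearMap.fst ℝ _ _)) z := by
  have hM := h.nonneg
  have hsub : Icc s t ⊆ Icc 0 T := Icc_subset_Icc hs.1 ht.2
  have hIoc : uIoc s t ⊆ Icc s t := by
    rw [uIoc_of_le ht.1]
    exact Ioc_subset_Icc_self
  have hIcc : uIcc s t ⊆ Icc 0 T := by rwa [uIcc_of_le ht.1]
  have hF := fun w => h.continuousOn_lagr hs w
  have hF' := h.continuousOn_lagrFlowForm hD hs z
  have hderiv := intervalIntegral.hasFDerivAt_integral_of_dominated_of_fderiv_le
    (μ := MeasureTheory.volume) (bound := fun _ =>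
      ((‖z.2‖ + 1 + M * T) * (‖kinField L‖ + M) + M) * Real.exp ((‖kinField L‖ + M) * T))
    (Metric.ball_mem_nhds z one_pos)
    (.of_forall fun w =>
      ((hF w).mono (hIoc.trans hsub)).aestronglyMeasurable measurableSet_uIoc)
    ((hF z).mono hIcc).intervalIntegrable
    ((hF'.mono (hIoc.trans hsub)).aestronglyMeasurable measurableSet_uIoc)
    (.of_forall fun τ hτ w hw => by
      have hw2 : ‖w.2‖ ≤ ‖z.2‖ + 1 := (norm_le_norm_add_norm_sub' _ z.2).trans <| by
        gcongr
        exact (norm_snd_le (w - z)).trans (mem_ball_iff_norm.1 hw).le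
      refine (h.norm_lagrFlowForm_le hD hs (Icc_subset_Icc_right ht.2 (hIoc hτ)) w).trans ?_
      gcongr)
    intervalIntegrable_const
    (.of_forall fun τ hτ w _ =>
      h.hasFDerivAt_lagr_hamFlow hD hs (Icc_subset_Icc_right ht.2 (hIoc hτ)) w)
  refine hderiv.congr_fderiv (ContinuousLinearMap.ext fun v => ?_)
  rw [ContinuousLinearMap.intervalIntegral_apply (hF'.mono hIcc).intervalIntegrable,
    h.integral_lagrFlowForm hD hs ht]
  rfl

end Linearized

theorem lagr_add_intVec (h : IsKineticHam L H b b' T R M) {t : ℝ} (ht : t ∈ Icc 0 T)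
    (m : Fin k → ℤ) (z : EucSp k × EucSp k) : lagr H t (z + (intVec m, 0)) = lagr H t z := by
  have hfield : hamField H t (z + (intVec m, 0)) = hamField H t z := by
    simp only [h.hamField_eq ht, h.field_periodic t ht, kinField_apply, Prod.snd_add, add_zero]
  simp only [lagr, hfield, Prod.fst_add, Prod.snd_add, add_zero, h.ham_periodic t ht]

theorem flowAction_add_intVec (h : IsKineticHam L H b b' T R M) {s t : ℝ} (hs : s ∈ Icc 0 T)
    (ht : t ∈ Icc s T) (m : Fin k → ℤ) (z : EucSp k × EucSp k) :
    flowAction H T t s (z + (intVec m, 0)) = flowAction H T t s z := by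
  refine intervalIntegral.integral_congr fun τ hτ => ?_
  rw [uIcc_of_le ht.1] at hτ
  have hτ' : τ ∈ Icc 0 T := Icc_subset_Icc hs.1 ht.2 hτ
  simp only [h.hamFlow_add_intVec hs hτ', h.lagr_add_intVec hτ']

theorem flowAction_of_lt (h : IsKineticHam L H b b' T R M) {s t : ℝ} (hs : s ∈ Icc 0 T)
    (ht : t ∈ Icc s T) {z : EucSp k × EucSp k} (hz : R < ‖z.2‖) :
    flowAction H T t s z = (t - s) / 2 * inner ℝ (L z.2) z.2 := by
  have hconst : EqOn (fun τ => lagr H τ (hamFlow H T τ s z))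
      (fun _ => 1 / 2 * inner ℝ (L z.2) z.2) (uIcc s t) := by
    intro τ hτ
    rw [uIcc_of_le ht.1] at hτ
    have hτ' : τ ∈ Icc 0 T := Icc_subset_Icc hs.1 ht.2 hτ
    have hfree : b τ (z.1 + (τ - s) • L z.2, z.2) = 0 := h.field_eq_zero τ hτ' _ hz
    simp only [h.hamFlow_of_lt hs hτ' hz, lagr, h.hamField_eq hτ', hfree, h.ham_eq τ hτ' _ _ hz,
      kinField_apply, add_zero]
    rw [real_inner_comm]
    ring
  rw [flowAction, intervalIntegral.integral_congr hconst, intervalIntegral.integral_const,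
    smul_eq_mul]
  ring

end IsKineticHam

/-- `S` is a `C^2` generating function, without parameters, of the twist map `φ`: the trajectory
from `X` to `Y` has initial momentum `P (X,Y)` and final momentum `p (X,Y)`, and
`dS = p dY - P dX`. -/
structure IsTwistGF (S : EucSp k → EucSp k → ℝ) (φ : EucSp k × EucSp k → EucSp k × EucSp k)
    (P p : EucSp k × EucSp k → EucSp k) : Prop where
  contDiff_start : ContDiff ℝ 1 P
  contDiff_end : ContDiff ℝ 1 p
  flow_iff : ∀ X Y Q q, φ (X, Q) = (Y, q) ↔ Q = P (X, Y) ∧ q = p (X, Y)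
  hasFDerivAt : ∀ w, HasFDerivAt (fun w : EucSp k × EucSp k => S w.1 w.2)
    (sympForm (p w, P w)) w

theorem IsTwistGF.contDiff {S : EucSp k → EucSp k → ℝ}
    {φ : EucSp k × EucSp k → EucSp k × EucSp k} {P p : EucSp k × EucSp k → EucSp k}
    (hS : IsTwistGF S φ P p) : ContDiff ℝ 2 (fun w : EucSp k × EucSp k => S w.1 w.2) := by
  have hS2 : ContDiff ℝ ((1 : ℕ) + 1) (fun w : EucSp k × EucSp k => S w.1 w.2) :=
    contDiff_succ_iff_hasFDerivAt.2 ⟨fun w => sympForm (p w, P w),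
    contDiff_sympForm.comp (hS.contDiff_end.prodMk hS.contDiff_start), hS.hasFDerivAt⟩
  rwa [Nat.cast_one, one_add_one_eq_two] at hS2

section TwistEquiv

variable {s t : ℝ} {e : EucSp k × EucSp k ≃ EucSp k × EucSp k}

theorem twist_symm_fst (he : ∀ z, e z = twistMap H T t s z) (w : EucSp k × EucSp k) :
    (e.symm w).1 = w.1 := by
  have hw := e.apply_symm_apply w
  rw [he] at hw
  exact (Prod.ext_iff.1 hw).1

theorem hamFlow_twist_symm_fst (he : ∀ z, e z = twistMap H T t s z) (w : EucSp k × EucSp k) :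
    (hamFlow H T t s (e.symm w)).1 = w.2 := by
  have hw := e.apply_symm_apply w
  rw [he] at hw
  exact (Prod.ext_iff.1 hw).2

theorem mk_twist_symm_snd (he : ∀ z, e z = twistMap H T t s z) (X Y : EucSp k) :
    (X, (e.symm (X, Y)).2) = e.symm (X, Y) :=
  Prod.ext (twist_symm_fst he (X, Y)).symm rfl

theorem mk_startMomentum_eq (he : ∀ z, e z = twistMap H T t s z) (X Y : EucSp k) :
    (X, startMomentum H T t s X Y) = e.symm (X, Y) := by
  have hinj : Function.Injective fun P => (hamFlow H T t s (X, P)).1 := fun P P' hP => by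
    have heq : e (X, P) = e (X, P') := by
      rw [he, he]
      exact Prod.ext rfl hP
    exact congrArg Prod.snd (e.injective heq)
  have hfst := mk_twist_symm_snd he X Y
  have hpos : (fun P => (hamFlow H T t s (X, P)).1) (e.symm (X, Y)).2 = Y := by
    beta_reduce
    rw [hfst, hamFlow_twist_symm_fst he]
  have hP : startMomentum H T t s X Y = (e.symm (X, Y)).2 :=
    hinj ((Function.invFun_eq (f := fun P => (hamFlow H T t s (X, P)).1) ⟨_, hpos⟩).trans hpos.symm)
  rw [hP, hfst]

namespace IsKineticHam

theorem segmentAction_eq (h : IsKineticHam L H b b' T R M) (hs : s ∈ Icc 0 T) (ht : t ∈ Icc s T)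
    (he : ∀ z, e z = twistMap H T t s z) (X Y : EucSp k) :
    segmentAction H T t s X Y = flowAction H T t s (e.symm (X, Y)) := by
  simp only [segmentAction, flowAction, mk_startMomentum_eq he]
  refine intervalIntegral.integral_congr_Ioo_of_le ht.1 fun τ hτ => ?_
  have hcurve : HasDerivAt (fun τ => (hamFlow H T τ s (e.symm (X, Y))).1)
      (hamField H τ (hamFlow H T τ s (e.symm (X, Y)))).1 τ :=
    ((h.isFlowOn.curve s hs (e.symm (X, Y)) τ
      (Icc_subset_Icc hs.1 ht.2 (Ioo_subset_Icc_self hτ))).hasDerivAt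
      (Icc_mem_nhds (hs.1.trans_lt hτ.1) (hτ.2.trans_le ht.2))).fst
  simp only [lagr, hcurve.deriv]

theorem hasFDerivAt_segmentAction (h : IsKineticHam L H b b' T R M) (hs : s ∈ Icc 0 T)
    (ht : t ∈ Icc s T) (he : ∀ z, e z = twistMap H T t s z) (hesymm : ContDiff ℝ 1 e.symm)
    (w : EucSp k × EucSp k) :
    HasFDerivAt (fun w : EucSp k × EucSp k => segmentAction H T t s w.1 w.2)
      (sympForm ((hamFlow H T t s (e.symm w)).2, (e.symm w).2)) w := by
  obtain ⟨D, hD⟩ := h.isFlowOn.exists_isLinearizedFlow h.isC1Field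
  have hS : (fun w : EucSp k × EucSp k => segmentAction H T t s w.1 w.2) =
      flowAction H T t s ∘ e.symm := funext fun w => h.segmentAction_eq hs ht he w.1 w.2
  have hes : HasFDerivAt e.symm (fderiv ℝ e.symm w) w :=
    (hesymm.differentiable one_ne_zero w).hasFDerivAt
  have hstart : ∀ v, (fderiv ℝ e.symm w v).1 = v.1 := by
    have hfst := hes.fst
    simp only [twist_symm_fst he] at hfst
    exact fun v => DFunLike.congr_fun (hfst.unique hasFDerivAt_fst) v
  have hend : ∀ v, (D t s (e.symm w) (fderiv ℝ e.symm w v)).1 = v.2 := by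
    have hsnd := ((hD.hasFDerivAt h.isFlowOn h.isC1Field hs ht _).comp w hes).fst
    simp only [Function.comp_apply, hamFlow_twist_symm_fst he] at hsnd
    exact fun v => DFunLike.congr_fun (hsnd.unique hasFDerivAt_snd) v
  rw [hS]
  refine ((h.hasFDerivAt_flowAction hD hs ht _).comp w hes).congr_fderiv <|
    ContinuousLinearMap.ext fun v => ?_
  simp [sympForm_apply, hstart, hend]

theorem isTwistGF (h : IsKineticHam L H b b' T R M) (hs : s ∈ Icc 0 T) (ht : t ∈ Icc s T)
    (he : ∀ z, e z = twistMap H T t s z) (hesymm : ContDiff ℝ 1 e.symm) :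
    IsTwistGF (segmentAction H T t s) (hamFlow H T t s) (fun w => (e.symm w).2)
      (fun w => (hamFlow H T t s (e.symm w)).2) where
  contDiff_start := contDiff_snd.comp hesymm
  contDiff_end := by
    obtain ⟨D, hD⟩ := h.isFlowOn.exists_isLinearizedFlow h.isC1Field
    exact contDiff_snd.comp ((hD.contDiff h.isFlowOn h.isC1Field hs ht).comp hesymm)
  flow_iff X Y Q q := by
    constructor
    · intro hflow
      have hsymm : e.symm (X, Y) = (X, Q) := by rw [Equiv.symm_apply_eq, he, twistMap, hflow]
      simp only [hsymm, hflow, and_self]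
    · rintro ⟨rfl, rfl⟩
      rw [mk_twist_symm_snd he]
      exact Prod.ext (hamFlow_twist_symm_fst he _) rfl
  hasFDerivAt := h.hasFDerivAt_segmentAction hs ht he hesymm

theorem segmentAction_add_intVec (h : IsKineticHam L H b b' T R M) (hs : s ∈ Icc 0 T)
    (ht : t ∈ Icc s T) (he : ∀ z, e z = twistMap H T t s z) (m : Fin k → ℤ) (X Y : EucSp k) :
    segmentAction H T t s (X + intVec m) (Y + intVec m) = segmentAction H T t s X Y := by
  have hshift : e.symm (X + intVec m, Y + intVec m) = e.symm (X, Y) + (intVec m, 0) := by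
    rw [Equiv.symm_apply_eq, he, twistMap,
      h.hamFlow_add_intVec hs (Icc_subset_Icc_left hs.1 ht), Prod.fst_add, Prod.fst_add,
      twist_symm_fst he, hamFlow_twist_symm_fst he]
  rw [h.segmentAction_eq hs ht he, hshift, h.flowAction_add_intVec hs ht,
    h.segmentAction_eq hs ht he]

end IsKineticHam

/-- The difference between the action `S(X,Y)` of a segment of duration `ε` and the free action
`⟨A⁻¹(Y - X), Y - X⟩ / 2ε`, where `L'` stands for `A⁻¹`. -/
noncomputable def actionDefect (L' : EucSp k →L[ℝ] EucSp k) (ε : ℝ) (S : EucSp k → EucSp k → ℝ)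
    (w : EucSp k × EucSp k) : ℝ :=
  S w.1 w.2 - 1 / (2 * ε) * inner ℝ (L' (w.2 - w.1)) (w.2 - w.1)

theorem hasFDerivAt_actionDefect {L' : EucSp k →L[ℝ] EucSp k}
    (hL' : ∀ x y, inner ℝ (L' x) y = inner ℝ x (L' y)) {S : EucSp k → EucSp k → ℝ}
    {P p : EucSp k} {w : EucSp k × EucSp k}
    (hS : HasFDerivAt (fun w : EucSp k × EucSp k => S w.1 w.2) (sympForm (p, P)) w) (ε : ℝ) :
    HasFDerivAt (actionDefect L' ε S)
      (sympForm (p - ε⁻¹ • L' (w.2 - w.1), P - ε⁻¹ • L' (w.2 - w.1))) w := by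
  have hincr : HasFDerivAt (fun w : EucSp k × EucSp k => w.2 - w.1)
      (ContinuousLinearMap.snd ℝ _ _ - ContinuousLinearMap.fst ℝ _ _) w :=
    hasFDerivAt_snd.sub hasFDerivAt_fst
  have hLincr : HasFDerivAt (fun w : EucSp k × EucSp k => L' (w.2 - w.1)) _ w :=
    L'.hasFDerivAt.comp w hincr
  refine (hS.sub ((hLincr.inner ℝ hincr).const_mul (1 / (2 * ε)))).congr_fderiv <|
    ContinuousLinearMap.ext fun v => ?_
  have hsymm : inner ℝ (L' (v.2 - v.1)) (w.2 - w.1) = inner ℝ (L' (w.2 - w.1)) (v.2 - v.1) := by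
    rw [hL', real_inner_comm]
  simp only [sub_apply, sympForm_apply, smul_apply, ContinuousLinearMap.comp_apply,
    fderivInnerCLM_apply, ContinuousLinearMap.prod_apply, ContinuousLinearMap.coe_fst',
    ContinuousLinearMap.coe_snd', hsymm, inner_sub_left, inner_smul_left, smul_eq_mul,
    inner_sub_right, conj_trivial]
  ring

namespace IsKineticHam

variable {L' : EucSp k →L[ℝ] EucSp k}

theorem norm_position_sub_le (h : IsKineticHam L H b b' T R M) (hs : s ∈ Icc 0 T)
    (ht : t ∈ Icc s T) (z : EucSp k × EucSp k) :
    ‖(hamFlow H T t s z).1 - z.1 - (t - s) • L z.2‖ ≤ (‖L‖ * (M * T) + M) * (t - s) := by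
  have hM := h.nonneg
  have hmv := norm_image_sub_le_of_norm_deriv_le_segment'
    (f := fun τ => (hamFlow H T τ s z).1 - (τ - s) • L z.2)
    (f' := fun τ => (hamField H τ (hamFlow H T τ s z)).1 - L z.2) (C := ‖L‖ * (M * T) + M)
    (fun τ hτ => HasDerivWithinAt.sub (h.isFlowOn.hasDerivWithinAt_Icc hs z hτ).fst <| by
      simpa using (((hasDerivAt_id τ).sub_const s).smul_const (L z.2)).hasDerivWithinAt)
    (fun τ hτ => by
      have hτs := Ico_subset_Icc_self hτ
      have hτ' : τ ∈ Icc 0 T := Icc_subset_Icc_left hs.1 hτs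
      have hsplit : (hamField H τ (hamFlow H T τ s z)).1 - L z.2 =
          L ((hamFlow H T τ s z).2 - z.2) + (b τ (hamFlow H T τ s z)).1 := by
        simp only [h.hamField_eq hτ', kinField_apply, Prod.fst_add, map_sub]
        abel
      rw [hsplit]
      refine norm_add_le_of_le ((L.le_opNorm _).trans ?_)
        ((norm_fst_le _).trans (h.field_norm_le τ hτ' _))
      gcongr
      refine (h.norm_momentum_sub_le hs hτs z).trans ?_
      gcongr
      linarith [hτs.2, hs.1]) t ht
  simp only [h.isFlowOn.self s hs, sub_self, zero_smul, sub_zero] at hmv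
  rwa [sub_right_comm] at hmv

theorem norm_startMomentum_sub_le (h : IsKineticHam L H b b' T R M) (hs : s ∈ Icc 0 T)
    (ht : t ∈ Icc s T) (hst : s < t) (hL : ∀ v, L' (L v) = v) (z : EucSp k × EucSp k) :
    ‖z.2 - (t - s)⁻¹ • L' ((hamFlow H T t s z).1 - z.1)‖ ≤ ‖L'‖ * (‖L‖ * (M * T) + M) := by
  have hts : 0 < t - s := sub_pos.2 hst
  have heq : z.2 - (t - s)⁻¹ • L' ((hamFlow H T t s z).1 - z.1) =
      -((t - s)⁻¹ • L' ((hamFlow H T t s z).1 - z.1 - (t - s) • L z.2)) := by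
    rw [map_sub L' ((hamFlow H T t s z).1 - z.1), map_smul, hL, smul_sub, smul_smul,
      inv_mul_cancel₀ hts.ne', one_smul, neg_sub]
  rw [heq, norm_neg, norm_smul, norm_inv, Real.norm_of_nonneg hts.le, inv_mul_le_iff₀ hts]
  calc _ ≤ ‖L'‖ * ‖(hamFlow H T t s z).1 - z.1 - (t - s) • L z.2‖ := L'.le_opNorm _
    _ ≤ ‖L'‖ * ((‖L‖ * (M * T) + M) * (t - s)) := by
        gcongr
        exact h.norm_position_sub_le hs ht z
    _ = (t - s) * (‖L'‖ * (‖L‖ * (M * T) + M)) := by ring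

theorem norm_sub_actionDefect_le (h : IsKineticHam L H b b' T R M) (hs : s ∈ Icc 0 T)
    (ht : t ∈ Icc s T) (hst : s < t) (he : ∀ z, e z = twistMap H T t s z)
    (hesymm : ContDiff ℝ 1 e.symm) (hL : ∀ v, L' (L v) = v)
    (hL' : ∀ x y, inner ℝ (L' x) y = inner ℝ x (L' y)) (w w' : EucSp k × EucSp k) :
    ‖actionDefect L' (t - s) (segmentAction H T t s) w -
        actionDefect L' (t - s) (segmentAction H T t s) w'‖ ≤
      2 * (M * T + ‖L'‖ * (‖L‖ * (M * T) + M)) * ‖w - w'‖ := by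
  have hM := h.nonneg
  have hMT : 0 ≤ M * T := mul_nonneg hM h.pos.le
  refine convex_univ.norm_image_sub_le_of_norm_hasFDerivWithin_le
    (fun w _ => (hasFDerivAt_actionDefect hL'
      (h.hasFDerivAt_segmentAction hs ht he hesymm w) _).hasFDerivWithinAt)
    (fun w _ => ?_) (mem_univ w') (mem_univ w)
  refine (norm_sympForm_le _).trans (mul_le_mul_of_nonneg_left ?_ two_pos.le)
  have hstart := h.norm_startMomentum_sub_le hs ht hst hL (e.symm w)
  rw [hamFlow_twist_symm_fst he, twist_symm_fst he] at hstart
  refine norm_prod_le_iff.2 ⟨?_, hstart.trans (le_add_of_nonneg_left hMT)⟩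
  have hmomentum : ‖(hamFlow H T t s (e.symm w)).2 - (e.symm w).2‖ ≤ M * T := by
    refine (h.norm_momentum_sub_le hs ht _).trans ?_
    gcongr
    linarith [hs.1, ht.2]
  exact norm_sub_le_norm_sub_add_norm_sub _ (e.symm w).2 _ |>.trans (add_le_add hmomentum hstart)

/-- In the coordinates `z = e⁻¹(X,Y)` the defect is periodic in position and vanishes for large
momenta, where the segment is free. -/
theorem exists_norm_actionDefect_le (h : IsKineticHam L H b b' T R M) (hs : s ∈ Icc 0 T)
    (ht : t ∈ Icc s T) (hst : s < t) (he : ∀ z, e z = twistMap H T t s z) (hec : Continuous e)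
    (hesymm : ContDiff ℝ 1 e.symm) (hL : ∀ v, L' (L v) = v) :
    ∃ C, 0 ≤ C ∧ ∀ w, ‖actionDefect L' (t - s) (segmentAction H T t s) w‖ ≤ C := by
  have hts : t - s ≠ 0 := (sub_pos.2 hst).ne'
  have ht' : t ∈ Icc 0 T := Icc_subset_Icc_left hs.1 ht
  have hcont : Continuous (actionDefect L' (t - s) (segmentAction H T t s)) := by
    have hS : Continuous fun w : EucSp k × EucSp k => segmentAction H T t s w.1 w.2 :=
      (h.isTwistGF hs ht he hesymm).contDiff.continuous
    unfold actionDefect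
    fun_prop
  obtain ⟨C, hC, hbound⟩ := exists_norm_le_of_periodic (a := 0) (b := T) (R := R)
    (g := fun _ z => actionDefect L' (t - s) (segmentAction H T t s) (e z))
    ((hcont.comp (hec.comp continuous_snd)).continuousOn)
    (fun _ _ m z => by
      have hshift : e (z + (intVec m, 0)) = ((e z).1 + intVec m, (e z).2 + intVec m) := by
        rw [he, he, twistMap, twistMap, h.hamFlow_add_intVec hs ht']
        rfl
      simp only [hshift, actionDefect, h.segmentAction_add_intVec hs ht he,
        add_sub_add_right_eq_sub])
    (fun _ _ z hz => by
      have hincr : (e z).2 - (e z).1 = (t - s) • L z.2 := by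
        rw [he, twistMap, h.hamFlow_of_lt hs ht' hz, add_sub_cancel_left]
      simp only [actionDefect, hincr, h.segmentAction_eq hs ht he, Prod.mk.eta,
        e.symm_apply_apply, h.flowAction_of_lt hs ht hz, map_smul, hL, inner_smul_left,
        inner_smul_right, conj_trivial]
      rw [real_inner_comm]
      field_simp [hts]
      ring)
  refine ⟨C, hC, fun w => ?_⟩
  simpa only [e.apply_symm_apply] using hbound 0 ⟨le_rfl, h.pos.le⟩ (e.symm w)

end IsKineticHam

end TwistEquiv

end Action

section BrokenPath

/-- The space of the parameters `(ξ, U)` of a broken geodesic. -/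
abbrev ParamSp (k N : ℕ) : Type := EucSp k × (Fin N → EucSp k)

variable {k N : ℕ}

@[simp] theorem brokenPath_zero (X : EucSp k) (U : Fin N → EucSp k) (x : EucSp k) :
    brokenPath X U x 0 = X := rfl

@[simp] theorem brokenPath_last (X : EucSp k) (U : Fin N → EucSp k) (x : EucSp k) :
    brokenPath X U x (Fin.last (N + 1)) = x := by
  rw [← Fin.succ_last, brokenPath, Fin.cons_succ, Fin.snoc_last]

@[simp] theorem brokenPath_castSucc_succ (X : EucSp k) (U : Fin N → EucSp k) (x : EucSp k)
    (i : Fin N) : brokenPath X U x i.castSucc.succ = U i := by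
  rw [brokenPath, Fin.cons_succ, Fin.snoc_castSucc]

@[simp] theorem brokenPath_succ_castSucc (X : EucSp k) (U : Fin N → EucSp k) (x : EucSp k)
    (i : Fin N) : brokenPath X U x i.succ.castSucc = U i := by
  rw [← Fin.succ_castSucc, brokenPath_castSucc_succ]

theorem forall_fin_path {p : Fin (N + 2) → Prop} (zero : p 0)
    (inner : ∀ i : Fin N, p i.castSucc.succ) (last : p (Fin.last (N + 1))) (j : Fin (N + 2)) :
    p j := by
  refine Fin.cases zero (fun j => ?_) j
  exact Fin.lastCases (by rwa [Fin.succ_last]) inner j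

theorem brokenPath_eta (Z : Fin (N + 2) → EucSp k) :
    brokenPath (Z 0) (fun i => Z i.castSucc.succ) (Z (Fin.last (N + 1))) = Z :=
  funext <| forall_fin_path (by simp) (by simp) (by simp)

/-- The vertices of a broken geodesic as a linear function of `(x, (ξ, U))`. -/
noncomputable def pathCLM (k N : ℕ) : EucSp k × ParamSp k N →L[ℝ] (Fin (N + 2) → EucSp k) :=
  LinearMap.toContinuousLinearMap
    { toFun := fun w => brokenPath w.2.1 w.2.2 w.1
      map_add' := fun v w => funext <| forall_fin_path (by simp) (by simp) (by simp)
      map_smul' := fun c w => funext <| forall_fin_path (by simp) (by simp) (by simp) }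

/-- The `j`-th edge of a broken geodesic as a linear function of `(x, (ξ, U))`. -/
noncomputable def edgeCLM (k N : ℕ) (j : Fin (N + 1)) :
    EucSp k × ParamSp k N →L[ℝ] EucSp k × EucSp k :=
  ((ContinuousLinearMap.proj j.castSucc).comp (pathCLM k N)).prod
    ((ContinuousLinearMap.proj j.succ).comp (pathCLM k N))

theorem edgeCLM_apply (j : Fin (N + 1)) (w : EucSp k × ParamSp k N) :
    edgeCLM k N j w =
      (brokenPath w.2.1 w.2.2 w.1 j.castSucc, brokenPath w.2.1 w.2.2 w.1 j.succ) := rfl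

theorem edgeCLM_vertices (Z : Fin (N + 2) → EucSp k) (j : Fin (N + 1)) :
    edgeCLM k N j (Z (Fin.last (N + 1)), Z 0, fun i => Z i.castSucc.succ) =
      (Z j.castSucc, Z j.succ) := by
  simp only [edgeCLM_apply, brokenPath_eta]

theorem gradient_eq_of_hasFDerivAt {F : Type*} [NormedAddCommGroup F] [InnerProductSpace ℝ F]
    [CompleteSpace F] {f : F → ℝ} {D : F →L[ℝ] ℝ} {x g : F} (hf : HasFDerivAt f D x)
    (hD : ∀ v, D v = inner ℝ g v) : gradient f x = g := by
  have hdual : D = InnerProductSpace.toDual ℝ _ g := ContinuousLinearMap.ext hD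
  rw [hdual] at hf
  exact HasGradientAt.gradient hf

/-- The linear form `(a, u) ↦ ⟨c₀, a⟩ + ∑ ⟨c i, u i⟩` on the space of parameters. -/
noncomputable def paramForm (c₀ : EucSp k) (c : Fin N → EucSp k) : ParamSp k N →L[ℝ] ℝ :=
  (innerSL ℝ c₀).comp (ContinuousLinearMap.fst ℝ _ _) +
    ∑ i, (innerSL ℝ (c i)).comp
      ((ContinuousLinearMap.proj i).comp (ContinuousLinearMap.snd ℝ _ _))

theorem paramForm_apply (c₀ : EucSp k) (c : Fin N → EucSp k) (v : ParamSp k N) :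
    paramForm c₀ c v = inner ℝ c₀ v.1 + ∑ i, inner ℝ (c i) (v.2 i) := by
  simp [paramForm]

theorem paramForm_smul (l : ℝ) (c₀ : EucSp k) (c : Fin N → EucSp k) :
    paramForm (l • c₀) (l • c) = l • paramForm c₀ c := by
  refine ContinuousLinearMap.ext fun v => ?_
  simp only [paramForm_apply, Pi.smul_apply, inner_smul_left, smul_apply, smul_eq_mul, mul_add,
    Finset.mul_sum, conj_trivial]

theorem paramForm_eq_zero_iff {c₀ : EucSp k} {c : Fin N → EucSp k} :
    paramForm c₀ c = 0 ↔ c₀ = 0 ∧ c = 0 := by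
  constructor
  · intro hzero
    have hsum : inner ℝ c₀ c₀ + ∑ i, inner ℝ (c i) (c i) = 0 :=
      (paramForm_apply c₀ c (c₀, c)).symm.trans (DFunLike.congr_fun hzero (c₀, c))
    have hnonneg : ∀ i ∈ Finset.univ, 0 ≤ inner ℝ (c i) (c i) := fun i _ => real_inner_self_nonneg
    obtain ⟨hc₀, hc⟩ := (add_eq_zero_iff_of_nonneg real_inner_self_nonneg
      (Finset.sum_nonneg hnonneg)).1 hsum
    exact ⟨inner_self_eq_zero.1 hc₀, funext fun i => inner_self_eq_zero.1
      ((Finset.sum_eq_zero_iff_of_nonneg hnonneg).1 hc i (Finset.mem_univ i))⟩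
  · rintro ⟨rfl, rfl⟩
    refine ContinuousLinearMap.ext fun v => ?_
    simp [paramForm_apply]

theorem exists_eq_paramForm (ℓ : ParamSp k N →L[ℝ] ℝ) : ∃ c₀ c, ℓ = paramForm c₀ c := by
  refine ⟨(InnerProductSpace.toDual ℝ _).symm (ℓ.comp (ContinuousLinearMap.inl ℝ _ _)),
    fun i => (InnerProductSpace.toDual ℝ _).symm ((ℓ.comp (ContinuousLinearMap.inr ℝ _ _)).comp
      (ContinuousLinearMap.single ℝ (fun _ : Fin N => EucSp k) i)),
    ContinuousLinearMap.ext fun v => ?_⟩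
  simp only [paramForm_apply, InnerProductSpace.toDual_symm_apply,
    ContinuousLinearMap.comp_apply, ContinuousLinearMap.inl_apply]
  have hsum : ∑ i, ℓ (ContinuousLinearMap.inr ℝ (EucSp k) (Fin N → EucSp k)
      (ContinuousLinearMap.single ℝ (fun _ : Fin N => EucSp k) i (v.2 i))) = ℓ (0, v.2) := by
    rw [← map_sum, ← map_sum]
    exact congrArg (fun u => ℓ (0, u)) (Finset.univ_sum_single v.2)
  rw [hsum, ← map_add, Prod.mk_add_mk, add_zero, zero_add]

/-- The sum of the functions `S j` over the edges of a broken geodesic, as a function of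
`(x, (ξ, U))`. -/
noncomputable def pathSum (S : Fin (N + 1) → EucSp k → EucSp k → ℝ)
    (w : EucSp k × ParamSp k N) : ℝ :=
  ∑ j, S j (edgeCLM k N j w).1 (edgeCLM k N j w).2

/-- The jumps of the momentum at the interior vertices of a broken geodesic, where the `j`-th edge
starts with momentum `P j` and ends with momentum `p j`. -/
noncomputable def momentumJump (P p : Fin (N + 1) → EucSp k × EucSp k → EucSp k)
    (w : EucSp k × ParamSp k N) (i : Fin N) : EucSp k :=
  p i.castSucc (edgeCLM k N i.castSucc w) - P i.succ (edgeCLM k N i.succ w)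

variable {S : Fin (N + 1) → EucSp k → EucSp k → ℝ}
  {φ : Fin (N + 1) → EucSp k × EucSp k → EucSp k × EucSp k}
  {P p : Fin (N + 1) → EucSp k × EucSp k → EucSp k}

theorem contDiff_pathSum (hS : ∀ j, IsTwistGF (S j) (φ j) (P j) (p j)) :
    ContDiff ℝ 2 (pathSum S) :=
  ContDiff.sum fun j _ => (hS j).contDiff.comp (edgeCLM k N j).contDiff

theorem hasFDerivAt_pathSum (hS : ∀ j, IsTwistGF (S j) (φ j) (P j) (p j))
    (w : EucSp k × ParamSp k N) :
    HasFDerivAt (pathSum S)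
      ((innerSL ℝ (p (Fin.last N) (edgeCLM k N (Fin.last N) w))).comp
        (ContinuousLinearMap.fst ℝ _ _) +
      (paramForm (-P 0 (edgeCLM k N 0 w)) (momentumJump P p w)).comp
        (ContinuousLinearMap.snd ℝ _ _)) w := by
  have hsum : HasFDerivAt (pathSum S) (∑ j, (sympForm (p j (edgeCLM k N j w),
      P j (edgeCLM k N j w))).comp (edgeCLM k N j)) w :=
    HasFDerivAt.fun_sum fun j _ => ((hS j).hasFDerivAt _).comp w (edgeCLM k N j).hasFDerivAt
  refine hsum.congr_fderiv (ContinuousLinearMap.ext fun v => ?_)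
  have hv : ∀ j, edgeCLM k N j v = _ := fun j => edgeCLM_apply j v
  simp only [sum_apply, ContinuousLinearMap.comp_apply, sympForm_apply, hv, add_apply,
    paramForm_apply, ContinuousLinearMap.coe_fst', ContinuousLinearMap.coe_snd',
    innerSL_apply_apply]
  -- Summation by parts: the contributions of the two edges at each interior vertex are collected.
  rw [Finset.sum_sub_distrib, Fin.sum_univ_castSucc]
  conv_lhs => rw [Fin.sum_univ_succ (n := N)]
  simp only [brokenPath_castSucc_succ, brokenPath_succ_castSucc, Fin.succ_last, brokenPath_last,
    Fin.castSucc_zero, brokenPath_zero, momentumJump, inner_sub_left, Finset.sum_sub_distrib,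
    inner_neg_left]
  ring

theorem gradient_pathSum_end (hS : ∀ j, IsTwistGF (S j) (φ j) (P j) (p j)) (x : EucSp k)
    (q : ParamSp k N) :
    gradient (fun x' => pathSum S (x', q)) x = p (Fin.last N) (edgeCLM k N (Fin.last N) (x, q)) :=
  gradient_eq_of_hasFDerivAt (HasFDerivAt.comp (f := fun x' => (x', q)) x
    (hasFDerivAt_pathSum hS (x, q)) (hasFDerivAt_prodMk_left x q)) fun v => by simp

theorem hasFDerivAt_pathSum_param (hS : ∀ j, IsTwistGF (S j) (φ j) (P j) (p j)) (x : EucSp k)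
    (q : ParamSp k N) :
    HasFDerivAt (fun q' => pathSum S (x, q'))
      (paramForm (-P 0 (edgeCLM k N 0 (x, q))) (momentumJump P p (x, q))) q := by
  refine (HasFDerivAt.comp (f := fun q' => (x, q')) q (hasFDerivAt_pathSum hS (x, q))
    (hasFDerivAt_prodMk_right x q)).congr_fderiv (ContinuousLinearMap.ext fun v => ?_)
  simp

theorem gradient_pathSum_start (hS : ∀ j, IsTwistGF (S j) (φ j) (P j) (p j)) (x X : EucSp k)
    (U : Fin N → EucSp k) :
    gradient (fun X' => pathSum S (x, X', U)) X = -P 0 (edgeCLM k N 0 (x, X, U)) :=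
  gradient_eq_of_hasFDerivAt (HasFDerivAt.comp (f := fun X' => (X', U)) X
    (hasFDerivAt_pathSum_param hS x (X, U)) (hasFDerivAt_prodMk_left X U))
    fun v => by simp [paramForm_apply]

theorem fderiv_pathSum_interior_eq_zero_iff (hS : ∀ j, IsTwistGF (S j) (φ j) (P j) (p j))
    (x X : EucSp k) (U : Fin N → EucSp k) :
    fderiv ℝ (fun V : Fin N → EucSp k => pathSum S (x, X, V)) U = 0 ↔
      momentumJump P p (x, X, U) = 0 := by
  have hderiv : fderiv ℝ (fun V : Fin N → EucSp k => pathSum S (x, X, V)) U =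
      (paramForm 0 (momentumJump P p (x, X, U))).comp (ContinuousLinearMap.inr ℝ _ _) := by
    refine (HasFDerivAt.comp (f := fun V => (X, V)) U (hasFDerivAt_pathSum_param hS x (X, U))
      (hasFDerivAt_prodMk_right X U)).fderiv.trans (ContinuousLinearMap.ext fun v => ?_)
    simp [paramForm_apply]
  rw [hderiv]
  constructor
  · intro hzero
    refine (paramForm_eq_zero_iff (c₀ := 0).1 (ContinuousLinearMap.ext fun v => ?_)).2
    simpa [paramForm_apply] using DFunLike.congr_fun hzero v.2
  · intro hjump
    rw [hjump, paramForm_eq_zero_iff.2 ⟨rfl, rfl⟩, ContinuousLinearMap.zero_comp]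

theorem fderiv_add_pathSum (hS : ∀ j, IsTwistGF (S j) (φ j) (P j) (p j)) {σ : EucSp k → ℝ}
    (hσ : Differentiable ℝ σ) (x : EucSp k) (q : ParamSp k N) :
    fderiv ℝ (fun q : ParamSp k N => σ q.1 + pathSum S (x, q)) q =
      paramForm (gradient σ q.1 - P 0 (edgeCLM k N 0 (x, q))) (momentumJump P p (x, q)) := by
  have hσq : HasFDerivAt (fun q : ParamSp k N => σ q.1) _ q :=
    (hσ q.1).hasFDerivAt.comp q hasFDerivAt_fst
  refine (hσq.add (hasFDerivAt_pathSum_param hS x q)).fderiv.trans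
    (ContinuousLinearMap.ext fun v => ?_)
  simp only [add_apply, ContinuousLinearMap.comp_apply, ContinuousLinearMap.coe_fst',
    paramForm_apply, inner_neg_left, inner_sub_left, inner_gradient_left]
  ring

theorem fderiv_add_pathSum_eq_zero_iff (hS : ∀ j, IsTwistGF (S j) (φ j) (P j) (p j))
    {σ : EucSp k → ℝ} (hσ : Differentiable ℝ σ) (x : EucSp k) (q : ParamSp k N) :
    fderiv ℝ (fun q : ParamSp k N => σ q.1 + pathSum S (x, q)) q = 0 ↔
      gradient σ q.1 = P 0 (edgeCLM k N 0 (x, q)) ∧ momentumJump P p (x, q) = 0 := by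
  rw [fderiv_add_pathSum hS hσ, paramForm_eq_zero_iff, sub_eq_zero]

theorem orbit_of_momentumJump_eq_zero (hS : ∀ j, IsTwistGF (S j) (φ j) (P j) (p j))
    {w : EucSp k × ParamSp k N} (hjump : momentumJump P p w = 0)
    {z : Fin (N + 2) → EucSp k × EucSp k} (hz0 : z 0 = (w.2.1, P 0 (edgeCLM k N 0 w)))
    (hz : ∀ j, z (Fin.succ j) = φ j (z j.castSucc)) :
    (∀ j : Fin (N + 1), z j.castSucc = ((edgeCLM k N j w).1, P j (edgeCLM k N j w))) ∧
      z (Fin.last (N + 1)) = (w.1, p (Fin.last N) (edgeCLM k N (Fin.last N) w)) := by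
  have hstep : ∀ j : Fin (N + 1), φ j ((edgeCLM k N j w).1, P j (edgeCLM k N j w)) =
      ((edgeCLM k N j w).2, p j (edgeCLM k N j w)) := fun j =>
    ((hS j).flow_iff _ _ _ _).2 ⟨rfl, rfl⟩
  have hstart : ∀ j : Fin (N + 1),
      z j.castSucc = ((edgeCLM k N j w).1, P j (edgeCLM k N j w)) := by
    intro j
    induction j using Fin.induction with
    | zero => simpa [edgeCLM_apply] using hz0
    | succ i ih =>
      rw [← Fin.succ_castSucc, hz, ih, hstep, sub_eq_zero.1 (congrFun hjump i)]
      refine Prod.ext ?_ rfl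
      simp only [edgeCLM_apply, Fin.succ_castSucc]
  refine ⟨hstart, ?_⟩
  rw [← Fin.succ_last, hz, hstart, hstep]
  refine Prod.ext ?_ rfl
  simp only [edgeCLM_apply, Fin.succ_last, brokenPath_last]

theorem orbit_iff_exists_momentumJump_eq_zero
    {Φ : Fin (N + 2) → EucSp k × EucSp k → EucSp k × EucSp k}
    (hS : ∀ j, IsTwistGF (S j) (φ j) (P j) (p j)) (hΦ0 : ∀ z, Φ 0 z = z)
    (hΦ : ∀ j z, Φ (Fin.succ j) z = φ j (Φ j.castSucc z)) (X Q x q : EucSp k) :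
    Φ (Fin.last (N + 1)) (X, Q) = (x, q) ↔
      ∃ U : Fin N → EucSp k, momentumJump P p (x, X, U) = 0 ∧
        Q = P 0 (edgeCLM k N 0 (x, X, U)) ∧
        q = p (Fin.last N) (edgeCLM k N (Fin.last N) (x, X, U)) := by
  constructor
  · intro hlast
    set Z : Fin (N + 2) → EucSp k := fun j => (Φ j (X, Q)).1 with hZ
    have hedge : ∀ j : Fin (N + 1), edgeCLM k N j (x, X, fun i => Z i.castSucc.succ) =
        (Z j.castSucc, Z j.succ) := fun j => by
      rw [← edgeCLM_vertices]
      simp only [hZ, hlast, hΦ0]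
    have hmomenta : ∀ j : Fin (N + 1),
        (Φ j.castSucc (X, Q)).2 = P j (Z j.castSucc, Z j.succ) ∧
          (Φ j.succ (X, Q)).2 = p j (Z j.castSucc, Z j.succ) := fun j =>
      ((hS j).flow_iff _ _ _ _).1 (by simp only [hZ, Prod.mk.eta, hΦ])
    refine ⟨fun i => Z i.castSucc.succ, funext fun i => ?_, ?_, ?_⟩
    · rw [momentumJump, hedge, hedge, ← (hmomenta _).2, ← (hmomenta _).1, Fin.succ_castSucc,
        sub_self, Pi.zero_apply]
    · rw [hedge, ← (hmomenta _).1, Fin.castSucc_zero, hΦ0]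
    · rw [hedge, ← (hmomenta _).2, Fin.succ_last, hlast]
  · rintro ⟨U, hjump, rfl, rfl⟩
    exact (orbit_of_momentumJump_eq_zero hS hjump
      (z := fun j => Φ j (X, P 0 (edgeCLM k N 0 (x, X, U)))) (hΦ0 _) (fun j => hΦ j _)).2

theorem generatesMap_pathSum {Φ : Fin (N + 2) → EucSp k × EucSp k → EucSp k × EucSp k}
    (hS : ∀ j, IsTwistGF (S j) (φ j) (P j) (p j)) (hΦ0 : ∀ z, Φ 0 z = z)
    (hΦ : ∀ j z, Φ (Fin.succ j) z = φ j (Φ j.castSucc z)) :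
    GeneratesMap (fun X x (U : Fin N → EucSp k) => pathSum S (x, X, U))
      (Φ (Fin.last (N + 1))) := fun X Q x q => by
  simp only [orbit_iff_exists_momentumJump_eq_zero hS hΦ0 hΦ,
    fderiv_pathSum_interior_eq_zero_iff hS, gradient_pathSum_start hS, gradient_pathSum_end hS,
    neg_neg]

theorem generatesSet_add_pathSum {Φ : Fin (N + 2) → EucSp k × EucSp k → EucSp k × EucSp k}
    (hS : ∀ j, IsTwistGF (S j) (φ j) (P j) (p j)) (hΦ0 : ∀ z, Φ 0 z = z)
    (hΦ : ∀ j z, Φ (Fin.succ j) z = φ j (Φ j.castSucc z)) {σ : EucSp k → ℝ}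
    (hσ : Differentiable ℝ σ) :
    GeneratesSet (fun x (q : ParamSp k N) => σ q.1 + pathSum S (x, q))
      (Φ (Fin.last (N + 1)) '' range fun ξ => (ξ, gradient σ ξ)) := by
  ext ⟨x, y⟩
  have hgrad : ∀ ξ U, gradient (fun x' => σ ξ + pathSum S (x', ξ, U)) x =
      p (Fin.last N) (edgeCLM k N (Fin.last N) (x, ξ, U)) := fun ξ U => by
    rw [← gradient_pathSum_end hS, gradient, gradient, fderiv_const_add]
  simp only [mem_image, mem_range, exists_exists_eq_and, mem_ofPred_eq,
    fderiv_add_pathSum_eq_zero_iff hS hσ,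
    orbit_iff_exists_momentumJump_eq_zero hS hΦ0 hΦ, Prod.exists]
  refine exists_congr fun ξ => exists_congr fun U => ?_
  rw [hgrad]
  tauto

end BrokenPath

section RegularValue

variable {k N : ℕ} {S : Fin (N + 1) → EucSp k → EucSp k → ℝ}
  {φ : Fin (N + 1) → EucSp k × EucSp k → EucSp k × EucSp k}
  {P p : Fin (N + 1) → EucSp k × EucSp k → EucSp k}

/-- The orbit of `z` under the successive maps `φ j`, where the impulse `l • c j` is subtracted
from the momentum at the `j`-th vertex. -/
noncomputable def impulseOrbit (φ : Fin (N + 1) → EucSp k × EucSp k → EucSp k × EucSp k)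
    (c : Fin (N + 2) → EucSp k) (z : EucSp k × EucSp k) (l : ℝ) (j : Fin (N + 2)) :
    EucSp k × EucSp k :=
  Fin.induction (motive := fun _ => EucSp k × EucSp k) (z - (0, l • c 0))
    (fun j y => φ j y - (0, l • c j.succ)) j

theorem impulseOrbit_zero (c : Fin (N + 2) → EucSp k) (z : EucSp k × EucSp k) (l : ℝ) :
    impulseOrbit φ c z l 0 = z - (0, l • c 0) := rfl

theorem impulseOrbit_succ (c : Fin (N + 2) → EucSp k) (z : EucSp k × EucSp k) (l : ℝ)
    (j : Fin (N + 1)) :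
    impulseOrbit φ c z l j.succ = φ j (impulseOrbit φ c z l j.castSucc) - (0, l • c j.succ) := by
  simp only [impulseOrbit, Fin.induction_succ]

theorem contDiff_impulseOrbit (hφ : ∀ j, ContDiff ℝ 1 (φ j)) (c : Fin (N + 2) → EucSp k)
    (z : EucSp k × EucSp k) (j : Fin (N + 2)) :
    ContDiff ℝ 1 fun l => impulseOrbit φ c z l j := by
  induction j using Fin.induction with
  | zero =>
    simp only [impulseOrbit_zero]
    fun_prop
  | succ j ih =>
    simp only [impulseOrbit_succ]
    exact ((hφ j).comp ih).sub (by fun_prop)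

/-- The broken geodesic through the positions of `impulseOrbit φ c z l`. -/
noncomputable def impulsePath (φ : Fin (N + 1) → EucSp k × EucSp k → EucSp k × EucSp k)
    (c : Fin (N + 2) → EucSp k) (z : EucSp k × EucSp k) (l : ℝ) : EucSp k × ParamSp k N :=
  ((impulseOrbit φ c z l (Fin.last (N + 1))).1, (impulseOrbit φ c z l 0).1,
    fun i => (impulseOrbit φ c z l i.castSucc.succ).1)

theorem contDiff_impulsePath (hφ : ∀ j, ContDiff ℝ 1 (φ j)) (c : Fin (N + 2) → EucSp k)
    (z : EucSp k × EucSp k) : ContDiff ℝ 1 (impulsePath φ c z) :=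
  (contDiff_fst.comp (contDiff_impulseOrbit hφ c z _)).prodMk
    ((contDiff_fst.comp (contDiff_impulseOrbit hφ c z _)).prodMk
      (contDiff_pi.2 fun _ => contDiff_fst.comp (contDiff_impulseOrbit hφ c z _)))

theorem momenta_impulsePath (hS : ∀ j, IsTwistGF (S j) (φ j) (P j) (p j))
    (c : Fin (N + 2) → EucSp k) (z : EucSp k × EucSp k) (l : ℝ) (j : Fin (N + 1)) :
    (impulseOrbit φ c z l j.castSucc).2 = P j (edgeCLM k N j (impulsePath φ c z l)) ∧
      (impulseOrbit φ c z l j.succ).2 + l • c j.succ =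
        p j (edgeCLM k N j (impulsePath φ c z l)) := by
  have hedge : edgeCLM k N j (impulsePath φ c z l) =
      ((impulseOrbit φ c z l j.castSucc).1, (impulseOrbit φ c z l j.succ).1) :=
    edgeCLM_vertices (fun j => (impulseOrbit φ c z l j).1) j
  rw [hedge]
  refine ((hS j).flow_iff _ _ _ _).1 ?_
  rw [impulseOrbit_succ]
  refine Prod.ext ?_ ?_ <;> simp

theorem fderiv_impulsePath (hS : ∀ j, IsTwistGF (S j) (φ j) (P j) (p j)) {σ : EucSp k → ℝ}
    (hσ : Differentiable ℝ σ) (c₀ x ξ : EucSp k) (c : Fin N → EucSp k) (l : ℝ) :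
    fderiv ℝ (fun q : ParamSp k N => σ q.1 + pathSum S
        ((impulsePath φ (brokenPath c₀ c x) (ξ, gradient σ ξ) l).1, q))
        (impulsePath φ (brokenPath c₀ c x) (ξ, gradient σ ξ) l).2 = l • paramForm c₀ c := by
  have hmomenta := momenta_impulsePath hS (brokenPath c₀ c x) (ξ, gradient σ ξ) l
  rw [fderiv_add_pathSum hS hσ, Prod.mk.eta, ← paramForm_smul]
  congr 1
  · rw [← (hmomenta 0).1]
    simp [impulsePath, impulseOrbit_zero]
  · funext i
    rw [momentumJump, ← (hmomenta _).2, ← (hmomenta _).1, Fin.succ_castSucc]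
    simp

theorem impulsePath_zero (hS : ∀ j, IsTwistGF (S j) (φ j) (P j) (p j))
    (c : Fin (N + 2) → EucSp k) {w : EucSp k × ParamSp k N} (hjump : momentumJump P p w = 0) :
    impulsePath φ c (w.2.1, P 0 (edgeCLM k N 0 w)) 0 = w := by
  obtain ⟨hstart, hlast⟩ := orbit_of_momentumJump_eq_zero hS hjump
    (z := impulseOrbit φ c (w.2.1, P 0 (edgeCLM k N 0 w)) 0) (by simp [impulseOrbit_zero])
    (fun j => by simp [impulseOrbit_succ])
  refine Prod.ext ?_ (Prod.ext ?_ (funext fun i => ?_))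
  · simp [impulsePath, hlast]
  · simp [impulsePath, impulseOrbit_zero]
  · simp only [impulsePath]
    rw [Fin.succ_castSucc, hstart]
    simp [edgeCLM_apply]

theorem differentiable_fderiv_slice {E F G : Type*} [NormedAddCommGroup E] [NormedSpace ℝ E]
    [NormedAddCommGroup F] [NormedSpace ℝ F] [NormedAddCommGroup G] [NormedSpace ℝ G]
    {g : E × F → G} (hg : ContDiff ℝ 2 g) :
    Differentiable ℝ fun w : E × F => fderiv ℝ (fun q => g (w.1, q)) w.2 := by
  have hslice : (fun w : E × F => fderiv ℝ (fun q => g (w.1, q)) w.2) =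
      fun w => (fderiv ℝ g w).comp (ContinuousLinearMap.inr ℝ E F) := funext fun w =>
    (HasFDerivAt.comp (f := fun q => (w.1, q)) w.2
      ((hg.differentiable (by simp) w).hasFDerivAt) (hasFDerivAt_prodMk_right w.1 w.2)).fderiv
  have hfderiv : Differentiable ℝ (fderiv ℝ g) :=
    (hg.fderiv_right (m := 1) (by rw [one_add_one_eq_two])).differentiable (by simp)
  rw [hslice]
  exact hfderiv.clm_comp (differentiable_const _)

theorem zeroIsRegularValue_add_pathSum (hS : ∀ j, IsTwistGF (S j) (φ j) (P j) (p j))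
    (hφ : ∀ j, ContDiff ℝ 1 (φ j)) {σ : EucSp k → ℝ} (hσ : ContDiff ℝ 2 σ) :
    ZeroIsRegularValue (fun x (q : ParamSp k N) => σ q.1 + pathSum S (x, q)) := by
  intro w hw ℓ
  have hσ' : Differentiable ℝ σ := hσ.differentiable (by simp)
  obtain ⟨c₀, c, rfl⟩ := exists_eq_paramForm ℓ
  obtain ⟨hgrad, hjump⟩ := (fderiv_add_pathSum_eq_zero_iff hS hσ' _ _).1 hw
  -- Along the broken geodesics obtained from impulses `l • c` the differential is `l • ℓ`.
  let γ : ℝ → EucSp k × ParamSp k N :=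
    impulsePath φ (brokenPath c₀ c 0) (w.2.1, gradient σ w.2.1)
  have hγ0 : γ 0 = w := by
    simp only [γ, hgrad]
    exact impulsePath_zero hS _ hjump
  have hdiff := differentiable_fderiv_slice (g := fun w : EucSp k × ParamSp k N =>
    σ w.2.1 + pathSum S w) ((hσ.comp (contDiff_fst.comp contDiff_snd)).add (contDiff_pathSum hS))
  have hderiv := (hdiff (γ 0)).hasFDerivAt.comp_hasDerivAt 0
    ((contDiff_impulsePath hφ _ _).differentiable (by simp) 0 : DifferentiableAt ℝ γ 0).hasDerivAt
  refine ⟨deriv γ 0, ?_⟩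
  rw [hγ0] at hderiv
  refine hderiv.unique ?_
  have hline : HasDerivAt (fun l : ℝ => l • paramForm c₀ c) (paramForm c₀ c) 0 := by
    simpa using (hasDerivAt_id (0 : ℝ)).smul_const (paramForm c₀ c)
  exact hline.congr_of_eventuallyEq (.of_forall fun l => fderiv_impulsePath hS hσ' c₀ 0 w.2.1 c l)

end RegularValue

section NormalForm

/-- `f` is bounded by `A` and Lipschitz with constant `L`; both constants are real numbers so that
they can be computed for products and compositions. -/
structure BoundedLipschitz {E F : Type*} [SeminormedAddCommGroup E] [SeminormedAddCommGroup F]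
    (f : E → F) (A L : ℝ) : Prop where
  norm_le : ∀ x, ‖f x‖ ≤ A
  norm_sub_le : ∀ x y, ‖f x - f y‖ ≤ L * ‖x - y‖

namespace BoundedLipschitz

variable {E F G₁ G₂ : Type*} [NormedAddCommGroup E] [NormedAddCommGroup F] {f : E → F}
  {A A' L L' : ℝ}

theorem add {g : E → F} (hf : BoundedLipschitz f A L) (hg : BoundedLipschitz g A' L') :
    BoundedLipschitz (fun x => f x + g x) (A + A') (L + L') where
  norm_le x := norm_add_le_of_le (hf.norm_le x) (hg.norm_le x)
  norm_sub_le x y := by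
    rw [add_sub_add_comm, add_mul]
    exact norm_add_le_of_le (hf.norm_sub_le x y) (hg.norm_sub_le x y)

theorem sum {ι : Type*} {s : Finset ι} {f : ι → E → F} {A L : ι → ℝ}
    (hf : ∀ i ∈ s, BoundedLipschitz (f i) (A i) (L i)) :
    BoundedLipschitz (fun x => ∑ i ∈ s, f i x) (∑ i ∈ s, A i) (∑ i ∈ s, L i) where
  norm_le x := norm_sum_le_of_le s fun i hi => (hf i hi).norm_le x
  norm_sub_le x y := by
    rw [← Finset.sum_sub_distrib, Finset.sum_mul]
    exact norm_sum_le_of_le s fun i hi => (hf i hi).norm_sub_le x y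

theorem mono (hf : BoundedLipschitz f A L) (hA : A ≤ A') (hL : L ≤ L') :
    BoundedLipschitz f A' L' where
  norm_le x := (hf.norm_le x).trans hA
  norm_sub_le x y := (hf.norm_sub_le x y).trans (by gcongr)

theorem comp_clm_slice [NormedSpace ℝ E] [NormedAddCommGroup G₁] [NormedSpace ℝ G₁]
    [NormedAddCommGroup G₂] [NormedSpace ℝ G₂] (hf : BoundedLipschitz f A L) (hL : 0 ≤ L)
    (Λ : G₁ × G₂ →L[ℝ] E) (x : G₁) :
    BoundedLipschitz (fun η => f (Λ (x, η))) A (L * ‖Λ‖) where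
  norm_le η := hf.norm_le _
  norm_sub_le η η' := by
    have hslice : ‖Λ (x, η) - Λ (x, η')‖ ≤ ‖Λ‖ * ‖η - η'‖ := by
      rw [← map_sub]
      simpa using Λ.le_opNorm ((x, η) - (x, η'))
    rw [mul_assoc]
    exact (hf.norm_sub_le _ _).trans (by gcongr)

variable [NormedSpace ℝ F] [NormedAddCommGroup G₁] [NormedSpace ℝ G₁] [NormedAddCommGroup G₂]
  [NormedSpace ℝ G₂] {g : E → G₁}

theorem clm_comp (hf : BoundedLipschitz f A L) (G : F →L[ℝ] G₁) :
    BoundedLipschitz (fun x => G (f x)) (‖G‖ * A) (‖G‖ * L) where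
  norm_le x := (G.le_opNorm _).trans (by gcongr; exact hf.norm_le x)
  norm_sub_le x y := by
    rw [← map_sub, mul_assoc]
    exact (G.le_opNorm _).trans (by gcongr; exact hf.norm_sub_le x y)

theorem bilin (hf : BoundedLipschitz f A L) (hg : BoundedLipschitz g A' L')
    (β : F →ₗ[ℝ] G₁ →ₗ[ℝ] G₂) {c : ℝ} (hc : 0 ≤ c) (hβ : ∀ a b, ‖β a b‖ ≤ c * ‖a‖ * ‖b‖) :
    BoundedLipschitz (fun x => β (f x) (g x)) (c * A * A') (c * (A * L' + L * A')) where
  norm_le x := by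
    have hA : 0 ≤ A := (norm_nonneg _).trans (hf.norm_le x)
    refine (hβ _ _).trans ?_
    gcongr
    exacts [hf.norm_le x, hg.norm_le x]
  norm_sub_le x y := by
    have hA : 0 ≤ A := (norm_nonneg _).trans (hf.norm_le x)
    have hL : 0 ≤ L * ‖x - y‖ := (norm_nonneg _).trans (hf.norm_sub_le x y)
    have hsplit : β (f x) (g x) - β (f y) (g y) = β (f x) (g x - g y) + β (f x - f y) (g y) := by
      rw [map_sub, map_sub, LinearMap.sub_apply]
      abel
    calc ‖β (f x) (g x) - β (f y) (g y)‖
        ≤ c * ‖f x‖ * ‖g x - g y‖ + c * ‖f x - f y‖ * ‖g y‖ := by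
          rw [hsplit]
          exact (norm_add_le _ _).trans (add_le_add (hβ _ _) (hβ _ _))
      _ ≤ c * A * (L' * ‖x - y‖) + c * (L * ‖x - y‖) * A' := by
          gcongr
          exacts [hf.norm_le x, hg.norm_sub_le x y, hf.norm_sub_le x y, hg.norm_le y]
      _ = c * (A * L' + L * A') * ‖x - y‖ := by ring

end BoundedLipschitz

section CutInversion

/-- A `C^∞` function on `ℝ` which vanishes for `y ≤ 1` and is `1 / y` for `2 ≤ y`; it turns the
inversion `η ↦ η / (η · η)` into a map without singularity. -/
noncomputable def cutInv (y : ℝ) : ℝ := Real.smoothTransition (y - 1) * y⁻¹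

theorem cutInv_of_le {y : ℝ} (h : y ≤ 1) : cutInv y = 0 := by
  rw [cutInv, Real.smoothTransition.zero_of_nonpos (by linarith), zero_mul]

theorem cutInv_of_ge {y : ℝ} (h : 2 ≤ y) : cutInv y = y⁻¹ := by
  rw [cutInv, Real.smoothTransition.one_of_one_le (by linarith), one_mul]

theorem abs_cutInv_le {y : ℝ} (hy : 0 < y) : |cutInv y| ≤ y⁻¹ := by
  rw [cutInv, abs_mul, abs_of_nonneg (Real.smoothTransition.nonneg _), abs_of_pos (inv_pos.2 hy)]
  exact mul_le_of_le_one_left (inv_pos.2 hy).le (Real.smoothTransition.le_one _)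

theorem abs_cutInv_le_one (y : ℝ) : |cutInv y| ≤ 1 := by
  rcases le_or_gt y 1 with h | h
  · simp [cutInv_of_le h]
  · exact (abs_cutInv_le (zero_lt_one.trans h)).trans (inv_le_one_of_one_le₀ h.le)

theorem contDiff_cutInv : ContDiff ℝ 1 cutInv := by
  rw [contDiff_iff_contDiffAt]
  intro y
  rcases eq_or_ne y 0 with rfl | hy
  · have hzero : cutInv =ᶠ[nhds 0] fun _ => 0 := by
      filter_upwards [Iio_mem_nhds (zero_lt_one' ℝ)] with y hy
      exact cutInv_of_le hy.le
    exact contDiffAt_const.congr_of_eventuallyEq hzero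
  · exact (Real.smoothTransition.contDiff.comp (contDiff_id.sub contDiff_const)).contDiffAt.mul
      (contDiffAt_inv ℝ hy)

theorem exists_abs_mul_deriv_cutInv_le : ∃ B, 0 ≤ B ∧ ∀ y, 0 ≤ y → |y * deriv cutInv y| ≤ B := by
  have hcont : Continuous fun y => y * deriv cutInv y :=
    continuous_id.mul (contDiff_cutInv.continuous_deriv (by simp))
  obtain ⟨C, hC⟩ := (isCompact_Icc (a := (0 : ℝ)) (b := 2)).exists_bound_of_continuousOn
    hcont.continuousOn
  refine ⟨max C 1, le_max_of_le_right zero_le_one, fun y hy => ?_⟩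
  rcases le_or_gt y 2 with hy2 | hy2
  · exact (hC y ⟨hy, hy2⟩).trans (le_max_left _ _)
  · have hinv : cutInv =ᶠ[nhds y] fun y => y⁻¹ := by
      filter_upwards [Ioi_mem_nhds hy2] with z hz
      exact cutInv_of_ge (le_of_lt hz)
    have hval : y * -(y ^ 2)⁻¹ = -y⁻¹ := by field_simp
    rw [hinv.deriv_eq, deriv_inv, hval, abs_neg, abs_of_pos (by positivity)]
    exact (inv_le_one_of_one_le₀ (by linarith)).trans (le_max_right _ _)

variable {ι : Type*} [Fintype ι]

theorem dotProduct_self_nonneg (η : ι → ℝ) : 0 ≤ η ⬝ᵥ η :=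
  Finset.sum_nonneg fun _ _ => mul_self_nonneg _

theorem sq_norm_le_dotProduct (η : ι → ℝ) : ‖η‖ ^ 2 ≤ η ⬝ᵥ η := by
  have hnorm : ‖η‖ ≤ Real.sqrt (η ⬝ᵥ η) := by
    refine (pi_norm_le_iff_of_nonneg (Real.sqrt_nonneg _)).2 fun i => Real.abs_le_sqrt ?_
    rw [sq]
    exact Finset.single_le_sum (f := fun i => η i * η i) (fun i _ => mul_self_nonneg _)
      (Finset.mem_univ i)
  calc ‖η‖ ^ 2 ≤ Real.sqrt (η ⬝ᵥ η) ^ 2 := by gcongr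
    _ = η ⬝ᵥ η := Real.sq_sqrt (dotProduct_self_nonneg η)

theorem abs_dotProduct_le (a b : ι → ℝ) : |a ⬝ᵥ b| ≤ Fintype.card ι * ‖a‖ * ‖b‖ := by
  have hterm : ∀ i ∈ Finset.univ, |a i * b i| ≤ ‖a‖ * ‖b‖ := fun i _ => by
    rw [abs_mul]
    exact mul_le_mul (norm_le_pi_norm a i) (norm_le_pi_norm b i) (abs_nonneg _) (norm_nonneg _)
  calc |a ⬝ᵥ b| ≤ ∑ i, |a i * b i| := Finset.abs_sum_le_sum_abs _ _
    _ ≤ ∑ _i : ι, ‖a‖ * ‖b‖ := Finset.sum_le_sum hterm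
    _ = Fintype.card ι * ‖a‖ * ‖b‖ := by simp [mul_assoc]

theorem contDiff_dotProduct {E : Type*} [NormedAddCommGroup E] [NormedSpace ℝ E]
    {n : WithTop ℕ∞} {a b : E → ι → ℝ} (ha : ContDiff ℝ n a) (hb : ContDiff ℝ n b) :
    ContDiff ℝ n fun x => a x ⬝ᵥ b x :=
  ContDiff.sum fun i _ => (contDiff_pi.1 ha i).mul (contDiff_pi.1 hb i)

theorem hasFDerivAt_dotProduct_self (η : ι → ℝ) :
    HasFDerivAt (fun η : ι → ℝ => η ⬝ᵥ η)
      (2 • LinearMap.toContinuousLinearMap (dotProductBilin ℝ ℝ η)) η := by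
  have hsum : HasFDerivAt (fun η : ι → ℝ => η ⬝ᵥ η)
      (∑ i, (η i • ContinuousLinearMap.proj (R := ℝ) (φ := fun _ : ι => ℝ) i +
        η i • ContinuousLinearMap.proj i)) η :=
    HasFDerivAt.fun_sum fun i _ => (hasFDerivAt_apply i η).mul (hasFDerivAt_apply i η)
  refine hsum.congr_fderiv (ContinuousLinearMap.ext fun v => ?_)
  simp [dotProduct, Finset.sum_add_distrib, two_mul]

/-- The inversion `η ↦ η / (η · η)`, cut off near the origin. -/
noncomputable def cutInversion (η : ι → ℝ) : ι → ℝ := cutInv (η ⬝ᵥ η) • η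

theorem contDiff_cutInversion : ContDiff ℝ 1 (cutInversion (ι := ι)) :=
  (contDiff_cutInv.comp (contDiff_dotProduct contDiff_id contDiff_id)).smul contDiff_id

theorem cutInversion_dotProduct_self {η : ι → ℝ} (hη : 2 ≤ ‖η‖) : cutInversion η ⬝ᵥ η = 1 := by
  have hdot : 2 ≤ η ⬝ᵥ η := by nlinarith [sq_norm_le_dotProduct η]
  rw [cutInversion, cutInv_of_ge hdot, smul_dotProduct, smul_eq_mul,
    inv_mul_cancel₀ (by positivity)]

theorem norm_cutInversion_le (η : ι → ℝ) : ‖cutInversion η‖ ≤ 1 := by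
  rw [cutInversion, norm_smul, Real.norm_eq_abs]
  rcases le_or_gt (η ⬝ᵥ η) 1 with h | h
  · simp [cutInv_of_le h]
  · have hnorm : ‖η‖ ≤ η ⬝ᵥ η := by
      nlinarith [sq_norm_le_dotProduct η, norm_nonneg η, sq_nonneg (‖η‖ - 1)]
    calc |cutInv (η ⬝ᵥ η)| * ‖η‖ ≤ (η ⬝ᵥ η)⁻¹ * (η ⬝ᵥ η) := by
          gcongr
          exact abs_cutInv_le (zero_lt_one.trans h)
      _ = 1 := inv_mul_cancel₀ (by positivity)

theorem hasFDerivAt_cutInversion (η : ι → ℝ) :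
    HasFDerivAt cutInversion (cutInv (η ⬝ᵥ η) • ContinuousLinearMap.id ℝ _ +
      (deriv cutInv (η ⬝ᵥ η) •
        2 • LinearMap.toContinuousLinearMap (dotProductBilin ℝ ℝ η)).smulRight η) η :=
  (((contDiff_cutInv.differentiable (by simp) _).hasDerivAt).comp_hasFDerivAt η
    (hasFDerivAt_dotProduct_self η)).smul (hasFDerivAt_id η)

theorem norm_cutInversion_sub_le {B : ℝ} (hB : 0 ≤ B)
    (hbound : ∀ y, 0 ≤ y → |y * deriv cutInv y| ≤ B) (η η' : ι → ℝ) :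
    ‖cutInversion η - cutInversion η'‖ ≤ (2 * Fintype.card ι * B + 1) * ‖η - η'‖ := by
  refine convex_univ.norm_image_sub_le_of_norm_hasFDerivWithin_le
    (fun w _ => (hasFDerivAt_cutInversion w).hasFDerivWithinAt) (fun w _ => ?_)
    (mem_univ η') (mem_univ η)
  refine ContinuousLinearMap.opNorm_le_bound _ (by positivity) fun u => ?_
  have hradial : ‖w‖ ^ 2 * |deriv cutInv (w ⬝ᵥ w)| ≤ B := by
    have hw := hbound _ (dotProduct_self_nonneg w)
    rw [abs_mul, abs_of_nonneg (dotProduct_self_nonneg w)] at hw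
    exact (mul_le_mul_of_nonneg_right (sq_norm_le_dotProduct w) (abs_nonneg _)).trans hw
  calc ‖cutInv (w ⬝ᵥ w) • u + (deriv cutInv (w ⬝ᵥ w) • 2 • (w ⬝ᵥ u)) • w‖
      ≤ |cutInv (w ⬝ᵥ w)| * ‖u‖ + |deriv cutInv (w ⬝ᵥ w)| * (2 * |w ⬝ᵥ u|) * ‖w‖ := by
        refine (norm_add_le _ _).trans_eq ?_
        simp [norm_smul]
    _ ≤ 1 * ‖u‖ + |deriv cutInv (w ⬝ᵥ w)| * (2 * (Fintype.card ι * ‖w‖ * ‖u‖)) * ‖w‖ := by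
        gcongr
        exacts [abs_cutInv_le_one _, abs_dotProduct_le w u]
    _ = ‖u‖ + 2 * Fintype.card ι * (‖w‖ ^ 2 * |deriv cutInv (w ⬝ᵥ w)|) * ‖u‖ := by ring
    _ ≤ ‖u‖ + 2 * Fintype.card ι * B * ‖u‖ := by gcongr
    _ = (2 * Fintype.card ι * B + 1) * ‖u‖ := by ring

theorem exists_small_cut_inversion (ι : Type*) [Fintype ι] {δ : ℝ} (hδ : 0 < δ) :
    ∃ (v : (ι → ℝ) → ι → ℝ) (C : ℝ), 0 < C ∧ ContDiff ℝ 1 v ∧ BoundedLipschitz v δ δ ∧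
      ∀ η, C ≤ ‖η‖ → v η ⬝ᵥ η = 1 := by
  obtain ⟨B, hB, hbound⟩ := exists_abs_mul_deriv_cutInv_le
  set L : ℝ := 2 * Fintype.card ι * B + 1
  have hL1 : 1 ≤ L := le_add_of_nonneg_left (by positivity)
  set l : ℝ := min 1 (δ / L)
  have hl0 : 0 < l := by positivity
  have hlL : l * L ≤ δ := (le_div_iff₀ (by positivity)).1 (min_le_right _ _)
  refine ⟨fun η => l • cutInversion (l • η), 2 / l, by positivity,
    (contDiff_cutInversion.comp (contDiff_id.const_smul l)).const_smul l,
    ⟨fun η => ?_, fun η η' => ?_⟩,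
    fun η hη => ?_⟩
  · calc ‖l • cutInversion (l • η)‖ = l * ‖cutInversion (l • η)‖ := norm_smul_of_nonneg hl0.le _
      _ ≤ l * L := by gcongr; exact (norm_cutInversion_le _).trans hL1
      _ ≤ δ := hlL
  · calc ‖l • cutInversion (l • η) - l • cutInversion (l • η')‖
        = l * ‖cutInversion (l • η) - cutInversion (l • η')‖ := by
          rw [← smul_sub, norm_smul_of_nonneg hl0.le]
      _ ≤ l * (L * (l * ‖η - η'‖)) := by
          rw [← norm_smul_of_nonneg hl0.le (η - η'), smul_sub]
          gcongr
          exact norm_cutInversion_sub_le hB hbound _ _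
      _ = l * (l * L) * ‖η - η'‖ := by ring
      _ ≤ 1 * δ * ‖η - η'‖ := by gcongr; exact min_le_left _ _
      _ = δ * ‖η - η'‖ := by rw [one_mul]
  · have hη' : 2 ≤ ‖l • η‖ := by
      rw [norm_smul_of_nonneg hl0.le]
      exact (div_le_iff₀' hl0).1 hη
    simpa only [smul_dotProduct, dotProduct_smul] using cutInversion_dotProduct_self hη'

end CutInversion

section QuadRoot

/-- The root `u` of `u + ½ y u² = 1` which is `1` at `y = 0`. -/
noncomputable def quadRoot (y : ℝ) : ℝ := 2 / (1 + Real.sqrt (1 + 2 * y))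

theorem quadRoot_eq {y : ℝ} (hy : -(1 / 2) ≤ y) : quadRoot y + 1 / 2 * y * quadRoot y ^ 2 = 1 := by
  have hsq : Real.sqrt (1 + 2 * y) ^ 2 = 1 + 2 * y := Real.sq_sqrt (by linarith)
  have hpos : 0 < 1 + Real.sqrt (1 + 2 * y) := by positivity
  have hy' : y = (Real.sqrt (1 + 2 * y) ^ 2 - 1) / 2 := by rw [hsq]; ring
  rw [quadRoot]
  set a := Real.sqrt (1 + 2 * y)
  rw [hy']
  field_simp
  ring

theorem abs_quadRoot_le (y : ℝ) : |quadRoot y| ≤ 2 := by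
  have hsqrt := Real.sqrt_nonneg (1 + 2 * y)
  rw [quadRoot, abs_of_nonneg (by positivity), div_le_iff₀ (by positivity)]
  linarith

theorem hasDerivAt_quadRoot {y : ℝ} (hy : -(1 / 2) < y) :
    HasDerivAt quadRoot
      (-2 / (Real.sqrt (1 + 2 * y) * (1 + Real.sqrt (1 + 2 * y)) ^ 2)) y := by
  have hpos : 0 < 1 + 2 * y := by linarith
  have hsqrt : HasDerivAt (fun y => 1 + Real.sqrt (1 + 2 * y)) (Real.sqrt (1 + 2 * y))⁻¹ y := by
    have hlin : HasDerivAt (fun y : ℝ => 1 + 2 * y) 2 y := by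
      simpa using ((hasDerivAt_id y).const_mul 2).const_add 1
    refine ((hlin.sqrt hpos.ne').const_add 1).congr_deriv ?_
    have := Real.sqrt_pos.2 hpos
    field_simp
  refine ((hasDerivAt_const y (2 : ℝ)).div hsqrt (by positivity)).congr_deriv ?_
  have := Real.sqrt_pos.2 hpos
  field_simp
  ring

theorem abs_quadRoot_sub_le {y z : ℝ} (hy : |y| ≤ 1 / 4) (hz : |z| ≤ 1 / 4) :
    |quadRoot y - quadRoot z| ≤ 4 * |y - z| := by
  have hderiv : ∀ u ∈ Icc (-(1 / 4) : ℝ) (1 / 4), HasDerivWithinAt quadRoot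
      (-2 / (Real.sqrt (1 + 2 * u) * (1 + Real.sqrt (1 + 2 * u)) ^ 2)) (Icc (-(1 / 4)) (1 / 4)) u :=
    fun u hu => (hasDerivAt_quadRoot (by linarith [hu.1])).hasDerivWithinAt
  refine (convex_Icc _ _).norm_image_sub_le_of_norm_hasDerivWithin_le hderiv (fun u hu => ?_)
    (abs_le.1 hz) (abs_le.1 hy)
  have hsqrt : 1 / 2 ≤ Real.sqrt (1 + 2 * u) :=
    Real.le_sqrt_of_sq_le (by norm_num; linarith [hu.1])
  rw [norm_div, Real.norm_of_nonneg (by positivity :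
    0 ≤ Real.sqrt (1 + 2 * u) * (1 + Real.sqrt (1 + 2 * u)) ^ 2), norm_neg, Real.norm_two,
    div_le_iff₀ (by positivity)]
  nlinarith [sq_nonneg (Real.sqrt (1 + 2 * u))]

theorem contDiffAt_quadRoot {n : WithTop ℕ∞} {y : ℝ} (hy : -(1 / 2) < y) :
    ContDiffAt ℝ n quadRoot y :=
  contDiffAt_const.div (contDiffAt_const.add (ContDiffAt.sqrt
    (contDiffAt_const.add (contDiffAt_const.mul contDiffAt_id)) (by simp; linarith)))
    (by positivity)

end QuadRoot

section QuadShift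

variable {ι : Type*} [Fintype ι]

/-- The solution `d ∈ ℝ · G w` of `½ (η + d) · B (η + d) = ½ η · B η + c`, where `G = B⁻¹` and
`w · η = 1`. -/
noncomputable def quadShift (G : (ι → ℝ) →L[ℝ] (ι → ℝ)) (w : ι → ℝ) (c : ℝ) : ι → ℝ :=
  (c * quadRoot (c * (w ⬝ᵥ G w))) • G w

theorem half_quadForm_add_quadShift {B : Matrix ι ι ℝ} (hB : B.IsSymm)
    {G : (ι → ℝ) →L[ℝ] (ι → ℝ)} (hBG : ∀ w, B.mulVec (G w) = w) {w η : ι → ℝ} {c : ℝ}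
    (hsmall : |c * (w ⬝ᵥ G w)| ≤ 1 / 4) (hw : w ⬝ᵥ η = 1) :
    1 / 2 * ((η + quadShift G w c) ⬝ᵥ B.mulVec (η + quadShift G w c)) =
      1 / 2 * (η ⬝ᵥ B.mulVec η) + c := by
  have hroot := quadRoot_eq (y := c * (w ⬝ᵥ G w)) (by linarith [(abs_le.1 hsmall).1])
  have hηG : η ⬝ᵥ B.mulVec (G w) = 1 := by rw [hBG, dotProduct_comm, hw]
  have hGη : G w ⬝ᵥ B.mulVec η = 1 := by
    rw [Matrix.dotProduct_mulVec, ← Matrix.mulVec_transpose, hB.eq, hBG, hw]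
  have hGG : G w ⬝ᵥ B.mulVec (G w) = w ⬝ᵥ G w := by rw [hBG, dotProduct_comm]
  simp only [quadShift, Matrix.mulVec_add, Matrix.mulVec_smul, add_dotProduct, dotProduct_add,
    smul_dotProduct, dotProduct_smul, hηG, hGη, hGG, smul_eq_mul]
  linear_combination c * hroot

theorem contDiff_quadShift {E : Type*} [NormedAddCommGroup E] [NormedSpace ℝ E] {n : WithTop ℕ∞}
    (G : (ι → ℝ) →L[ℝ] (ι → ℝ)) {w : E → ι → ℝ} {c : E → ℝ} (hw : ContDiff ℝ n w)
    (hc : ContDiff ℝ n c) (hsmall : ∀ x, |c x * (w x ⬝ᵥ G (w x))| ≤ 1 / 4) :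
    ContDiff ℝ n fun x => quadShift G (w x) (c x) := by
  have hGw : ContDiff ℝ n fun x => G (w x) := G.contDiff.comp hw
  have hy : ContDiff ℝ n fun x => c x * (w x ⬝ᵥ G (w x)) := hc.mul (contDiff_dotProduct hw hGw)
  have hroot : ContDiff ℝ n fun x => quadRoot (c x * (w x ⬝ᵥ G (w x))) :=
    contDiff_iff_contDiffAt.2 fun x =>
      (contDiffAt_quadRoot (by linarith [(abs_le.1 (hsmall x)).1])).comp x hy.contDiffAt
  exact (hc.mul hroot).smul hGw

namespace BoundedLipschitz

variable {E : Type*} [NormedAddCommGroup E] {G : (ι → ℝ) →L[ℝ] (ι → ℝ)} {w : E → ι → ℝ}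
  {c : E → ℝ} {M δ : ℝ}

theorem mul_dotProduct_apply (hc : BoundedLipschitz c M M) (hw : BoundedLipschitz w δ δ) :
    BoundedLipschitz (fun x => c x * (w x ⬝ᵥ G (w x))) (M * (Fintype.card ι * ‖G‖ * δ ^ 2))
      (3 * M * (Fintype.card ι * ‖G‖ * δ ^ 2)) := by
  have hdot := hw.bilin (hw.clm_comp G) (dotProductBilin ℝ ℝ) (Nat.cast_nonneg _) abs_dotProduct_le
  have hmul := hc.bilin hdot (LinearMap.mul ℝ ℝ) zero_le_one fun a b => by simp
  exact ⟨fun x => (hmul.norm_le x).trans_eq (by ring),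
    fun x y => (hmul.norm_sub_le x y).trans_eq (by ring)⟩

theorem quadShift (hc : BoundedLipschitz c M M) (hw : BoundedLipschitz w δ δ)
    (hsmall : M * (Fintype.card ι * ‖G‖ * δ ^ 2) ≤ 1 / 4) :
    BoundedLipschitz (fun x => quadShift G (w x) (c x)) (2 * M * (‖G‖ * δ))
      (7 * M * (‖G‖ * δ)) := by
  have hy := hc.mul_dotProduct_apply (G := G) hw
  have hy4 : ∀ x, |c x * (w x ⬝ᵥ G (w x))| ≤ 1 / 4 := fun x => (hy.norm_le x).trans hsmall
  have hroot : BoundedLipschitz (fun x => quadRoot (c x * (w x ⬝ᵥ G (w x)))) 2 3 :=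
    ⟨fun x => abs_quadRoot_le _, fun x x' => by
      refine (abs_quadRoot_sub_le (hy4 x) (hy4 x')).trans ?_
      have := hy.norm_sub_le x x'
      rw [Real.norm_eq_abs] at this
      nlinarith [norm_nonneg (x - x')]⟩
  have hcoeff := hc.bilin hroot (LinearMap.mul ℝ ℝ) zero_le_one fun a b => by simp
  have hshift := hcoeff.bilin (hw.clm_comp G) (LinearMap.lsmul ℝ (ι → ℝ)) zero_le_one
    fun a b => by simp [norm_smul]
  exact ⟨fun x => (hshift.norm_le x).trans_eq (by ring),
    fun x y => (hshift.norm_sub_le x y).trans_eq (by ring)⟩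

end BoundedLipschitz

end QuadShift

theorem exists_isFiberedDiffeo_add_eq {k : ℕ} {F : Type*} [NormedAddCommGroup F] [NormedSpace ℝ F]
    [FiniteDimensional ℝ F] {d : EucSp k → F → F}
    (hd : ContDiff ℝ 1 fun w : EucSp k × F => d w.1 w.2) (hper : ZPeriodic d) {K : NNReal}
    (hK : K < 1) (hlip : ∀ x, LipschitzWith K (d x)) :
    ∃ Ψ : EucSp k → F → F, IsFiberedDiffeo Ψ ∧ ∀ x η, Ψ x η + d x (Ψ x η) = η := by
  obtain ⟨e, he, hec, hec'⟩ := exists_fibered_equiv_of_lipschitzWith_sub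
    (g := fun w : EucSp k × F => w.2 + d w.1 w.2) (contDiff_snd.add hd)
    fun x => ⟨Equiv.refl F, 1, K, LipschitzWith.id, by simpa using hlip x, by simpa using hK⟩
  have hfst : ∀ x η, e.symm (x, η) = (x, (e.symm (x, η)).2) := fun x η =>
    Prod.ext (by simpa using (congrArg Prod.fst (he (e.symm (x, η)))).symm) rfl
  have hadd : ∀ x η, (e.symm (x, η)).2 + d x (e.symm (x, η)).2 = η := fun x η => by
    have := congrArg Prod.snd (he (e.symm (x, η)))
    rw [e.apply_symm_apply, hfst] at this
    exact this.symm
  refine ⟨fun x η => (e.symm (x, η)).2, ⟨fun n x => funext fun η => ?_,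
    contDiff_snd.comp hec', fun x => ?_⟩, hadd⟩
  · have hshift : e.symm (x + intVec n, η) = (x + intVec n, (e.symm (x, η)).2) := by
      rw [Equiv.symm_apply_eq, he]
      simp only [hper n x, hadd]
    change (e.symm (x + intVec n, η)).2 = (e.symm (x, η)).2
    rw [hshift]
  · have hpair : ContDiff ℝ 1 fun η : F => ((x, η) : EucSp k × F) :=
      contDiff_const.prodMk contDiff_id
    refine ⟨⟨fun η => (e.symm (x, η)).2, fun η => (e (x, η)).2, fun η => ?_, fun η => ?_⟩,
      fun _ => rfl, contDiff_snd.comp (hec'.comp hpair), contDiff_snd.comp (hec.comp hpair)⟩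
    · beta_reduce
      rw [← hfst, e.apply_symm_apply]
    · have hfst' : (x, (e (x, η)).2) = e (x, η) := Prod.ext (by rw [he]) rfl
      beta_reduce
      rw [hfst', e.symm_apply_apply]

theorem exists_fibered_normal_form {ι : Type*} [Fintype ι] [DecidableEq ι] {k : ℕ}
    {B : Matrix ι ι ℝ} (hB : B.IsSymm) (hdet : IsUnit B.det) {f : EucSp k → (ι → ℝ) → ℝ}
    (hf : ContDiff ℝ 1 fun w : EucSp k × (ι → ℝ) => f w.1 w.2) (hper : ZPeriodic f) {M : ℝ}
    (hbl : ∀ x, BoundedLipschitz (f x) M M) :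
    ∃ Ψ : EucSp k → (ι → ℝ) → (ι → ℝ), IsFiberedDiffeo Ψ ∧ (∀ x η, ‖Ψ x η - η‖ ≤ 1) ∧
      ∃ C, 0 < C ∧ ∀ x η, C < ‖η‖ →
        1 / 2 * (Ψ x η ⬝ᵥ B.mulVec (Ψ x η)) + f x (Ψ x η) = 1 / 2 * (η ⬝ᵥ B.mulVec η) := by
  have hM : 0 ≤ M := (norm_nonneg _).trans ((hbl 0).norm_le 0)
  let G : (ι → ℝ) →L[ℝ] (ι → ℝ) := LinearMap.toContinuousLinearMap B⁻¹.mulVecLin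
  have hBG : ∀ w, B.mulVec (G w) = w := fun w =>
    show B.mulVec (B⁻¹.mulVec w) = w by
      rw [Matrix.mulVec_mulVec, Matrix.mul_nonsing_inv _ hdet, Matrix.one_mulVec]
  obtain ⟨δ, hδ, hδquad, hδlip⟩ : ∃ δ, 0 < δ ∧ M * (Fintype.card ι * ‖G‖ * δ ^ 2) ≤ 1 / 4 ∧
      7 * M * (‖G‖ * δ) ≤ 1 / 2 := by
    obtain ⟨δ, hδ, hδeq⟩ : ∃ δ, 0 < δ ∧
        (14 * (Fintype.card ι * (M * ‖G‖)) + 14 * (M * ‖G‖) + 1) * δ = 1 :=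
      ⟨_, by positivity, mul_inv_cancel₀ (by positivity)⟩
    have hlin : 0 ≤ M * ‖G‖ * δ := by positivity
    have hcard : 0 ≤ Fintype.card ι * (M * ‖G‖) * δ := by positivity
    have hδ1 : δ ≤ 1 := by linarith
    have hquad := mul_le_mul_of_nonneg_left hδ1 hcard
    exact ⟨δ, hδ, by linarith, by linarith⟩
  obtain ⟨v, C, hC, hv, hvbl, hv1⟩ := exists_small_cut_inversion ι hδ
  have hsmall : ∀ x η, |f x η * (v η ⬝ᵥ G (v η))| ≤ 1 / 4 := fun x η =>
    (((hbl x).mul_dotProduct_apply hvbl).norm_le η).trans hδquad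
  have hd : ∀ x, BoundedLipschitz (fun η => quadShift G (v η) (f x η)) (2 * M * (‖G‖ * δ))
    (7 * M * (‖G‖ * δ)) := fun x => .quadShift (hbl x) hvbl hδquad
  -- With `Q η = ½ η · B η`, one has `Q ∘ (id + quadShift) = Q + f` near infinity, and `Ψ x` is the
  -- inverse of `id + quadShift`.
  obtain ⟨Ψ, hΨ, hadd⟩ := exists_isFiberedDiffeo_add_eq
    (d := fun x η => quadShift G (v η) (f x η))
    (contDiff_quadShift G (hv.comp contDiff_snd) hf fun w => hsmall w.1 w.2)
    (fun m x => by simp only [hper m x]) (K := 1 / 2) (NNReal.half_lt_self one_ne_zero)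
    (fun x => LipschitzWith.of_dist_le_mul fun η η' => by
      rw [dist_eq_norm, dist_eq_norm]
      exact ((hd x).norm_sub_le η η').trans
        (mul_le_mul_of_nonneg_right (by simpa using hδlip) (norm_nonneg _)))
  have hdisp : ∀ x η, ‖Ψ x η - η‖ ≤ 1 := fun x η => by
    have heq : Ψ x η - η = -quadShift G (v (Ψ x η)) (f x (Ψ x η)) :=
      sub_eq_of_eq_add (by rw [← sub_eq_neg_add, eq_sub_iff_add_eq, hadd])
    have hMG : 0 ≤ M * (‖G‖ * δ) := by positivity
    rw [heq, norm_neg]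
    exact ((hd x).norm_le _).trans (by linarith [hδlip, hMG])
  refine ⟨Ψ, hΨ, hdisp, C + 1, by positivity, fun x η hη => ?_⟩
  have hΨC : C ≤ ‖Ψ x η‖ := by
    linarith [norm_sub_norm_le η (Ψ x η), norm_sub_rev (Ψ x η) η, hdisp x η]
  have hform := half_quadForm_add_quadShift hB hBG (hsmall x (Ψ x η)) (hv1 _ hΨC)
  rw [hadd] at hform
  exact hform.symm

end NormalForm

section Fibered

variable {E F F' G : Type*} [NormedAddCommGroup E] [NormedSpace ℝ E] [NormedAddCommGroup F]
  [NormedSpace ℝ F] [NormedAddCommGroup F'] [NormedSpace ℝ F'] [NormedAddCommGroup G]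
  [NormedSpace ℝ G]

theorem fderiv_comp_eq_zero_iff {f : F → G} {g : F' → F} {η : F'} (hf : DifferentiableAt ℝ f (g η))
    (hg : DifferentiableAt ℝ g η) (hsurj : Function.Surjective (fderiv ℝ g η)) :
    fderiv ℝ (fun η' => f (g η')) η = 0 ↔ fderiv ℝ f (g η) = 0 := by
  rw [fderiv_fun_comp η hf hg]
  refine ⟨fun h0 => ContinuousLinearMap.ext fun v => ?_, fun h0 => by
    rw [h0, ContinuousLinearMap.zero_comp]⟩
  obtain ⟨u, rfl⟩ := hsurj v
  exact DFunLike.congr_fun h0 u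

/-- The envelope theorem: moving the fibre variable does not contribute at a critical point. -/
theorem fderiv_apply_self_of_fderiv_eq_zero {S : E → F → G} {g : E → F} {x : E}
    (hS : DifferentiableAt ℝ (fun w : E × F => S w.1 w.2) (x, g x)) (hg : DifferentiableAt ℝ g x)
    (h0 : fderiv ℝ (S x) (g x) = 0) :
    fderiv ℝ (fun y => S y (g y)) x = fderiv ℝ (fun y => S y (g x)) x := by
  have htotal : HasFDerivAt (fun y => S y (g y)) _ x :=
    HasFDerivAt.comp (f := fun y => (y, g y)) x hS.hasFDerivAt
      ((hasFDerivAt_id x).prodMk hg.hasFDerivAt)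
  have hbase : HasFDerivAt (fun y => S y (g x)) _ x :=
    HasFDerivAt.comp (f := fun y => (y, g x)) x hS.hasFDerivAt (hasFDerivAt_prodMk_left x (g x))
  have hfibre : HasFDerivAt (S x) _ (g x) :=
    hS.hasFDerivAt.comp (g x) (hasFDerivAt_prodMk_right x (g x))
  rw [hfibre.fderiv] at h0
  rw [htotal.fderiv, hbase.fderiv]
  refine ContinuousLinearMap.ext fun v => ?_
  have hzero := DFunLike.congr_fun h0 (fderiv ℝ g x v)
  set D := fderiv ℝ (fun w : E × F => S w.1 w.2) (x, g x)
  change D (0, fderiv ℝ g x v) = 0 at hzero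
  change D (v, fderiv ℝ g x v) = D (v, 0)
  rw [← sub_eq_zero, ← map_sub, Prod.mk_sub_mk, sub_self, sub_zero, hzero]

theorem GeneratesSet.comp_fibered {k : ℕ} {S : EucSp k → F → ℝ} {Λ : Set (EucSp k × EucSp k)}
    (h : GeneratesSet S Λ) (hS : Differentiable ℝ fun w : EucSp k × F => S w.1 w.2)
    {Φ : EucSp k → F' → F} (hΦ : Differentiable ℝ fun w : EucSp k × F' => Φ w.1 w.2)
    (hsurj : ∀ x, Function.Surjective (Φ x))
    (hsurj' : ∀ x η, Function.Surjective (fderiv ℝ (Φ x) η)) :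
    GeneratesSet (fun x η => S x (Φ x η)) Λ := by
  have hcrit : ∀ x η, fderiv ℝ (fun η => S x (Φ x η)) η = 0 ↔ fderiv ℝ (S x) (Φ x η) = 0 :=
    fun x η => fderiv_comp_eq_zero_iff
      (hS.comp ((differentiable_const x).prodMk differentiable_id) (Φ x η))
      (hΦ.comp ((differentiable_const x).prodMk differentiable_id) η) (hsurj' x η)
  have hgrad : ∀ x η, fderiv ℝ (S x) (Φ x η) = 0 →
      gradient (fun y => S y (Φ y η)) x = gradient (fun y => S y (Φ x η)) x := fun x η h0 => by
    rw [gradient, gradient, fderiv_apply_self_of_fderiv_eq_zero (g := fun y => Φ y η) (hS _)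
      (hΦ.comp (differentiable_id.prodMk (differentiable_const η)) x) h0]
  rw [GeneratesSet] at h ⊢
  rw [h]
  ext z
  constructor
  · rintro ⟨ξ, h0, hz⟩
    obtain ⟨η, rfl⟩ := hsurj z.1 ξ
    exact ⟨η, (hcrit z.1 η).2 h0, hz.trans (hgrad z.1 η h0).symm⟩
  · rintro ⟨η, h0, hz⟩
    have h0' := (hcrit z.1 η).1 h0
    exact ⟨Φ z.1 η, h0', hz.trans (hgrad z.1 η h0')⟩

theorem IsC1Diffeo.surjective {f : F → F'} (h : IsC1Diffeo f) : Function.Surjective f := by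
  obtain ⟨e, he, -⟩ := h
  exact (funext he : (e : F → F') = f) ▸ e.surjective

theorem IsC1Diffeo.surjective_fderiv {f : F → F'} (h : IsC1Diffeo f) (z : F) :
    Function.Surjective (fderiv ℝ f z) := by
  obtain ⟨e, he, hsmooth, hsmooth_symm⟩ := h
  obtain rfl : (e : F → F') = f := funext he
  have hcomp : HasFDerivAt (e ∘ e.symm) _ (e z) :=
    HasFDerivAt.comp (e z) (by
      rw [e.symm_apply_apply]
      exact (hsmooth.differentiable one_ne_zero z).hasFDerivAt)
      (hsmooth_symm.differentiable one_ne_zero (e z)).hasFDerivAt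
  rw [e.self_comp_symm] at hcomp
  exact fun v => ⟨_, DFunLike.congr_fun (hcomp.unique (hasFDerivAt_id _)) v⟩

end Fibered

section Increments

open Matrix

variable {k N : ℕ}

/-- The increment `η_j ∈ ℝ^k` of `η ∈ ℝ^{(N+1)k}`. -/
noncomputable def incrCol (k N : ℕ) (j : Fin (N + 1)) : IncrSp k N →L[ℝ] EucSp k :=
  (EuclideanSpace.equiv (Fin k) ℝ).symm.toContinuousLinearMap.comp
    (ContinuousLinearMap.pi fun l => ContinuousLinearMap.proj (l, j))

theorem incrCol_apply (j : Fin (N + 1)) (η : IncrSp k N) :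
    incrCol k N j η = WithLp.toLp 2 fun l => η (l, j) := rfl

theorem incrCol_ext {η η' : IncrSp k N} (h : ∀ j, incrCol k N j η = incrCol k N j η') :
    η = η' :=
  funext fun ⟨l, j⟩ => congr_fun (WithLp.toLp_injective 2 (h j)) l

theorem vertexOf_eq (A : Matrix (Fin k) (Fin k) ℝ) (x : EucSp k) (η : IncrSp k N)
    (j : Fin (N + 1)) :
    vertexOf A x η j = x - ∑ i ∈ Finset.Ici j, toEuclideanCLM (𝕜 := ℝ) A (incrCol k N i η) := rfl

/-- `vertexOf` as a continuous linear function of `(x, η)`. -/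
noncomputable def vertexCLM (A : Matrix (Fin k) (Fin k) ℝ) (j : Fin (N + 1)) :
    EucSp k × IncrSp k N →L[ℝ] EucSp k :=
  ContinuousLinearMap.fst ℝ _ _ - ∑ i ∈ Finset.Ici j,
    (toEuclideanCLM (𝕜 := ℝ) A).comp ((incrCol k N i).comp (ContinuousLinearMap.snd ℝ _ _))

theorem vertexCLM_apply (A : Matrix (Fin k) (Fin k) ℝ) (j : Fin (N + 1))
    (w : EucSp k × IncrSp k N) : vertexCLM A j w = vertexOf A w.1 w.2 j := by
  simp [vertexCLM, vertexOf_eq]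

/-- `incrToParam` as a continuous linear function of `(x, η)`. -/
noncomputable def incrCLM (A : Matrix (Fin k) (Fin k) ℝ) (N : ℕ) :
    EucSp k × IncrSp k N →L[ℝ] ParamSp k N :=
  (vertexCLM A 0).prod (ContinuousLinearMap.pi fun l => vertexCLM A l.succ)

theorem incrCLM_apply (A : Matrix (Fin k) (Fin k) ℝ) (w : EucSp k × IncrSp k N) :
    incrCLM A N w = incrToParam A w.1 w.2 :=
  Prod.ext (vertexCLM_apply A 0 w) (funext fun l => vertexCLM_apply A l.succ w)

theorem contDiff_incrToParam (A : Matrix (Fin k) (Fin k) ℝ) {n : WithTop ℕ∞} :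
    ContDiff ℝ n fun w : EucSp k × IncrSp k N => incrToParam A w.1 w.2 := by
  have hlin := (incrCLM A N).contDiff (n := n)
  rwa [show (incrCLM A N : EucSp k × IncrSp k N → ParamSp k N) = _ from funext (incrCLM_apply A)]
    at hlin

theorem brokenPath_incrToParam_castSucc (A : Matrix (Fin k) (Fin k) ℝ) (x : EucSp k)
    (η : IncrSp k N) (j : Fin (N + 1)) :
    brokenPath (incrToParam A x η).1 (incrToParam A x η).2 x j.castSucc = vertexOf A x η j := by
  refine Fin.cases rfl (fun i => ?_) j
  rw [brokenPath_succ_castSucc]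
  rfl

theorem brokenPath_incrToParam_sub (A : Matrix (Fin k) (Fin k) ℝ) (x : EucSp k)
    (η : IncrSp k N) (j : Fin (N + 1)) :
    brokenPath (incrToParam A x η).1 (incrToParam A x η).2 x j.succ -
        brokenPath (incrToParam A x η).1 (incrToParam A x η).2 x j.castSucc =
      toEuclideanCLM (𝕜 := ℝ) A (incrCol k N j η) := by
  rw [brokenPath_incrToParam_castSucc]
  refine Fin.lastCases ?_ (fun i => ?_) j
  · rw [Fin.succ_last, brokenPath_last, vertexOf_eq,
      show Finset.Ici (Fin.last N) = {Fin.last N} from Finset.Ici_top, Finset.sum_singleton,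
      sub_sub_cancel]
  · have hIci : Finset.Ici i.castSucc = insert i.castSucc (Finset.Ici i.succ) := by
      ext l
      simp only [Finset.mem_Ici, Finset.mem_insert, Fin.le_def, Fin.ext_iff, Fin.val_castSucc,
        Fin.val_succ]
      lia
    rw [brokenPath_castSucc_succ]
    change vertexOf A x η i.succ - _ = _
    rw [vertexOf_eq, vertexOf_eq, hIci, Finset.sum_insert (by simp [Fin.le_def])]
    abel

theorem incrToParam_add_left (A : Matrix (Fin k) (Fin k) ℝ) (x y : EucSp k) (η : IncrSp k N) :
    incrToParam A (x + y) η =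
      ((incrToParam A x η).1 + y, (incrToParam A x η).2 + fun _ => y) :=
  Prod.ext (add_sub_right_comm _ _ _) (funext fun _ => add_sub_right_comm _ _ _)

theorem injective_incrToParam {A : Matrix (Fin k) (Fin k) ℝ} (hdet : A.det ≠ 0) (x : EucSp k) :
    Function.Injective (incrToParam (N := N) A x) := by
  intro η η' h
  refine incrCol_ext fun j => ?_
  have hincr := brokenPath_incrToParam_sub A x η j
  rw [h, brokenPath_incrToParam_sub] at hincr
  exact WithLp.ofLp_injective 2 (Matrix.mulVec_injective_iff_isUnit.2
    ((Matrix.isUnit_iff_isUnit_det A).2 hdet.isUnit) (WithLp.toLp_injective 2 hincr.symm))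

theorem surjective_incrCLM_inr {A : Matrix (Fin k) (Fin k) ℝ} (hdet : A.det ≠ 0) :
    Function.Surjective ((incrCLM A N).comp (ContinuousLinearMap.inr ℝ _ _)) := by
  have hdim : Module.finrank ℝ (IncrSp k N) = Module.finrank ℝ (ParamSp k N) := by
    simp only [Module.finrank_fintype_fun_eq_card, Fintype.card_prod, Fintype.card_fin,
      Module.finrank_prod, finrank_euclideanSpace, Module.finrank_pi_fintype, Finset.sum_const,
      Finset.card_univ, smul_eq_mul]
    ring
  refine (LinearMap.injective_iff_surjective_of_finrank_eq_finrank
    (f := ((incrCLM A N).comp (ContinuousLinearMap.inr ℝ _ _)).toLinearMap) hdim).1 fun η η' h => ?_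
  refine injective_incrToParam hdet 0 ?_
  simpa only [ContinuousLinearMap.coe_coe, ContinuousLinearMap.comp_apply,
    ContinuousLinearMap.inr_apply, incrCLM_apply] using h

theorem surjective_incrToParam {A : Matrix (Fin k) (Fin k) ℝ} (hdet : A.det ≠ 0) (x : EucSp k) :
    Function.Surjective (incrToParam (N := N) A x) := by
  intro q
  obtain ⟨η, hη⟩ := surjective_incrCLM_inr hdet (q - incrCLM A N (x, 0))
  refine ⟨η, ?_⟩
  rw [ContinuousLinearMap.comp_apply, ContinuousLinearMap.inr_apply, eq_sub_iff_add_eq,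
    ← map_add, incrCLM_apply] at hη
  simpa only [Prod.mk_add_mk, zero_add, add_zero] using hη

theorem surjective_fderiv_incrToParam {A : Matrix (Fin k) (Fin k) ℝ} (hdet : A.det ≠ 0)
    (x : EucSp k) (η : IncrSp k N) : Function.Surjective (fderiv ℝ (incrToParam A x) η) := by
  have hderiv : HasFDerivAt (fun η' => incrCLM A N (x, η'))
      ((incrCLM A N).comp (ContinuousLinearMap.inr ℝ _ _)) η :=
    (incrCLM A N).hasFDerivAt.comp η (hasFDerivAt_prodMk_right x η)
  simp only [incrCLM_apply] at hderiv
  rw [hderiv.fderiv]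
  exact surjective_incrCLM_inr hdet

end Increments

section BlockForm

open Matrix

theorem inner_toEuclideanCLM_comm {n : Type*} [Fintype n] [DecidableEq n] {A : Matrix n n ℝ}
    (hA : A.IsSymm) (v w : EuclideanSpace ℝ n) :
    inner ℝ (toEuclideanCLM (𝕜 := ℝ) A v) w = inner ℝ v (toEuclideanCLM (𝕜 := ℝ) A w) := by
  rw [real_inner_comm, inner_toEuclideanCLM, inner_toEuclideanCLM, dotProduct_mulVec,
    ← mulVec_transpose, hA.eq, dotProduct_comm]

theorem toEuclideanCLM_inv_apply {n : Type*} [Fintype n] [DecidableEq n] {A : Matrix n n ℝ}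
    (hdet : A.det ≠ 0) (v : EuclideanSpace ℝ n) :
    toEuclideanCLM (𝕜 := ℝ) A⁻¹ (toEuclideanCLM (𝕜 := ℝ) A v) = v := by
  rw [← mul_apply_eq_comp, ← map_mul, nonsing_inv_mul A hdet.isUnit, map_one,
    one_apply_eq_self]

variable {k N : ℕ} {A : Matrix (Fin k) (Fin k) ℝ}

theorem isSymm_blockDiagonal (hA : A.IsSymm) :
    (blockDiagonal fun _ : Fin (N + 1) => A).IsSymm := by
  rw [IsSymm, blockDiagonal_transpose, hA.eq]

theorem det_blockDiagonal_ne_zero (hdet : A.det ≠ 0) :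
    (blockDiagonal fun _ : Fin (N + 1) => A).det ≠ 0 := by
  rw [det_blockDiagonal]
  exact Finset.prod_ne_zero_iff.2 fun _ _ => hdet

theorem dotProduct_blockDiagonal_mulVec (A : Matrix (Fin k) (Fin k) ℝ) (η ζ : IncrSp k N) :
    η ⬝ᵥ (blockDiagonal fun _ => A) *ᵥ ζ =
      ∑ j, inner ℝ (incrCol k N j η) (toEuclideanCLM (𝕜 := ℝ) A (incrCol k N j ζ)) := by
  simp only [inner_toEuclideanCLM]
  simp [incrCol_apply, dotProduct, mulVec, Fintype.sum_prod_type_right, blockDiagonal_apply,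
    ite_mul]

theorem blockForm_apply (A : Matrix (Fin k) (Fin k) ℝ) (N : ℕ) (ε : ℝ) (η : IncrSp k N) :
    blockForm A N ε η = 1 / (2 * ε) * (η ⬝ᵥ (blockDiagonal fun _ => A) *ᵥ η) := by
  rw [blockForm, _root_.smul_apply, toQuadraticForm',
    LinearMap.BilinMap.toQuadraticMap_apply, toLinearMap₂'_apply', smul_eq_mul]

theorem contDiff_blockForm (A : Matrix (Fin k) (Fin k) ℝ) (N : ℕ) (ε : ℝ) {n : WithTop ℕ∞} :
    ContDiff ℝ n (blockForm A N ε) := by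
  have hmulVec : ContDiff ℝ n fun η => (blockDiagonal fun _ : Fin (N + 1) => A) *ᵥ η :=
    (LinearMap.toContinuousLinearMap (mulVecLin (blockDiagonal fun _ : Fin (N + 1) => A))).contDiff
  have hform : ContDiff ℝ n fun η : IncrSp k N =>
      1 / (2 * ε) * (η ⬝ᵥ (blockDiagonal fun _ => A) *ᵥ η) :=
    contDiff_const.mul (contDiff_dotProduct contDiff_id hmulVec)
  simpa only [← blockForm_apply] using hform

theorem polarBilin_blockForm (hA : A.IsSymm) (ε : ℝ) (η ζ : IncrSp k N) :
    QuadraticMap.polarBilin (blockForm A N ε) η ζ =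
      1 / ε * (η ⬝ᵥ (blockDiagonal fun _ => A) *ᵥ ζ) := by
  have hcomm : ζ ⬝ᵥ (blockDiagonal fun _ => A) *ᵥ η = η ⬝ᵥ (blockDiagonal fun _ => A) *ᵥ ζ := by
    rw [dotProduct_mulVec, ← mulVec_transpose, (isSymm_blockDiagonal hA).eq, dotProduct_comm]
  simp only [QuadraticMap.polarBilin_apply_apply, QuadraticMap.polar, blockForm_apply, mulVec_add,
    dotProduct_add, add_dotProduct, hcomm]
  field_simp
  ring

theorem nondegenerate_polarBilin_blockForm (hA : A.IsSymm) (hdet : A.det ≠ 0) (N : ℕ) {ε : ℝ}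
    (hε : ε ≠ 0) : (QuadraticMap.polarBilin (blockForm A N ε)).Nondegenerate := by
  have hsymm : (QuadraticMap.polarBilin (blockForm A N ε)).IsRefl := fun η ζ h => by
    rwa [QuadraticMap.polarBilin_apply_apply, QuadraticMap.polar_comm]
  refine hsymm.nondegenerate_iff_separatingRight.2 fun ζ h => ?_
  refine eq_zero_of_mulVec_eq_zero (det_blockDiagonal_ne_zero (N := N) hdet)
    (dotProduct_self_eq_zero.1 ?_)
  exact (mul_eq_zero.1 ((polarBilin_blockForm hA ε _ ζ).symm.trans (h _))).resolve_left
    (one_div_ne_zero hε)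

end BlockForm

section BrokenGeodesicNormalForm

open Matrix

variable {k N : ℕ} {A : Matrix (Fin k) (Fin k) ℝ}

theorem ZPeriodic.exists_norm_le {G : Type*} [NormedAddCommGroup G] {g : EucSp k → G}
    (hper : ZPeriodic g) (hg : Continuous g) : ∃ M, ∀ x, ‖g x‖ ≤ M := by
  obtain ⟨ρ, hρ⟩ := exists_norm_add_intVec_le k
  obtain ⟨M, hM⟩ := (isCompact_closedBall (0 : EucSp k) ρ).exists_bound_of_continuousOn
    hg.continuousOn
  refine ⟨M, fun x => ?_⟩
  obtain ⟨m, hm⟩ := hρ x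
  rw [← hper m x]
  exact hM _ (mem_closedBall_zero_iff.2 hm)

theorem ZPeriodic.exists_boundedLipschitz {G : Type*} [NormedAddCommGroup G] [NormedSpace ℝ G]
    {g : EucSp k → G} (hper : ZPeriodic g) (hg : ContDiff ℝ 1 g) :
    ∃ M, 0 ≤ M ∧ BoundedLipschitz g M M := by
  obtain ⟨M, hM⟩ := hper.exists_norm_le hg.continuous
  obtain ⟨M', hM'⟩ := ZPeriodic.exists_norm_le (fun m => fderiv_add_of_periodic (hper m))
    (hg.continuous_fderiv one_ne_zero)
  have hbl : BoundedLipschitz g M M' :=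
    ⟨hM, fun x y => convex_univ.norm_image_sub_le_of_norm_fderiv_le
      (fun z _ => hg.differentiable one_ne_zero z) (fun z _ => hM' z) (mem_univ y) (mem_univ x)⟩
  exact ⟨max M M', le_max_of_le_left ((norm_nonneg _).trans (hM 0)),
    hbl.mono (le_max_left _ _) (le_max_right _ _)⟩

/-- The edge `(X_j, X_{j+1})` of a broken geodesic, as a function of `(x, η)`. -/
noncomputable def incrEdge (A : Matrix (Fin k) (Fin k) ℝ) (N : ℕ) (j : Fin (N + 1)) :
    EucSp k × IncrSp k N →L[ℝ] EucSp k × EucSp k :=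
  (edgeCLM k N j).comp ((ContinuousLinearMap.fst ℝ _ _).prod (incrCLM A N))

theorem incrEdge_apply (j : Fin (N + 1)) (x : EucSp k) (η : IncrSp k N) :
    incrEdge A N j (x, η) = edgeCLM k N j (x, incrToParam A x η) := by
  rw [← incrCLM_apply A (x, η)]
  rfl

theorem incrEdge_snd_sub_fst (j : Fin (N + 1)) (x : EucSp k) (η : IncrSp k N) :
    (incrEdge A N j (x, η)).2 - (incrEdge A N j (x, η)).1 =
      toEuclideanCLM (𝕜 := ℝ) A (incrCol k N j η) := by
  rw [incrEdge_apply, edgeCLM_apply, brokenPath_incrToParam_sub]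

theorem incrEdge_add_left (j : Fin (N + 1)) (x v : EucSp k) (η : IncrSp k N) :
    incrEdge A N j (x + v, η) =
      ((incrEdge A N j (x, η)).1 + v, (incrEdge A N j (x, η)).2 + v) := by
  have hpath : ∀ i, brokenPath ((incrToParam A x η).1 + v) ((incrToParam A x η).2 + fun _ => v)
      (x + v) i = brokenPath (incrToParam A x η).1 (incrToParam A x η).2 x i + v :=
    forall_fin_path (by simp) (by simp) (by simp)
  rw [incrEdge_apply, incrEdge_apply, edgeCLM_apply, edgeCLM_apply, incrToParam_add_left, hpath,
    hpath]

theorem blockForm_eq_sum (hdet : A.det ≠ 0) (ε : ℝ) (x : EucSp k) (η : IncrSp k N) :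
    blockForm A N ε η = ∑ j, 1 / (2 * ε) * inner ℝ
      (toEuclideanCLM (𝕜 := ℝ) A⁻¹ ((incrEdge A N j (x, η)).2 - (incrEdge A N j (x, η)).1))
      ((incrEdge A N j (x, η)).2 - (incrEdge A N j (x, η)).1) := by
  rw [blockForm_apply, dotProduct_blockDiagonal_mulVec, Finset.mul_sum]
  refine Finset.sum_congr rfl fun j _ => ?_
  rw [incrEdge_snd_sub_fst, toEuclideanCLM_inv_apply hdet]

theorem zPeriodic_add_pathSum_incrToParam (A : Matrix (Fin k) (Fin k) ℝ)
    {S : Fin (N + 1) → EucSp k → EucSp k → ℝ}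
    (hper : ∀ j m X Y, S j (X + intVec m) (Y + intVec m) = S j X Y) {σ : EucSp k → ℝ}
    (hσ : ZPeriodic σ) :
    ZPeriodic fun x (η : IncrSp k N) =>
      σ (incrToParam A x η).1 + pathSum S (x, incrToParam A x η) := by
  intro m x
  funext η
  simp only [pathSum, ← incrEdge_apply, incrEdge_add_left, hper]
  rw [incrToParam_add_left, hσ]

/-- The difference between a broken-geodesic function in the variables `(x, η)` and its quadratic
part. -/
noncomputable def incrementDefect (A : Matrix (Fin k) (Fin k) ℝ) (ε : ℝ)
    (S : Fin (N + 1) → EucSp k → EucSp k → ℝ) (σ : EucSp k → ℝ) (x : EucSp k)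
    (η : IncrSp k N) : ℝ :=
  σ (incrToParam A x η).1 + pathSum S (x, incrToParam A x η) - blockForm A N ε η

section IncrementDefect

variable {S : Fin (N + 1) → EucSp k → EucSp k → ℝ} {σ : EucSp k → ℝ} {ε : ℝ}

theorem contDiff_incrementDefect {n : WithTop ℕ∞} (hS : ContDiff ℝ n (pathSum S))
    (hσ : ContDiff ℝ n σ) :
    ContDiff ℝ n fun w : EucSp k × IncrSp k N => incrementDefect A ε S σ w.1 w.2 :=
  ((hσ.comp (contDiff_incrToParam A).fst).add
    (hS.comp (contDiff_fst.prodMk (contDiff_incrToParam A)))).sub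
    ((contDiff_blockForm A N ε).comp contDiff_snd)

theorem zPeriodic_incrementDefect
    (hper : ∀ j m X Y, S j (X + intVec m) (Y + intVec m) = S j X Y) (hσ : ZPeriodic σ) :
    ZPeriodic (incrementDefect A ε S σ) := fun m x => funext fun η =>
  congr_arg (· - blockForm A N ε η)
    (congr_fun (zPeriodic_add_pathSum_incrToParam A hper hσ m x) η)

theorem incrementDefect_eq (hdet : A.det ≠ 0) (x : EucSp k) (η : IncrSp k N) :
    incrementDefect A ε S σ x η = σ (vertexCLM A 0 (x, η)) +
      ∑ j, actionDefect (toEuclideanCLM (𝕜 := ℝ) A⁻¹) ε (S j) (incrEdge A N j (x, η)) := by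
  rw [incrementDefect, blockForm_eq_sum hdet ε x η, add_sub_assoc, pathSum,
    ← Finset.sum_sub_distrib, vertexCLM_apply]
  simp only [← incrEdge_apply]
  rfl

theorem exists_boundedLipschitz_incrementDefect (hdet : A.det ≠ 0)
    (hb : ∀ j, ∃ C, 0 ≤ C ∧
      BoundedLipschitz (actionDefect (toEuclideanCLM (𝕜 := ℝ) A⁻¹) ε (S j)) C C)
    (hσper : ZPeriodic σ) (hσ : ContDiff ℝ 1 σ) :
    ∃ M, ∀ x, BoundedLipschitz (incrementDefect A ε S σ x) M M := by
  choose C hC hbl using hb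
  obtain ⟨M, hM, hσbl⟩ := hσper.exists_boundedLipschitz hσ
  refine ⟨max (M + ∑ j, C j) (M * ‖vertexCLM (N := N) A 0‖ + ∑ j, C j * ‖incrEdge A N j‖),
    fun x => ?_⟩
  rw [show incrementDefect A ε S σ x = _ from funext fun η => incrementDefect_eq hdet x η]
  exact ((hσbl.comp_clm_slice hM (vertexCLM A 0) x).add
    (.sum fun j _ => (hbl j).comp_clm_slice (hC j) (incrEdge A N j) x)).mono
      (le_max_left _ _) (le_max_right _ _)

theorem exists_fibered_normal_form_incrementDefect (hA : A.IsSymm) (hdet : A.det ≠ 0)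
    (hε : ε ≠ 0) (hdefect : ContDiff ℝ 1 fun w : EucSp k × IncrSp k N =>
      incrementDefect A ε S σ w.1 w.2)
    (hper : ZPeriodic (incrementDefect A ε S σ)) {M : ℝ}
    (hbl : ∀ x, BoundedLipschitz (incrementDefect A ε S σ x) M M) :
    ∃ Ψ : EucSp k → IncrSp k N → IncrSp k N, IsFiberedDiffeo Ψ ∧ (∀ x η, ‖Ψ x η - η‖ ≤ 1) ∧
      ∃ C, 0 < C ∧ ∀ x η, C < ‖η‖ →
        σ (incrToParam A x (Ψ x η)).1 + pathSum S (x, incrToParam A x (Ψ x η)) =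
          blockForm A N ε η := by
  set B := (1 / ε) • blockDiagonal fun _ : Fin (N + 1) => A with hB
  have hBsymm : B.IsSymm := (isSymm_blockDiagonal hA).smul _
  have hBdet : IsUnit B.det := by
    rw [hB, det_smul]
    exact (mul_ne_zero (pow_ne_zero _ (one_div_ne_zero hε)) (det_blockDiagonal_ne_zero hdet)).isUnit
  have hBform : ∀ η, 1 / 2 * (η ⬝ᵥ B *ᵥ η) = blockForm A N ε η := fun η => by
    rw [blockForm_apply, hB, smul_mulVec, dotProduct_smul, smul_eq_mul]
    field_simp
  obtain ⟨Ψ, hΨ, hΨ1, C, hC, hΨC⟩ := exists_fibered_normal_form hBsymm hBdet hdefect hper hbl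
  refine ⟨Ψ, hΨ, hΨ1, C, hC, fun x η hη => ?_⟩
  rw [← hBform η, ← hΨC x η hη, hBform, incrementDefect, add_sub_cancel]

end IncrementDefect

end BrokenGeodesicNormalForm

section BrokenGeodesicGF

variable {k N : ℕ}

theorem exists_isGFQI_add_pathSum {A : Matrix (Fin k) (Fin k) ℝ} (hA : A.IsSymm) (hdet : A.det ≠ 0)
    {ε : ℝ} (hε : ε ≠ 0) {S : Fin (N + 1) → EucSp k → EucSp k → ℝ} (hS : ContDiff ℝ 1 (pathSum S))
    (hper : ∀ j m X Y, S j (X + intVec m) (Y + intVec m) = S j X Y)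
    (hb : ∀ j, ∃ C, 0 ≤ C ∧
      BoundedLipschitz (actionDefect (Matrix.toEuclideanCLM (𝕜 := ℝ) A⁻¹) ε (S j)) C C)
    {σ : EucSp k → ℝ} (hσper : ZPeriodic σ) (hσ : ContDiff ℝ 1 σ) {Λ : Set (EucSp k × EucSp k)}
    (hΛ : GeneratesSet (fun x (q : ParamSp k N) => σ q.1 + pathSum S (x, q)) Λ) :
    ∃ Ψ : EucSp k → IncrSp k N → IncrSp k N,
      IsFiberedDiffeo Ψ ∧ (∃ B : ℝ, ∀ x η, ‖Ψ x η - η‖ ≤ B) ∧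
      IsGFQI (fun x η => σ (incrToParam A x (Ψ x η)).1 + pathSum S (x, incrToParam A x (Ψ x η)))
        (blockForm A N ε) Λ := by
  obtain ⟨M, hM⟩ := exists_boundedLipschitz_incrementDefect hdet hb hσper hσ
  obtain ⟨Ψ, hΨ, hΨ1, hquad⟩ := exists_fibered_normal_form_incrementDefect hA hdet hε
    (contDiff_incrementDefect hS hσ) (zPeriodic_incrementDefect hper hσper) hM
  have hc : ContDiff ℝ 1 fun w : EucSp k × ParamSp k N => σ w.2.1 + pathSum S w :=
    (hσ.comp (contDiff_fst.comp contDiff_snd)).add hS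
  have hincr := contDiff_incrToParam (N := N) A (n := 1)
  have hci : ContDiff ℝ 1 fun w : EucSp k × IncrSp k N =>
      σ (incrToParam A w.1 w.2).1 + pathSum S (w.1, incrToParam A w.1 w.2) :=
    hc.comp (contDiff_fst.prodMk hincr)
  have hΛi : GeneratesSet (fun x (η : IncrSp k N) =>
      σ (incrToParam A x η).1 + pathSum S (x, incrToParam A x η)) Λ :=
    hΛ.comp_fibered (hc.differentiable one_ne_zero) (hincr.differentiable one_ne_zero)
      (surjective_incrToParam hdet) (surjective_fderiv_incrToParam hdet)
  have hΛΨ := hΛi.comp_fibered (hci.differentiable one_ne_zero)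
    (hΨ.2.1.differentiable one_ne_zero) (fun x => (hΨ.2.2 x).surjective)
    (fun x => (hΨ.2.2 x).surjective_fderiv)
  refine ⟨Ψ, hΨ, ⟨1, hΨ1⟩, fun m x => funext fun η => ?_, hci.comp (contDiff_fst.prodMk hΨ.2.1),
    hΛΨ, nondegenerate_polarBilin_blockForm hA hdet N hε, hquad⟩
  have hshift := congr_fun (zPeriodic_add_pathSum_incrToParam A hper hσper m x) (Ψ x η)
  simpa only [hΨ.1 m x] using hshift

end BrokenGeodesicGF

section Node

variable {t T : ℝ} {N : ℕ}

theorem node_zero (t : ℝ) (N : ℕ) : node t N 0 = 0 := by simp [node]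

theorem node_last (t : ℝ) (N : ℕ) : node t N (N + 1) = t := by
  rw [node]
  push_cast
  field_simp

theorem node_succ_sub (t : ℝ) (N j : ℕ) : node t N (j + 1) - node t N j = t / ((N : ℝ) + 1) := by
  rw [node, node]
  push_cast
  ring

theorem strictMono_node (ht : 0 < t) (N : ℕ) : StrictMono (node t N) := fun i j hij =>
  mul_lt_mul_of_pos_right (Nat.cast_lt.2 hij) (by positivity)

theorem node_mem_Icc (ht : t ∈ Ioc 0 T) {j : ℕ} (hj : j ≤ N + 1) : node t N j ∈ Icc 0 T := by
  have hmono := (strictMono_node ht.1 N).monotone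
  exact ⟨(node_zero t N).symm.trans_le (hmono j.zero_le),
    (hmono hj).trans ((node_last t N).trans_le ht.2)⟩

theorem node_succ_mem_Icc (ht : t ∈ Ioc 0 T) (j : Fin (N + 1)) :
    node t N (j + 1) ∈ Icc (node t N j) T :=
  ⟨(strictMono_node ht.1 N).monotone j.val.le_succ, (node_mem_Icc ht (by lia)).2⟩

end Node

/-- A subdivision of `[0,t]` into `N + 1` equal intervals, with `t ∈ (0,T]`, so fine that each
segment map `(X,P) ↦ (X,x)` is a `C^1` diffeomorphism `e j`. -/
structure IsTwistSubdivision {k : ℕ} (H : ℝ → EucSp k → EucSp k → ℝ) (T t : ℝ) (N : ℕ)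
    (e : Fin (N + 1) → EucSp k × EucSp k ≃ EucSp k × EucSp k) : Prop where
  mem_Ioc : t ∈ Ioc 0 T
  twist : ∀ j z, e j z = twistMap H T (node t N (j + 1)) (node t N j) z
  contDiff : ∀ j, ContDiff ℝ 1 (e j)
  contDiff_symm : ∀ j, ContDiff ℝ 1 (e j).symm

section TwistSubdivision

variable {k N : ℕ} {L L' : EucSp k →L[ℝ] EucSp k} {H : ℝ → EucSp k → EucSp k → ℝ}
  {b : ℝ → EucSp k × EucSp k → EucSp k × EucSp k}
  {b' : ℝ → EucSp k × EucSp k → EucSp k × EucSp k →L[ℝ] EucSp k × EucSp k}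
  {T R M t : ℝ} {e : Fin (N + 1) → EucSp k × EucSp k ≃ EucSp k × EucSp k} {σ : EucSp k → ℝ}

theorem IsKineticHam.exists_isTwistSubdivision (h : IsKineticHam L H b b' T R M)
    (hstar : StarCondition H T) :
    ∃ N₀ : ℕ, ∀ N : ℕ, N₀ ≤ N → ∀ t ∈ Ioc 0 T, ∃ e, IsTwistSubdivision H T t N e := by
  obtain ⟨ε₀, hε₀, htwist⟩ := h.exists_twist_equiv hstar
  obtain ⟨N₀, hN₀⟩ := exists_nat_ge (T / ε₀)
  refine ⟨N₀, fun N hN t ht => ?_⟩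
  have hε : t / ((N : ℝ) + 1) ≤ ε₀ := by
    rw [div_le_comm₀ (by positivity) hε₀]
    calc t / ε₀ ≤ T / ε₀ := div_le_div_of_nonneg_right ht.2 hε₀.le
      _ ≤ N₀ := hN₀
      _ ≤ N := Nat.cast_le.2 hN
      _ ≤ (N : ℝ) + 1 := (lt_add_one _).le
  choose e he hec hesymm using fun j : Fin (N + 1) =>
    htwist _ (node_mem_Icc ht (j := j) (by lia)) _ (node_succ_mem_Icc ht j)
      (strictMono_node ht.1 N j.val.lt_succ_self) ((node_succ_sub t N j).trans_le hε)
  exact ⟨e, ht, he, hec, hesymm⟩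

theorem IsKineticHam.hamFlow_node_zero (h : IsKineticHam L H b b' T R M) (t : ℝ) (N : ℕ)
    (z : EucSp k × EucSp k) : hamFlow H T (node t N 0) 0 z = z := by
  rw [node_zero]
  exact h.isFlowOn.self 0 (left_mem_Icc.2 h.pos.le) z

namespace IsTwistSubdivision

theorem isC1Diffeo_twistMap (he : IsTwistSubdivision H T t N e) (j : Fin (N + 1)) :
    IsC1Diffeo (twistMap H T (node t N (j + 1)) (node t N j)) :=
  ⟨e j, he.twist j, he.contDiff j, he.contDiff_symm j⟩

theorem node_mem (he : IsTwistSubdivision H T t N e) (j : Fin (N + 1)) :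
    node t N j ∈ Icc 0 T :=
  node_mem_Icc he.mem_Ioc (by lia)

theorem node_succ_mem (he : IsTwistSubdivision H T t N e) (j : Fin (N + 1)) :
    node t N (j + 1) ∈ Icc (node t N j) T :=
  node_succ_mem_Icc he.mem_Ioc j

theorem isTwistGF (he : IsTwistSubdivision H T t N e) (h : IsKineticHam L H b b' T R M)
    (j : Fin (N + 1)) :
    IsTwistGF (segmentAction H T (node t N (j + 1)) (node t N j))
      (hamFlow H T (node t N (j + 1)) (node t N j)) (fun w => ((e j).symm w).2)
      (fun w => (hamFlow H T (node t N (j + 1)) (node t N j) ((e j).symm w)).2) :=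
  h.isTwistGF (he.node_mem j) (he.node_succ_mem j) (he.twist j) (he.contDiff_symm j)

theorem hamFlow_node_succ (he : IsTwistSubdivision H T t N e) (h : IsKineticHam L H b b' T R M)
    (j : Fin (N + 1)) (z : EucSp k × EucSp k) :
    hamFlow H T (node t N (j + 1)) 0 z =
      hamFlow H T (node t N (j + 1)) (node t N j) (hamFlow H T (node t N j) 0 z) :=
  (h.isFlowOn.comp_apply h.isC1Field (left_mem_Icc.2 h.pos.le) (he.node_mem j)
    (node_mem_Icc he.mem_Ioc (by lia)) z).symm

theorem generatesMap_brokenAction (he : IsTwistSubdivision H T t N e)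
    (h : IsKineticHam L H b b' T R M) :
    GeneratesMap (fun X x (U : Fin N → EucSp k) => brokenAction H T t X x U)
      (hamFlow H T t 0) := by
  have hgen := generatesMap_pathSum (Φ := fun j => hamFlow H T (node t N j) 0) (he.isTwistGF h)
    (h.hamFlow_node_zero t N) (he.hamFlow_node_succ h)
  rwa [Fin.val_last, node_last] at hgen

theorem generatesSet_brokenGF (he : IsTwistSubdivision H T t N e)
    (h : IsKineticHam L H b b' T R M) (hσ : Differentiable ℝ σ) :
    GeneratesSet (brokenGF H T t N σ) (wavefront H T t σ) := by
  have hgen := generatesSet_add_pathSum (Φ := fun j => hamFlow H T (node t N j) 0)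
    (he.isTwistGF h) (h.hamFlow_node_zero t N) (he.hamFlow_node_succ h) hσ
  rwa [Fin.val_last, node_last] at hgen

theorem contDiff_brokenGF (he : IsTwistSubdivision H T t N e) (h : IsKineticHam L H b b' T R M)
    {n : WithTop ℕ∞} (hn : n ≤ 2) (hσ : ContDiff ℝ n σ) :
    ContDiff ℝ n fun w : EucSp k × ParamSp k N => brokenGF H T t N σ w.1 w.2 :=
  (hσ.comp (contDiff_fst.comp contDiff_snd)).add
    ((contDiff_pathSum (he.isTwistGF h)).of_le hn)

theorem zeroIsRegularValue_brokenGF (he : IsTwistSubdivision H T t N e)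
    (h : IsKineticHam L H b b' T R M) (hσ : ContDiff ℝ 2 σ) :
    ZeroIsRegularValue (brokenGF H T t N σ) := by
  obtain ⟨D, hD⟩ := h.isFlowOn.exists_isLinearizedFlow h.isC1Field
  exact zeroIsRegularValue_add_pathSum (he.isTwistGF h)
    (fun j => hD.contDiff h.isFlowOn h.isC1Field (he.node_mem j) (he.node_succ_mem j)) hσ

theorem segmentAction_add_intVec (he : IsTwistSubdivision H T t N e)
    (h : IsKineticHam L H b b' T R M) (j : Fin (N + 1)) (m : Fin k → ℤ) (X Y : EucSp k) :
    segmentAction H T (node t N (j + 1)) (node t N j) (X + intVec m) (Y + intVec m) =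
      segmentAction H T (node t N (j + 1)) (node t N j) X Y :=
  h.segmentAction_add_intVec (he.node_mem j) (he.node_succ_mem j) (he.twist j) m X Y

theorem zPeriodic_brokenGF_incrToParam (he : IsTwistSubdivision H T t N e)
    (h : IsKineticHam L H b b' T R M) (A : Matrix (Fin k) (Fin k) ℝ) (hσ : ZPeriodic σ) :
    ZPeriodic fun x (η : IncrSp k N) => brokenGF H T t N σ x (incrToParam A x η) :=
  zPeriodic_add_pathSum_incrToParam A (he.segmentAction_add_intVec h) hσ

theorem exists_boundedLipschitz_actionDefect (he : IsTwistSubdivision H T t N e)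
    (h : IsKineticHam L H b b' T R M) (hL : ∀ v, L' (L v) = v)
    (hL' : ∀ x y, inner ℝ (L' x) y = inner ℝ x (L' y)) (j : Fin (N + 1)) :
    ∃ C, 0 ≤ C ∧ BoundedLipschitz (actionDefect L' (t / ((N : ℝ) + 1))
      (segmentAction H T (node t N (j + 1)) (node t N j))) C C := by
  have hlt : node t N j < node t N (j + 1) :=
    strictMono_node he.mem_Ioc.1 N j.val.lt_succ_self
  obtain ⟨C, hC, hbound⟩ := h.exists_norm_actionDefect_le (he.node_mem j) (he.node_succ_mem j) hlt
    (he.twist j) (he.contDiff j).continuous (he.contDiff_symm j) hL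
  rw [← node_succ_sub t N j]
  have hbl : BoundedLipschitz (actionDefect L' (node t N (j + 1) - node t N j)
      (segmentAction H T (node t N (j + 1)) (node t N j))) C _ :=
    ⟨hbound, h.norm_sub_actionDefect_le (he.node_mem j) (he.node_succ_mem j) hlt (he.twist j)
      (he.contDiff_symm j) hL hL'⟩
  exact ⟨_, le_max_of_le_left hC, hbl.mono (le_max_left _ _) (le_max_right _ _)⟩

theorem exists_isGFQI_brokenGF {A : Matrix (Fin k) (Fin k) ℝ} (hA : A.IsSymm) (hdet : A.det ≠ 0)
    (he : IsTwistSubdivision H T t N e)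
    (h : IsKineticHam (Matrix.toEuclideanCLM (𝕜 := ℝ) A) H b b' T R M)
    (hσper : ZPeriodic σ) (hσ : ContDiff ℝ 1 σ) :
    ∃ Ψ : EucSp k → IncrSp k N → IncrSp k N,
      IsFiberedDiffeo Ψ ∧ (∃ B : ℝ, ∀ x η, ‖Ψ x η - η‖ ≤ B) ∧
      IsGFQI (fun x η => brokenGF H T t N σ x (incrToParam A x (Ψ x η)))
        (blockForm A N (t / ((N : ℝ) + 1))) (wavefront H T t σ) :=
  exists_isGFQI_add_pathSum hA hdet (div_pos he.mem_Ioc.1 N.cast_add_one_pos).ne'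
    ((contDiff_pathSum (he.isTwistGF h)).of_le one_le_two) (he.segmentAction_add_intVec h)
    (he.exists_boundedLipschitz_actionDefect h (toEuclideanCLM_inv_apply hdet)
      (inner_toEuclideanCLM_comm hA.inv)) hσper hσ
    (he.generatesSet_brokenGF h (hσ.differentiable one_ne_zero))

end IsTwistSubdivision

end TwistSubdivision

theorem theorem6p1 (k : ℕ) (T : ℝ) (hT : 0 < T)
    (A : Matrix (Fin k) (Fin k) ℝ) (hAsymm : A.IsSymm) (hAdet : A.det ≠ 0)
    (H V : ℝ → EucSp k → EucSp k → ℝ)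
    (hreg : ContDiffOn ℝ 2 (fun q : ℝ × EucSp k × EucSp k => H q.1 q.2.1 q.2.2)
      (Icc 0 T ×ˢ univ))
    (hform : ∀ t ∈ Icc 0 T, ∀ x p : EucSp k,
      H t x p = 1 / 2 * inner ℝ (WithLp.toLp 2 (A.mulVec (fun i => p i)) : EucSp k) p + V t x p)
    (hper : ∀ t ∈ Icc 0 T, ZPeriodic (V t))
    (hsupp : ∃ R : ℝ, ∀ t ∈ Icc 0 T, ∀ x p : EucSp k, R < ‖p‖ → V t x p = 0)
    (hstar : StarCondition H T) :
    HamComplete H T ∧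
    ∃ N₀ : ℕ, ∀ N : ℕ, N₀ ≤ N → ∀ t ∈ Ioc 0 T,
      (∀ j : Fin (N + 1), IsC1Diffeo (twistMap H T (node t N (j + 1)) (node t N j))) ∧
      GeneratesMap (fun X x (U : Fin N → EucSp k) => brokenAction H T t X x U)
        (hamFlow H T t 0) ∧
      ∀ σ : EucSp k → ℝ, ZPeriodic σ → ContDiff ℝ 1 σ →
        ContDiff ℝ 1 (fun w : EucSp k × (EucSp k × (Fin N → EucSp k)) =>
          brokenGF H T t N σ w.1 w.2) ∧
        GeneratesSet (brokenGF H T t N σ) (wavefront H T t σ) ∧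
        (ContDiff ℝ 2 σ →
          ContDiff ℝ 2 (fun w : EucSp k × (EucSp k × (Fin N → EucSp k)) =>
            brokenGF H T t N σ w.1 w.2) ∧
          ZeroIsRegularValue (brokenGF H T t N σ)) ∧
        ZPeriodic (fun x (η : IncrSp k N) => brokenGF H T t N σ x (incrToParam A x η)) ∧
        ∃ Ψ : EucSp k → IncrSp k N → IncrSp k N,
          IsFiberedDiffeo Ψ ∧ (∃ B : ℝ, ∀ x η, ‖Ψ x η - η‖ ≤ B) ∧
          IsGFQI (fun x η => brokenGF H T t N σ x (incrToParam A x (Ψ x η)))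
            (blockForm A N (t / ((N : ℝ) + 1))) (wavefront H T t σ) := by
  obtain ⟨R, hR⟩ := hsupp
  obtain ⟨b, b', M, h⟩ := exists_isKineticHam (inner_toEuclideanCLM_comm hAsymm) hT hreg hform
    hper hR
  obtain ⟨N₀, hN₀⟩ := h.exists_isTwistSubdivision hstar
  refine ⟨h.hamComplete, N₀, fun N hN t ht => ?_⟩
  obtain ⟨e, he⟩ := hN₀ N hN t ht
  refine ⟨he.isC1Diffeo_twistMap, he.generatesMap_brokenAction h, fun σ hσper hσ => ?_⟩
  exact ⟨he.contDiff_brokenGF h one_le_two hσ,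
    he.generatesSet_brokenGF h (hσ.differentiable one_ne_zero),
    fun hσ2 => ⟨he.contDiff_brokenGF h le_rfl hσ2, he.zeroIsRegularValue_brokenGF h hσ2⟩,
    he.zPeriodic_brokenGF_incrToParam h A hσper, he.exists_isGFQI_brokenGF hAsymm hAdet h hσper hσ⟩
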